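/- Let $I\subset\mathbb{R}$ be open, let $F,C:I\to(0,\infty)$ be smooth functions of $z\in I$, and let $\eta^1,\eta^2,\eta^3$ be the left-invariant coframe on $\mathbb{S}^3=SU(2)$ (the unit quaternions) given by $q^{-1}dq=\eta^1 i+\eta^2 j+\eta^3 k$, so that $d\eta^1=-2\eta^2\wedge\eta^3$ and cyclically. In any local coordinates on $I\times\mathbb{S}^3$, consider the Riemannian metric $$g=C\Big(\tfrac{1}{4F}dz^2+F(\eta^1)^2+(\eta^2)^2+(\eta^3)^2\Big)$$ with the orthonormal coframe $\sigma^0=\sqrt{C/(4F)}\,dz$, $\sigma^1=\sqrt{CF}\,\eta^1$, $\sigma^2=\sqrt C\,\eta^2$, $\sigma^3=\sqrt C\,\eta^3$ and the orientation $\sigma^0\wedge\sigma^1\wedge\sigma^2\wedge\sigma^3>0$. With $\{\partial_z,e_1,e_2,e_3\}$ the frame dual to $\{dz,\eta^1,\eta^2,\eta^3\}$, put $$J^\pm=\mp2F\,\partial_z\otimes\eta^1\pm\tfrac1{2F}\,e_1\otimes dz-e_2\otimes\eta^3+e_3\otimes\eta^2,\qquad \omega^\pm=g(J^\pm\cdot,\cdot),$$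 $$\mathcal{L}^\pm=\Big(\mp\tfrac12\tfrac{d}{dz}+1\Big)\Big(\mp\tfrac{d}{dz}+1\Big),$$ $$\mathcal{B}(F,F)=\big(-\tfrac12F_{zz}+\tfrac32F_z+F-1\big)\big(\mathcal{L}^+F-1\big)+F_z\big(\mathcal{L}^+F\big)_z .$$ Conventions: $\mathrm{Rm}(a,b,c,d)=g(R(a,b)d,c)$ with $R(a,b)=[\nabla_a,\nabla_b]-\nabla_{[a,b]}$, $\mathrm{Ric}_{bd}=g^{ac}\mathrm{Rm}_{abcd}$, $W$ is the Weyl tensor as a $(0,4)$-tensor, $W^\pm=\frac12(W\pm *W)$, $\delta$ is the divergence $(\delta T)_{b\cdots}=\nabla^aT_{ab\cdots}$, $\mathrm{Bach}_{ij}=\nabla^l\nabla^kW_{ikjl}+\frac12\mathrm{Ric}^{kl}W_{ikjl}$, and $Id_{\bigwedge^\pm}$ is the $(0,4)$-tensor $(Id_{\bigwedge^\pm})_{abcd}=\frac12(g_{ac}g_{bd}-g_{ad}g_{bc}\pm\mathrm{vol}_{abcd})$. Then: 1. The scalar curvature is $$s=-4C^{-1}\Big(F_{zz}+\tfrac12F-2\Big)-24C^{-\frac32}\big(F\,(C^{\frac12})_z\big)_z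 .$$ 2. The trace-free Ricci tensor $\mathrm{Ric}-\frac s4g$ equals $$4FC^{-\frac12}\Big((C^{-\frac12})_{zz}-\tfrac14C^{-\frac12}\Big)\big((\sigma^0)^2-(\sigma^1)^2\big)+2\Big(C^{-\frac12}\big(F(C^{-\frac12})_z\big)_z-C^{-1}\big(\tfrac12F_{zz}-\tfrac34F+1\big)\Big)\big((\sigma^0)^2+(\sigma^1)^2-(\sigma^2)^2-(\sigma^3)^2\big).$$ 3. The Weyl curvatures are $$W^\pm=-C^{-1}\big(\mathcal{L}^\pm F-1\big)\Big(\omega^\pm\otimes\omega^\pm-\tfrac23Id_{\bigwedge^\pm}\Big).$$ 4. At every point where $\mathcal{L}^\pm F\ne1$, $$\delta W^\pm=W^\pm\Big(\nabla\log\big|e^{\pm\frac32z}(\mathcal{L}^\pm F-1)\sqrt C\big|,\cdot,\cdot,\cdot\Big),$$ and at every point (including those where $\mathcal{L}^\pm F=1$) $$\delta W^\pm=-C^{-\frac32}e^{\mp\frac32z}\Big(\omega^\pm\otimes\omega^\pm-\tfrac23Id_{\bigwedge^\pm}\Big)\Big(\nabla\big(e^{\pm\frac32z}(\mathcal{L}^\pm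 F-1)\sqrt C\big),\cdot,\cdot,\cdot\Big).$$ 5. The Bach tensor is $$\mathrm{Bach}=\frac{16}{3C^2}F\big(\mathcal{L}^-(\mathcal{L}^+F)-1\big)\big(-2(\sigma^1)^2+(\sigma^2)^2+(\sigma^3)^2\big)+\frac{8}{3C^2}\mathcal{B}(F,F)\big(-(\sigma^0)^2-(\sigma^1)^2+(\sigma^2)^2+(\sigma^3)^2\big).$$ 6. If $g$ is Kähler with respect to $J^+$ (that is, $J^+$ is an integrable $g$-compatible almost complex structure and $d\omega^+=0$) on a connected open set, then $C=C_0e^{-z}$ there for some constant $C_0>0$. If $g$ is Kähler with respect to $J^+$, or if $C=C_0e^{-z}$ with a constant $C_0>0$, on an open set, then there the scalar curvature and the Ricci form $\rho=\mathrm{Ric}(J^+\cdot,\cdot)$ are $$s=-\frac8C\big(\mathcal{L}^+F-1\big),\qquad \rho=-\frac2C\big(\mathcal{L}^+F-1\big)\omega^+-\frac2C\Big[\Big(-\tfrac12\tfrac{d}{dz}+1\Big)\Big(\tfrac{d}{dz}+1\Big)F-1\Big]\omega^- .$$ -/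

import Mathlib

open scoped ContDiff

noncomputable section

namespace U2Metric

/-! ## Riemannian geometry in a coordinate chart of a 4-manifold -/

/-- The coordinate space of a chart; only its structure as a vector space matters. -/
abbrev Coord := Fin 4 → ℝ

/-- The coordinate vector field `∂ / ∂ x i`. -/
def basisVec (i : Fin 4) : Coord := Pi.single i 1

/-- A covariant tensor field of rank `n` : at a point, a function of `n` tangent vectors. All the
tensor fields below are multilinear in these vectors. -/
abbrev CovTensor (n : ℕ) := Coord → (Fin n → Coord) → ℝ

/-- The matrix of the components `g i j` of the metric. -/
def gram (g : CovTensor 2) (x : Coord) : Matrix (Fin 4) (Fin 4) ℝ :=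
  Matrix.of fun i j => g x ![basisVec i, basisVec j]

/-- The metric trace `∑ g^{ij} B(∂_i, ∂_j)` of a bilinear form on the tangent space at `x`. -/
def metricTrace (g : CovTensor 2) (x : Coord) (B : Coord → Coord → ℝ) : ℝ :=
  ∑ i, ∑ j, (gram g x)⁻¹ i j * B (basisVec i) (basisVec j)

/-- The gradient vector field of a function. -/
def grad (g : CovTensor 2) (φ : Coord → ℝ) (x : Coord) : Coord :=
  fun i => ∑ j, (gram g x)⁻¹ i j * fderiv ℝ φ x (basisVec j)

/-- The Christoffel symbols of the Levi-Civita connection, as a vector valued bilinear map: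
`christoffel g x u v` is the value at `x` of `∇_u v` for the vector fields with constant
components `u` and `v`. -/
def christoffel (g : CovTensor 2) (x u v : Coord) : Coord :=
  fun k => ∑ l, (gram g x)⁻¹ k l *
    ((1 / 2) * (fderiv ℝ (fun y => g y ![v, basisVec l]) x u
      + fderiv ℝ (fun y => g y ![u, basisVec l]) x v
      - fderiv ℝ (fun y => g y ![u, v]) x (basisVec l)))

/-- The covariant derivative of a covariant tensor field:
`(∇ T)(a, v₁, …, vₙ) = (∇_a T)(v₁, …, vₙ)`, the direction of differentiation coming first. -/
def covDeriv {n : ℕ} (g : CovTensor 2) (T : CovTensor n) : CovTensor (n + 1) :=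
  fun x v => fderiv ℝ (fun y => T y (Fin.tail v)) x (v 0)
    - ∑ p : Fin n, T x (Function.update (Fin.tail v) p (christoffel g x (v 0) (Fin.tail v p)))

/-- The divergence `(δ T)(v₁, …, vₙ) = ∑ g^{ij} (∇_i T)(∂_j, v₁, …, vₙ)`. -/
def divergence {n : ℕ} (g : CovTensor 2) (T : CovTensor (n + 1)) : CovTensor n :=
  fun x v => metricTrace g x fun a b =>
    covDeriv g T x (Fin.cons a (Fin.cons b v : Fin (n + 1) → Coord))

/-- The curvature endomorphism `R(u, v) w = ∇_u ∇_v w - ∇_v ∇_u w - ∇_[u,v] w`, written out for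
vector fields with constant components (whose brackets vanish). -/
def curvOp (g : CovTensor 2) (x u v w : Coord) : Coord :=
  fderiv ℝ (fun y => christoffel g y v w) x u - fderiv ℝ (fun y => christoffel g y u w) x v
    + christoffel g x u (christoffel g x v w) - christoffel g x v (christoffel g x u w)

/-- The Riemann tensor `Rm(a, b, c, d) = g(R(a, b) d, c)`; on a round sphere
`Rm(a, b, a, b) > 0` for independent `a`, `b`. -/
def riemann (g : CovTensor 2) : CovTensor 4 :=
  fun x v => g x ![curvOp g x (v 0) (v 1) (v 3), v 2]

/-- The Ricci tensor `Ric(b, d) = tr_g Rm(·, b, ·, d)`. -/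
def ricci (g : CovTensor 2) : CovTensor 2 :=
  fun x v => metricTrace g x fun a c => riemann g x ![a, v 0, c, v 1]

/-- The scalar curvature. -/
def scalarCurv (g : CovTensor 2) (x : Coord) : ℝ :=
  metricTrace g x fun a b => ricci g x ![a, b]

/-- The trace-free Ricci tensor, in dimension 4. -/
def tracefreeRicci (g : CovTensor 2) : CovTensor 2 :=
  fun x v => ricci g x v - scalarCurv g x / 4 * g x v

/-- The Weyl tensor, in dimension 4. -/
def weyl (g : CovTensor 2) : CovTensor 4 :=
  fun x v => riemann g x v
    - (1 / 2) * (ricci g x ![v 0, v 2] * g x ![v 1, v 3]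
        - ricci g x ![v 0, v 3] * g x ![v 1, v 2]
        + ricci g x ![v 1, v 3] * g x ![v 0, v 2]
        - ricci g x ![v 1, v 2] * g x ![v 0, v 3])
    + scalarCurv g x / 6 * (g x ![v 0, v 2] * g x ![v 1, v 3] - g x ![v 0, v 3] * g x ![v 1, v 2])

/-- The Hodge star of the metric and the volume form `vol`, on the first pair of indices:
`(∗T)_{abcd} = (1/2) vol_{ab}^{kl} T_{klcd}`. -/
def hodgeLeft (g : CovTensor 2) (vol T : CovTensor 4) : CovTensor 4 :=
  fun x v => (1 / 2) * metricTrace g x fun k k' => metricTrace g x fun l l' =>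
    vol x ![v 0, v 1, k, l] * T x ![k', l', v 2, v 3]

/-- The part `W^+` (for `ε = 1`) or `W^-` (for `ε = -1`) of the Weyl tensor, `(W + ε ∗W) / 2`. -/
def weylPart (ε : ℝ) (g : CovTensor 2) (vol : CovTensor 4) : CovTensor 4 :=
  fun x v => (1 / 2) * (weyl g x v + ε * hodgeLeft g vol (weyl g) x v)

/-- The orthogonal projection of 2-forms onto `Λ^+` or `Λ^-` (the identity of `Λ^±`, extended by
zero), as a tensor of rank 4, with the inner product of 2-forms in which `σ^a ∧ σ^b` has length 1
for an orthonormal coframe. -/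
def idForms (ε : ℝ) (g : CovTensor 2) (vol : CovTensor 4) : CovTensor 4 :=
  fun x v => (1 / 2) * (g x ![v 0, v 2] * g x ![v 1, v 3] - g x ![v 0, v 3] * g x ![v 1, v 2]
    + ε * vol x v)

/-- The Bach tensor `Bach_{ij} = ∇^l ∇^k W_{ikjl} + (1/2) Ric^{kl} W_{ikjl}`. -/
def bach (g : CovTensor 2) : CovTensor 2 :=
  fun x v =>
    (metricTrace g x fun k k' => metricTrace g x fun l l' =>
      covDeriv g (covDeriv g (weyl g)) x ![l', k', v 0, k, v 1, l])
    + (1 / 2) * (metricTrace g x fun k k' => metricTrace g x fun l l' =>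
      ricci g x ![k', l'] * weyl g x ![v 0, k, v 1, l])

/-- The exterior derivative of a 2-form. -/
def extD (β : CovTensor 2) : CovTensor 3 :=
  fun x v => fderiv ℝ (fun y => β y ![v 1, v 2]) x (v 0)
    + fderiv ℝ (fun y => β y ![v 2, v 0]) x (v 1)
    + fderiv ℝ (fun y => β y ![v 0, v 1]) x (v 2)

/-- The Nijenhuis tensor `[Ju, Jv] - J[Ju, v] - J[u, Jv] - [u, v]`; on vector fields with constant
components the last bracket vanishes. -/
def nijenhuis (J : Coord → Coord → Coord) (x u v : Coord) : Coord :=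
  VectorField.lieBracket ℝ (fun y => J y u) (fun y => J y v) x
    - J x (VectorField.lieBracket ℝ (fun y => J y u) (fun _ => v) x)
    - J x (VectorField.lieBracket ℝ (fun _ => u) (fun y => J y v) x)

/-- The 2-form `g(J·, ·)`. -/
def formOf (g : CovTensor 2) (J : Coord → Coord → Coord) : CovTensor 2 :=
  fun x v => g x ![J x (v 0), v 1]

/-- `g` is a Kähler metric with respect to `J` on `U`: `J` is an integrable almost complex
structure, compatible with `g`, and the 2-form `g(J·, ·)` is closed. -/
structure IsKahlerOn (U : Set Coord) (g : CovTensor 2) (J : Coord → Coord → Coord) : Prop where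
  sq : ∀ x ∈ U, ∀ u, J x (J x u) = -u
  compatible : ∀ x ∈ U, ∀ u v, g x ![J x u, J x v] = g x ![u, v]
  integrable : ∀ x ∈ U, ∀ u v, nijenhuis J x u v = 0
  closed : ∀ x ∈ U, ∀ v, extD (formOf g J) x v = 0

/-! ## The metrics on `I × S³` -/

/-- `(z, q) : U → I × S³` is a local diffeomorphism onto an open part of `I × S³`, where `S³` is the
group of unit quaternions. (The inverse of any chart of
`I × S³` has this form; so every coordinate system is allowed.) -/
structure IsLocalDiffeo (I : Set ℝ) (U : Set Coord) (z : Coord → ℝ) (q : Coord → Quaternion ℝ) :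
    Prop where
  smooth_z : ContDiffOn ℝ ∞ z U
  smooth_q : ContDiffOn ℝ ∞ q U
  mem : ∀ x ∈ U, z x ∈ I
  unit : ∀ x ∈ U, ‖q x‖ = 1
  immersion : ∀ x ∈ U, Function.Injective (fderiv ℝ (fun y => (z y, q y)) x)

/-- The Maurer-Cartan form `q⁻¹ dq` of the group of unit quaternions (there `q⁻¹` is the
conjugate of `q`); it is left-invariant. -/
def maurerCartan (q : Coord → Quaternion ℝ) (x v : Coord) : Quaternion ℝ :=
  star (q x) * fderiv ℝ q x v

/-- The coframe `dz, η¹, η², η³`, where `q⁻¹ dq = η¹ i + η² j + η³ k`, so that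
`dη¹ = -2 η² ∧ η³` and cyclically. -/
def coframe (z : Coord → ℝ) (q : Coord → Quaternion ℝ) (a : Fin 4) (x v : Coord) : ℝ :=
  ![fderiv ℝ z x v, (maurerCartan q x v).imI, (maurerCartan q x v).imJ, (maurerCartan q x v).imK] a

/-- The frame `∂/∂z, e₁, e₂, e₃` dual to `dz, η¹, η², η³`. -/
def frame (z : Coord → ℝ) (q : Coord → Quaternion ℝ) (a : Fin 4) (x : Coord) : Coord :=
  fun i => (Matrix.of fun (b j : Fin 4) => coframe z q b x (basisVec j))⁻¹ i a

/-- The metric `g = C (dz² / (4F) + F (η¹)² + (η²)² + (η³)²)`. -/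
def metric (F C : ℝ → ℝ) (z : Coord → ℝ) (q : Coord → Quaternion ℝ) : CovTensor 2 :=
  fun x v => C (z x) *
    (1 / (4 * F (z x)) * (coframe z q 0 x (v 0) * coframe z q 0 x (v 1))
      + F (z x) * (coframe z q 1 x (v 0) * coframe z q 1 x (v 1))
      + coframe z q 2 x (v 0) * coframe z q 2 x (v 1)
      + coframe z q 3 x (v 0) * coframe z q 3 x (v 1))

/-- The unit coframe `σ⁰ = √(C/(4F)) dz`, `σ¹ = √(CF) η¹`, `σ² = √C η²`, `σ³ = √C η³`. -/
def unitCoframe (F C : ℝ → ℝ) (z : Coord → ℝ) (q : Coord → Quaternion ℝ) (a : Fin 4)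
    (x v : Coord) : ℝ :=
  ![√(C (z x) / (4 * F (z x))), √(C (z x) * F (z x)), √(C (z x)), √(C (z x))] a
    * coframe z q a x v

/-- The symmetric square `(σ^a)²`. -/
def sigmaSq (F C : ℝ → ℝ) (z : Coord → ℝ) (q : Coord → Quaternion ℝ) (a : Fin 4) : CovTensor 2 :=
  fun x v => unitCoframe F C z q a x (v 0) * unitCoframe F C z q a x (v 1)

/-- The volume form `σ⁰ ∧ σ¹ ∧ σ² ∧ σ³` of the metric, for the orientation given by `J⁺`. -/
def volForm (F C : ℝ → ℝ) (z : Coord → ℝ) (q : Coord → Quaternion ℝ) : CovTensor 4 :=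
  fun x v => (Matrix.of fun a b : Fin 4 => unitCoframe F C z q a x (v b)).det

/-- The complex structures `J^±` (for `ε = ±1`):
`J^± = ∓ 2F ∂/∂z ⊗ η¹ ± (1/(2F)) e₁ ⊗ dz - e₂ ⊗ η³ + e₃ ⊗ η²`. -/
def complexStr (ε : ℝ) (F : ℝ → ℝ) (z : Coord → ℝ) (q : Coord → Quaternion ℝ)
    (x v : Coord) : Coord :=
  (-ε * 2 * F (z x) * coframe z q 1 x v) • frame z q 0 x
    + (ε * (1 / (2 * F (z x))) * coframe z q 0 x v) • frame z q 1 x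
    - coframe z q 3 x v • frame z q 2 x
    + coframe z q 2 x v • frame z q 3 x

/-- The (1,1)-forms `ω^± = g(J^±·, ·)`. -/
def omega (ε : ℝ) (F C : ℝ → ℝ) (z : Coord → ℝ) (q : Coord → Quaternion ℝ) : CovTensor 2 :=
  formOf (metric F C z q) (complexStr ε F z q)

/-- The tensor `ω^± ⊗ ω^± - (2/3) Id` of rank 4. -/
def weylModel (ε : ℝ) (F C : ℝ → ℝ) (z : Coord → ℝ) (q : Coord → Quaternion ℝ) : CovTensor 4 :=
  fun x v => omega ε F C z q x ![v 0, v 1] * omega ε F C z q x ![v 2, v 3]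
    - (2 / 3) * idForms ε (metric F C z q) (volForm F C z q) x v

/-- The Ricci form `ρ = Ric(J^+·, ·)`. -/
def ricciForm (F C : ℝ → ℝ) (z : Coord → ℝ) (q : Coord → Quaternion ℝ) : CovTensor 2 :=
  fun x v => ricci (metric F C z q) x ![complexStr 1 F z q x (v 0), v 1]

/-! ## The ordinary differential operators -/

/-- The operator `c d/dz + 1`. -/
def firstOrder (c : ℝ) (f : ℝ → ℝ) : ℝ → ℝ := fun t => c * deriv f t + f t

/-- The operators `𝓛^± = (∓ (1/2) d/dz + 1)(∓ d/dz + 1)` (for `ε = ±1`). -/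
def opL (ε : ℝ) (f : ℝ → ℝ) : ℝ → ℝ := firstOrder (-ε / 2) (firstOrder (-ε) f)

/-- The operator `𝓑(F, F) = (-F''/2 + 3F'/2 + F - 1)(𝓛⁺F - 1) + F' (𝓛⁺F)'`. -/
def opB (F : ℝ → ℝ) : ℝ → ℝ := fun t =>
  (-(1 / 2) * deriv (deriv F) t + (3 / 2) * deriv F t + F t - 1) * (opL 1 F t - 1)
    + deriv F t * deriv (opL 1 F) t

/-- The function `e^{± 3z/2} (𝓛^± F - 1) √C` of `z`. -/
def divPotential (ε : ℝ) (F C : ℝ → ℝ) : ℝ → ℝ := fun t =>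
  Real.exp (ε * (3 / 2) * t) * (opL ε F t - 1) * √(C t)

end U2Metric

end

open U2Metric

/-! Right translations of S³ by i, j, k change the signs of η¹, η², η³ in pairs, hence preserve g.
The frame E_a dual to θ = (dz/(2F), η¹, η², η³) transforms by the four characters of the Klein
four-group that these symmetries induce. Label them by `Fin 4` with product `klein`. Invariance then
forces ∇_{E_a} E_b = γ_ab E_{ab}, and left invariance makes γ_ab a function of z alone. So the
Levi-Civita connection is a 4×4 table of functions (`conn`), and R(E_a, E_b) E_d is a multiple of
E_{abd} whose coefficient is quadratic in γ and linear in dγ/dz (`curvComp`).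

The factor 1/(2F) in θ⁰ gives g the diagonal entries C·(F, F, 1, 1) and makes J^± constant matrices,
so no square roots occur: with p = C'/C, all components are rational in F, C, p and their
derivatives. Tensors are handled through their components (`HasComp`). If these are functions of z,
so are those of the covariant derivative (`KleinConnection.hasComp_covDeriv`), and traces are
weighted sums (`HasComp.trace`). Every assertion thereby becomes finitely many identities between
rational functions.

The Weyl tensor is a combination of the two tensors ω^± ⊗ ω^± - (2/3) Id (`weylComp_eq`). The Hodge
star acts on them by ±1 (`hodge_modelComp`), which separates W^+ from W^-. The divergence of W^± is
a contraction with E_0 (`trace_covComp_model`), and its coefficient is the derivative of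
e^{±3z/2}(𝓛^±F - 1)√C up to the factor e^{±3z/2}√C. For the Bach tensor, the inner trace commutes
with ∇ because g is parallel (`trace_covComp`); what remains is a divergence of a tensor of rank 3
plus a Ricci term, and p cancels, as conformal covariance demands (`bach_comp`).

For the Kähler statements, dω^+(E_0, E_2, E_3) = 2F(C' + C), so closedness forces C' = -C. Then p =
-1 and p' = 0 are substituted into the general curvature formulas. -/

namespace U2Metric

/-! ## Components of multilinear forms with respect to a coframe -/

/-- The matrix of a coframe in the coordinate basis. -/
def coframeMatrix (ϑ : Fin 4 → Coord →L[ℝ] ℝ) : Matrix (Fin 4) (Fin 4) ℝ :=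
  Matrix.of fun a j => ϑ a (basisVec j)

/-- The vector `E_a` of the frame dual to a coframe. -/
noncomputable def dualVec (ϑ : Fin 4 → Coord →L[ℝ] ℝ) (a : Fin 4) : Coord :=
  fun i => (coframeMatrix ϑ)⁻¹ i a

/-- `τ` is the family of components of the multilinear form `T` in the coframe `ϑ`. -/
def HasComp (ϑ : Fin 4 → Coord →L[ℝ] ℝ) {n : ℕ} (T : (Fin n → Coord) → ℝ)
    (τ : (Fin n → Fin 4) → ℝ) : Prop :=
  ∀ v, T v = ∑ b, τ b * ∏ p, ϑ (b p) (v p)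

theorem sum_smul_basisVec (v : Coord) : ∑ i, v i • basisVec i = v := by
  ext j
  simp [basisVec, Pi.single_apply, Finset.sum_apply]

theorem clm_apply_eq_sum (l : Coord →L[ℝ] ℝ) (v : Coord) : l v = ∑ i, v i * l (basisVec i) := by
  conv_lhs => rw [← sum_smul_basisVec v]
  simp

theorem coframeMatrix_mulVec (ϑ : Fin 4 → Coord →L[ℝ] ℝ) (v : Coord) (a : Fin 4) :
    (coframeMatrix ϑ).mulVec v a = ϑ a v := by
  symm
  rw [clm_apply_eq_sum]
  exact Finset.sum_congr rfl fun i _ => mul_comm _ _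

section Pointwise

variable {ϑ : Fin 4 → Coord →L[ℝ] ℝ} {n : ℕ}

theorem coframe_dualVec (h : IsUnit (coframeMatrix ϑ).det) (a b : Fin 4) :
    ϑ a (dualVec ϑ b) = if a = b then 1 else 0 := by
  have := congrFun (congrFun (Matrix.mul_nonsing_inv _ h) a) b
  rw [Matrix.mul_apply, Matrix.one_apply] at this
  rw [← this, clm_apply_eq_sum]
  exact Finset.sum_congr rfl fun i _ => mul_comm _ _

theorem sum_coframe_smul_dualVec (h : IsUnit (coframeMatrix ϑ).det) (v : Coord) :
    ∑ a, ϑ a v • dualVec ϑ a = v := by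
  ext i
  have h2 : (coframeMatrix ϑ)⁻¹.mulVec ((coframeMatrix ϑ).mulVec v) = v := by
    rw [Matrix.mulVec_mulVec, Matrix.nonsing_inv_mul _ h, Matrix.one_mulVec]
  rw [← congrFun h2 i, Finset.sum_apply]
  simp only [← coframeMatrix_mulVec, Pi.smul_apply, smul_eq_mul, dualVec]
  exact Finset.sum_congr rfl fun i _ => mul_comm _ _

theorem sum_fin_cons {α M : Type*} [Fintype α] [AddCommMonoid M] (f : (Fin (n + 1) → α) → M) :
    ∑ b, f b = ∑ a, ∑ b : Fin n → α, f (Fin.cons a b) := by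
  rw [← Fintype.sum_prod_type', ← (Fin.consEquiv fun _ => α).sum_comp]
  rfl

/-- Only the multi-index `b` survives on dual vectors. This isolates a single component, as is
needed for `dω`. -/
theorem HasComp.apply_dualVec (h : IsUnit (coframeMatrix ϑ).det) {T : (Fin n → Coord) → ℝ}
    {τ : (Fin n → Fin 4) → ℝ} (hT : HasComp ϑ T τ) (b : Fin n → Fin 4) :
    T (fun p => dualVec ϑ (b p)) = τ b := by
  rw [hT, Finset.sum_eq_single b]
  · simp [coframe_dualVec h]
  · intro c _ hc
    obtain ⟨p, hp⟩ := Function.ne_iff.mp hc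
    rw [Finset.prod_eq_zero (Finset.mem_univ p), mul_zero]
    rw [coframe_dualVec h, if_neg hp]
  · simp

theorem HasComp.congr {T : (Fin n → Coord) → ℝ} {τ σ : (Fin n → Fin 4) → ℝ}
    (hT : HasComp ϑ T τ) (h : ∀ b, τ b = σ b) : HasComp ϑ T σ := by
  rwa [← funext h]

theorem HasComp.eq {S T : (Fin n → Coord) → ℝ} {τ : (Fin n → Fin 4) → ℝ}
    (hS : HasComp ϑ S τ) (hT : HasComp ϑ T τ) (v : Fin n → Coord) : S v = T v := by
  rw [hS, hT]

theorem HasComp.add {S T : (Fin n → Coord) → ℝ} {σ τ : (Fin n → Fin 4) → ℝ}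
    (hS : HasComp ϑ S σ) (hT : HasComp ϑ T τ) :
    HasComp ϑ (fun v => S v + T v) (fun b => σ b + τ b) := fun v => by
  simp only [hS v, hT v, add_mul, Finset.sum_add_distrib]

theorem HasComp.sub {S T : (Fin n → Coord) → ℝ} {σ τ : (Fin n → Fin 4) → ℝ}
    (hS : HasComp ϑ S σ) (hT : HasComp ϑ T τ) :
    HasComp ϑ (fun v => S v - T v) (fun b => σ b - τ b) := fun v => by
  simp only [hS v, hT v, sub_mul, Finset.sum_sub_distrib]

theorem HasComp.const_mul {T : (Fin n → Coord) → ℝ} {τ : (Fin n → Fin 4) → ℝ}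
    (hT : HasComp ϑ T τ) (c : ℝ) :
    HasComp ϑ (fun v => c * T v) (fun b => c * τ b) := fun v => by
  simp only [hT v, Finset.mul_sum, mul_assoc]

/-- `HasComp.trace` contracts the two leading slots only; a permutation of the slots brings every
other contraction to that form. -/
theorem HasComp.reindex {m : ℕ} {T : (Fin m → Coord) → ℝ} {τ : (Fin m → Fin 4) → ℝ}
    (hT : HasComp ϑ T τ) (s : Fin m → Fin n) (hs : Function.Bijective s) :
    HasComp ϑ (fun v => T (v ∘ s)) (fun b => τ (b ∘ s)) := fun v => by
  beta_reduce
  rw [hT, ← ((Equiv.ofBijective s hs).arrowCongr (Equiv.refl (Fin 4))).symm.sum_comp]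
  refine Finset.sum_congr rfl fun b _ => ?_
  rw [← (Equiv.ofBijective s hs).prod_comp]
  rfl

theorem HasComp.tensor {m : ℕ} {S : (Fin m → Coord) → ℝ} {σ : (Fin m → Fin 4) → ℝ}
    {T : (Fin n → Coord) → ℝ} {τ : (Fin n → Fin 4) → ℝ}
    (hS : HasComp ϑ S σ) (hT : HasComp ϑ T τ) :
    HasComp ϑ (fun v : Fin (m + n) → Coord =>
        S (fun i => v (Fin.castAdd n i)) * T (fun i => v (Fin.natAdd m i)))
      (fun b => σ (fun i => b (Fin.castAdd n i)) * τ (fun i => b (Fin.natAdd m i))) := fun v => by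
  beta_reduce
  rw [hS, hT, Finset.sum_mul_sum, ← Fintype.sum_prod_type', ← (Fin.appendEquiv m n).sum_comp]
  refine Finset.sum_congr rfl fun b _ => ?_
  rw [Fin.prod_univ_add]
  simp only [Fin.appendEquiv, Equiv.coe_fn_mk, Fin.append_left, Fin.append_right]
  ring

/-- The metric `g` is, at the point `x`, diagonal in the coframe `ϑ`. -/
structure IsDiag (g : CovTensor 2) (x : Coord) (ϑ : Fin 4 → Coord →L[ℝ] ℝ) (h : Fin 4 → ℝ) :
    Prop where
  det : IsUnit (coframeMatrix ϑ).det
  ne : ∀ a, h a ≠ 0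
  eq : ∀ u v, g x ![u, v] = ∑ a, h a * (ϑ a u * ϑ a v)

variable {g : CovTensor 2} {x : Coord} {h : Fin 4 → ℝ}

/-- With Θ the coframe matrix and D the diagonal one, the Gram matrix is ΘᵀDΘ, and its inverse is
Θ⁻¹D⁻¹Θ⁻ᵀ, where the columns of Θ⁻¹ are the dual vectors. -/
theorem IsDiag.gram_inv (hd : IsDiag g x ϑ h) (i j : Fin 4) :
    (gram g x)⁻¹ i j = ∑ a, (h a)⁻¹ * (dualVec ϑ a i * dualVec ϑ a j) := by
  set Θ := coframeMatrix ϑ with hΘ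
  have h1 : gram g x = Θ.transpose * Matrix.diagonal h * Θ := by
    ext i j
    rw [gram, Matrix.of_apply, hd.eq, Matrix.mul_apply]
    refine Finset.sum_congr rfl fun a _ => ?_
    rw [Matrix.mul_diagonal, Matrix.transpose_apply]
    simp only [hΘ, coframeMatrix, Matrix.of_apply]
    ring
  have h2 : (gram g x)⁻¹ = Θ⁻¹ * Matrix.diagonal (fun a => (h a)⁻¹) * Θ⁻¹.transpose := by
    apply Matrix.inv_eq_right_inv
    have e1 : Θ * Θ⁻¹ = 1 := Matrix.mul_nonsing_inv _ hd.det
    have e2 : Θ.transpose * Θ⁻¹.transpose = 1 := by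
      rw [← Matrix.transpose_mul, Matrix.nonsing_inv_mul _ hd.det, Matrix.transpose_one]
    have e3 : Matrix.diagonal h * Matrix.diagonal (fun a => (h a)⁻¹) = 1 := by
      rw [Matrix.diagonal_mul_diagonal, ← Matrix.diagonal_one]
      congr 1
      ext a
      exact mul_inv_cancel₀ (hd.ne a)
    calc gram g x * (Θ⁻¹ * Matrix.diagonal (fun a => (h a)⁻¹) * Θ⁻¹.transpose)
        = Θ.transpose * (Matrix.diagonal h * ((Θ * Θ⁻¹) * Matrix.diagonal (fun a => (h a)⁻¹)))
            * Θ⁻¹.transpose := by rw [h1]; simp only [Matrix.mul_assoc]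
      _ = 1 := by rw [e1, Matrix.one_mul, e3, Matrix.mul_one, e2]
  rw [h2, Matrix.mul_apply]
  refine Finset.sum_congr rfl fun a _ => ?_
  rw [Matrix.mul_diagonal, Matrix.transpose_apply]
  simp only [dualVec, ← hΘ]
  ring

theorem sum_dualVec_mul (hd : IsUnit (coframeMatrix ϑ).det) (a b : Fin 4) :
    ∑ i, dualVec ϑ a i * ϑ b (basisVec i) = if b = a then 1 else 0 := by
  rw [← clm_apply_eq_sum, coframe_dualVec hd]

theorem IsDiag.metricTrace_mul (hd : IsDiag g x ϑ h) (b c : Fin 4) :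
    metricTrace g x (fun u v => ϑ b u * ϑ c v) = if b = c then (h b)⁻¹ else 0 := by
  have : metricTrace g x (fun u v => ϑ b u * ϑ c v)
      = ∑ a, (h a)⁻¹ * ((∑ i, dualVec ϑ a i * ϑ b (basisVec i))
        * (∑ j, dualVec ϑ a j * ϑ c (basisVec j))) := by
    simp only [metricTrace, hd.gram_inv, Finset.mul_sum, Finset.sum_mul]
    simp only [Finset.sum_comm (s := Finset.univ (α := Fin 4)) (t := Finset.univ (α := Fin 4))
      (f := fun j a => (h a)⁻¹ * (dualVec ϑ a _ * dualVec ϑ a j) * _)]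
    rw [Finset.sum_comm]
    refine Finset.sum_congr rfl fun a _ => ?_
    rw [Finset.sum_comm]
    refine Finset.sum_congr rfl fun i _ => Finset.sum_congr rfl fun j _ => ?_
    ring
  rw [this]
  simp only [sum_dualVec_mul hd.det]
  by_cases hbc : b = c
  · subst hbc; simp
  · rw [if_neg hbc]
    refine Finset.sum_eq_zero fun a _ => ?_
    by_cases h1 : b = a
    · rw [if_neg (fun h2 => hbc (h1.trans h2.symm) : ¬ c = a)]; simp
    · simp [h1]

theorem metricTrace_sum {ι : Type*} (s : Finset ι) (B : ι → Coord → Coord → ℝ) :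
    metricTrace g x (fun u v => ∑ i ∈ s, B i u v) = ∑ i ∈ s, metricTrace g x (B i) := by
  simp only [metricTrace, Finset.mul_sum]
  rw [Finset.sum_comm (s := s)]
  exact Finset.sum_congr rfl fun i _ => Finset.sum_comm

theorem metricTrace_mul_left (c : ℝ) (B : Coord → Coord → ℝ) :
    metricTrace g x (fun u v => c * B u v) = c * metricTrace g x B := by
  simp only [metricTrace, Finset.mul_sum]
  exact Finset.sum_congr rfl fun i _ => Finset.sum_congr rfl fun j _ => by ring

theorem HasComp.trace (hd : IsDiag g x ϑ h) {S : (Fin (n + 2) → Coord) → ℝ}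
    {σ : (Fin (n + 2) → Fin 4) → ℝ} (hS : HasComp ϑ S σ) :
    HasComp ϑ (fun v => metricTrace g x fun a c => S (Fin.cons a (Fin.cons c v)))
      (fun b => ∑ a, (h a)⁻¹ * σ (Fin.cons a (Fin.cons a b))) := fun v => by
  have h1 : (fun u w => S (Fin.cons u (Fin.cons w v)))
      = fun u w => ∑ a, ∑ c, ∑ b : Fin n → Fin 4,
        (σ (Fin.cons a (Fin.cons c b)) * ∏ p, ϑ (b p) (v p)) * (ϑ a u * ϑ c w) := by
    funext u w
    rw [hS, sum_fin_cons]
    refine Finset.sum_congr rfl fun a _ => ?_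
    rw [sum_fin_cons]
    refine Finset.sum_congr rfl fun c _ => Finset.sum_congr rfl fun b _ => ?_
    rw [Fin.prod_univ_succ, Fin.prod_univ_succ]
    simp only [Fin.cons_zero, Fin.cons_succ]
    ring
  simp only [h1, metricTrace_sum, metricTrace_mul_left, hd.metricTrace_mul]
  simp only [Finset.sum_mul]
  rw [Finset.sum_comm (s := (Finset.univ : Finset (Fin n → Fin 4)))]
  refine Finset.sum_congr rfl fun a _ => ?_
  rw [Finset.sum_comm]
  refine Finset.sum_congr rfl fun b _ => ?_
  simp only [mul_ite, mul_zero, Finset.sum_ite_eq, Finset.mem_univ, if_true]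
  ring

end Pointwise

/-! ## Connections with components labelled by the Klein four-group -/

/-- The product of the Klein four-group, with unit `0`. -/
def klein (a b : Fin 4) : Fin 4 := ![![0, 1, 2, 3], ![1, 0, 3, 2], ![2, 3, 0, 1], ![3, 2, 1, 0]] a b

theorem two_le_infty : (2 : WithTop ℕ∞) ≤ ∞ :=
  show ((2 : ℕ∞) : WithTop ℕ∞) ≤ ((⊤ : ℕ∞) : WithTop ℕ∞) from WithTop.coe_le_coe.mpr le_top

theorem klein_klein (a b : Fin 4) : klein a (klein a b) = b := by
  revert a b; decide

/-- The coframe `θ` and the Levi-Civita connection of `g` on `U`: the dual frame satisfies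
`∇_{E_a} E_b = γ a b • E_{ab}`, and `dz = w θ⁰`. -/
structure KleinConnection (U : Set Coord) (g : CovTensor 2) (z : Coord → ℝ)
    (θ : Fin 4 → Coord → Coord →L[ℝ] ℝ) (w : ℝ → ℝ) (γ : Fin 4 → Fin 4 → ℝ → ℝ) : Prop where
  isOpen : IsOpen U
  smooth : ∀ a, ContDiffOn ℝ ∞ (θ a) U
  det : ∀ x ∈ U, IsUnit (coframeMatrix fun a => θ a x).det
  hasFDerivAt : ∀ x ∈ U, HasFDerivAt z (w (z x) • θ 0 x) x
  symm : ∀ x ∈ U, ∀ u v, christoffel g x u v = christoffel g x v u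
  conn : ∀ x ∈ U, ∀ c u v, θ c x (christoffel g x u v) = fderiv ℝ (θ c) x u v
    + ∑ a, γ a (klein a c) (z x) * (θ a x u * θ (klein a c) x v)

/-- The components of `∇ T`, for a tensor `T` whose components `τ` have the derivatives `τ'`. -/
def covComp {n : ℕ} (γ : Fin 4 → Fin 4 → ℝ) (w : ℝ) (τ τ' : (Fin n → Fin 4) → ℝ)
    (b : Fin (n + 1) → Fin 4) : ℝ :=
  (if b 0 = 0 then w * τ' (Fin.tail b) else 0)
    - ∑ p : Fin n, γ (b 0) (b p.succ)
        * τ (Function.update (Fin.tail b) p (klein (b 0) (b p.succ)))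

/-- The component of `R(E_a, E_b) E_d` along `E_{abd}`. -/
def curvComp (γ γ' : Fin 4 → Fin 4 → ℝ) (w : ℝ) (a b d : Fin 4) : ℝ :=
  (if a = 0 then w * γ' b d else 0) - (if b = 0 then w * γ' a d else 0)
    + γ b d * γ a (klein b d) - γ a d * γ b (klein a d) - (γ a b - γ b a) * γ (klein a b) d

section

variable {U : Set Coord} {g : CovTensor 2} {z : Coord → ℝ} {θ : Fin 4 → Coord → Coord →L[ℝ] ℝ}
  {w : ℝ → ℝ} {γ : Fin 4 → Fin 4 → ℝ → ℝ}

theorem KleinConnection.hasFDerivAt_coframe (hk : KleinConnection U g z θ w γ) {x : Coord}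
    (hx : x ∈ U) (a : Fin 4) : HasFDerivAt (θ a) (fderiv ℝ (θ a) x) x :=
  (((hk.smooth a).contDiffAt (hk.isOpen.mem_nhds hx)).differentiableAt (by simp)).hasFDerivAt

theorem KleinConnection.hasFDerivAt_coframe_apply (hk : KleinConnection U g z θ w γ) {x : Coord}
    (hx : x ∈ U) (a : Fin 4) (v : Coord) :
    HasFDerivAt (fun y => θ a y v) ((fderiv ℝ (θ a) x).flip v) x := by
  have := (hk.hasFDerivAt_coframe hx a).clm_apply (hasFDerivAt_const v x)
  simpa using this

theorem KleinConnection.hasFDerivAt_comp (hk : KleinConnection U g z θ w γ) {x : Coord}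
    (hx : x ∈ U) {f : ℝ → ℝ} {f' : ℝ} (hf : HasDerivAt f f' (z x)) :
    HasFDerivAt (fun y => f (z y)) ((f' * w (z x)) • θ 0 x) x := by
  have := hf.comp_hasFDerivAt x (hk.hasFDerivAt x hx)
  rwa [smul_smul] at this

theorem prod_update_apply {n : ℕ} (ϑ : Fin n → Coord →L[ℝ] ℝ) (v : Fin n → Coord) (p : Fin n)
    (u : Coord) : ∏ q, ϑ q (Function.update v p u q)
      = ϑ p u * ∏ q ∈ Finset.univ.erase p, ϑ q (v q) := by
  rw [← Finset.mul_prod_erase _ _ (Finset.mem_univ p), Function.update_self]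
  congr 1
  refine Finset.prod_congr rfl fun q hq => ?_
  rw [Function.update_of_ne (Finset.ne_of_mem_erase hq)]

/-- Differentiating ∑ τ_b ∏ θ^{b_p}(v_p) produces derivatives of the coframe; they cancel against
the derivative terms of `conn` in the Christoffel corrections. Only the derivative of τ along E_0
and the products of γ with τ remain. -/
theorem KleinConnection.hasComp_covDeriv (hk : KleinConnection U g z θ w γ) {n : ℕ}
    {T : CovTensor n} {τ τ' : (Fin n → Fin 4) → ℝ → ℝ}
    (hT : ∀ x ∈ U, HasComp (fun a => θ a x) (T x) (fun b => τ b (z x)))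
    (hτ : ∀ x ∈ U, ∀ b, HasDerivAt (τ b) (τ' b (z x)) (z x)) {x : Coord} (hx : x ∈ U) :
    HasComp (fun a => θ a x) (covDeriv g T x) (covComp (fun a b => γ a b (z x)) (w (z x))
      (fun b => τ b (z x)) (fun b => τ' b (z x))) := fun v => by
  obtain ⟨u, v, rfl⟩ : ∃ u v', v = Fin.cons u v' := ⟨v 0, Fin.tail v, (Fin.cons_self_tail v).symm⟩
  simp only [covDeriv, Fin.tail_cons, Fin.cons_zero]
  have h1 : HasFDerivAt (fun y => T y v) (∑ b, (τ b (z x) • (∑ p,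
      (∏ q ∈ Finset.univ.erase p, θ (b q) x (v q)) • (fderiv ℝ (θ (b p)) x).flip (v p))
      + (∏ p, θ (b p) x (v p)) • ((τ' b (z x) * w (z x)) • θ 0 x))) x := by
    have : HasFDerivAt (fun y => ∑ b, τ b (z y) * ∏ p, θ (b p) y (v p)) (∑ b, (τ b (z x) • (∑ p,
        (∏ q ∈ Finset.univ.erase p, θ (b q) x (v q)) • (fderiv ℝ (θ (b p)) x).flip (v p))
        + (∏ p, θ (b p) x (v p)) • ((τ' b (z x) * w (z x)) • θ 0 x))) x := by
      refine HasFDerivAt.fun_sum fun b _ => HasFDerivAt.mul (hk.hasFDerivAt_comp hx (hτ x hx b)) ?_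
      exact HasFDerivAt.finsetProd fun p _ => hk.hasFDerivAt_coframe_apply hx (b p) (v p)
    refine this.congr_of_eventuallyEq ?_
    filter_upwards [hk.isOpen.mem_nhds hx] with y hy
    exact hT y hy v
  rw [h1.fderiv]
  have h2 : ∀ p, T x (Function.update v p (christoffel g x u (v p)))
      = ∑ b, τ b (z x) * ((fderiv ℝ (θ (b p)) x u (v p)
          + ∑ a, γ a (klein a (b p)) (z x) * (θ a x u * θ (klein a (b p)) x (v p)))
        * ∏ q ∈ Finset.univ.erase p, θ (b q) x (v q)) := fun p => by
    rw [hT x hx]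
    refine Finset.sum_congr rfl fun b _ => ?_
    rw [prod_update_apply (fun q => θ (b q) x), hk.conn x hx]
  have h3 : ∀ (p : Fin n) (a : Fin 4), ∑ b : Fin n → Fin 4, τ b (z x) *
      ((γ a (klein a (b p)) (z x) * (θ a x u * θ (klein a (b p)) x (v p)))
        * ∏ q ∈ Finset.univ.erase p, θ (b q) x (v q))
      = ∑ b : Fin n → Fin 4, γ a (b p) (z x) * τ (Function.update b p (klein a (b p))) (z x)
        * (θ a x u * ∏ q, θ (b q) x (v q)) := fun p a => by
    -- For fixed a and p, replacing b_p by a·b_p is an involution of the multi-indices. Summing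
    -- along it moves the Klein product from the coframe factor to the index of τ.
    have hinv : Function.Involutive
        (fun b : Fin n → Fin 4 => Function.update b p (klein a (b p))) := fun b => by
      simp [klein_klein]
    rw [← Equiv.sum_comp hinv.toPerm]
    refine Finset.sum_congr rfl fun b _ => ?_
    simp only [Function.Involutive.coe_toPerm, Function.update_self, klein_klein]
    rw [← Finset.mul_prod_erase _ _ (Finset.mem_univ p)]
    have : ∏ q ∈ Finset.univ.erase p, θ (Function.update b p (klein a (b p)) q) x (v q)
        = ∏ q ∈ Finset.univ.erase p, θ (b q) x (v q) :=
      Finset.prod_congr rfl fun q hq => by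
        rw [Function.update_of_ne (Finset.ne_of_mem_erase hq)]
    rw [this]
    ring
  have h4 : ∑ p, T x (Function.update v p (christoffel g x u (v p)))
      = ∑ b, τ b (z x) * ∑ p, fderiv ℝ (θ (b p)) x u (v p)
          * ∏ q ∈ Finset.univ.erase p, θ (b q) x (v q)
        + ∑ a, ∑ b : Fin n → Fin 4, (∑ p, γ a (b p) (z x)
          * τ (Function.update b p (klein a (b p))) (z x)) * (θ a x u * ∏ q, θ (b q) x (v q)) := by
    simp only [h2, add_mul, mul_add, Finset.sum_add_distrib, Finset.mul_sum]
    congr 1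
    · exact Finset.sum_comm
    · simp only [Finset.sum_mul, Finset.mul_sum]
      calc _ = ∑ p, ∑ a, ∑ b : Fin n → Fin 4, τ b (z x) *
            ((γ a (klein a (b p)) (z x) * (θ a x u * θ (klein a (b p)) x (v p)))
            * ∏ q ∈ Finset.univ.erase p, θ (b q) x (v q)) :=
              Finset.sum_congr rfl fun p _ => Finset.sum_comm
        _ = _ := by
          simp only [h3]
          rw [Finset.sum_comm]
          exact Finset.sum_congr rfl fun a _ => Finset.sum_comm
  rw [h4, sum_fin_cons]
  simp only [covComp, Fin.cons_zero, Fin.tail_cons, Fin.cons_succ, Fin.prod_univ_succ, sub_mul,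
    Finset.sum_sub_distrib, ite_mul, zero_mul]
  rw [← sub_sub]
  congr 1
  simp only [_root_.sum_apply, _root_.add_apply,
    _root_.smul_apply, ContinuousLinearMap.flip_apply, smul_eq_mul,
    Finset.sum_add_distrib]
  rw [add_sub_assoc, add_comm, sub_add_eq_add_sub]
  rw [← sub_eq_zero]
  have h5 : ∑ a, ∑ b : Fin n → Fin 4, (if a = 0 then w (z x) * τ' b (z x)
      * (θ a x u * ∏ p, θ (b p) x (v p)) else 0)
      = ∑ b : Fin n → Fin 4, (∏ p, θ (b p) x (v p)) * (τ' b (z x) * w (z x) * θ 0 x u) := by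
    rw [Finset.sum_comm]
    refine Finset.sum_congr rfl fun b _ => ?_
    rw [Finset.sum_ite_eq' Finset.univ (0 : Fin 4)]
    simp only [Finset.mem_univ, if_true]
    ring
  rw [h5]
  have h6 : ∀ b : Fin n → Fin 4, ∑ p, (∏ q ∈ Finset.univ.erase p, θ (b q) x (v q))
        * fderiv ℝ (θ (b p)) x u (v p)
      = ∑ p, fderiv ℝ (θ (b p)) x u (v p) * ∏ q ∈ Finset.univ.erase p, θ (b q) x (v q) :=
    fun b => Finset.sum_congr rfl fun p _ => mul_comm _ _
  simp only [h6]
  ring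

/-- The first structure equation: the derivative terms of `conn` are skew-symmetrised while the
Christoffel symbol is symmetric. -/
theorem KleinConnection.torsion_free (hk : KleinConnection U g z θ w γ) {x : Coord} (hx : x ∈ U)
    (c : Fin 4) (u v : Coord) : fderiv ℝ (θ c) x u v - fderiv ℝ (θ c) x v u
      = ∑ a, γ a (klein a c) (z x) * (θ a x v * θ (klein a c) x u)
        - ∑ a, γ a (klein a c) (z x) * (θ a x u * θ (klein a c) x v) := by
  have h1 := hk.conn x hx c u v
  have h2 := hk.conn x hx c v u
  rw [hk.symm x hx] at h1
  linarith

/-- By Cramer's rule the dual vectors are polynomials in the coframe coefficients divided by the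
determinant. -/
theorem KleinConnection.differentiableAt_dualVec (hk : KleinConnection U g z θ w γ) {x : Coord}
    (hx : x ∈ U) (a : Fin 4) :
    DifferentiableAt ℝ (fun y => dualVec (fun a => θ a y) a) x := by
  have hM : ∀ i j, DifferentiableAt ℝ (fun y => coframeMatrix (fun a => θ a y) i j) x :=
    fun i j => (hk.hasFDerivAt_coframe_apply hx i (basisVec j)).differentiableAt
  have hdet : ∀ M : Coord → Matrix (Fin 4) (Fin 4) ℝ, (∀ i j, DifferentiableAt ℝ (M · i j) x) →
      DifferentiableAt ℝ (fun y => (M y).det) x := fun M hM => by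
    simp only [Matrix.det_apply']
    refine DifferentiableAt.fun_sum fun σ _ => DifferentiableAt.const_mul ?_ _
    exact (HasFDerivAt.finsetProd fun i _ => (hM (σ i) i).hasFDerivAt).differentiableAt
  rw [differentiableAt_pi]
  intro i
  simp only [dualVec, Matrix.inv_def, Matrix.smul_apply, Ring.inverse_eq_inv', smul_eq_mul,
    Matrix.adjugate_apply]
  refine (((hdet _ hM).inv (hk.det x hx).ne_zero)).mul (hdet _ fun j k => ?_)
  by_cases hj : j = a
  · subst hj
    simp
  · simpa [Matrix.updateRow_ne hj] using hM j k

theorem KleinConnection.differentiableAt_fderiv (hk : KleinConnection U g z θ w γ) {x : Coord}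
    (hx : x ∈ U) (a : Fin 4) : DifferentiableAt ℝ (fderiv ℝ (θ a)) x :=
  (((hk.smooth a).contDiffAt (hk.isOpen.mem_nhds hx)).fderiv_right
    (m := 1) (by rw [one_add_one_eq_two]; exact two_le_infty)).differentiableAt (by simp)

theorem KleinConnection.hasFDerivAt_conn (hk : KleinConnection U g z θ w γ)
    {γ' : Fin 4 → Fin 4 → ℝ → ℝ}
    (hγ : ∀ x ∈ U, ∀ a b, HasDerivAt (γ a b) (γ' a b (z x)) (z x)) {x : Coord} (hx : x ∈ U)
    (d : Fin 4) (v u : Coord) :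
    HasFDerivAt (fun y => θ d y (christoffel g y v u))
      (((fderiv ℝ (fderiv ℝ (θ d)) x).flip v).flip u
        + ∑ a, (γ a (klein a d) (z x) • (θ a x v • (fderiv ℝ (θ (klein a d)) x).flip u
            + θ (klein a d) x u • (fderiv ℝ (θ a) x).flip v)
          + (θ a x v * θ (klein a d) x u) • ((γ' a (klein a d) (z x) * w (z x)) • θ 0 x))) x := by
  have h1 : HasFDerivAt (fun y => fderiv ℝ (θ d) y v u)
      (((fderiv ℝ (fderiv ℝ (θ d)) x).flip v).flip u) x := by
    have := (((hk.differentiableAt_fderiv hx d).hasFDerivAt).clm_apply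
      (hasFDerivAt_const v x)).clm_apply (hasFDerivAt_const u x)
    simpa using this
  have h2 := h1.add (HasFDerivAt.fun_sum (u := Finset.univ) fun a _ =>
    (hk.hasFDerivAt_comp hx (hγ x hx a (klein a d))).mul
      ((hk.hasFDerivAt_coframe_apply hx a v).mul
        (hk.hasFDerivAt_coframe_apply hx (klein a d) u)))
  refine h2.congr_of_eventuallyEq ?_
  filter_upwards [hk.isOpen.mem_nhds hx] with y hy
  exact hk.conn y hy d v u

/-- The Christoffel symbol is reassembled from its frame components, whose differentiability comes
from `conn`. The product rule in `coframe_curvOp` needs it. -/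
theorem KleinConnection.differentiableAt_christoffel (hk : KleinConnection U g z θ w γ)
    {γ' : Fin 4 → Fin 4 → ℝ → ℝ}
    (hγ : ∀ x ∈ U, ∀ a b, HasDerivAt (γ a b) (γ' a b (z x)) (z x)) {x : Coord} (hx : x ∈ U)
    (v u : Coord) : DifferentiableAt ℝ (fun y => christoffel g y v u) x := by
  have : DifferentiableAt ℝ (fun y => ∑ d, θ d y (christoffel g y v u)
      • dualVec (fun a => θ a y) d) x :=
    DifferentiableAt.fun_sum fun d _ => (hk.hasFDerivAt_conn hγ hx d v u).differentiableAt.smul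
      (hk.differentiableAt_dualVec hx d)
  refine this.congr_of_eventuallyEq ?_
  filter_upwards [hk.isOpen.mem_nhds hx] with y hy
  exact (sum_coframe_smul_dualVec (hk.det y hy) _).symm

-- The second derivatives of θ^d cancel by symmetry. The first derivatives that remain occur as
-- dθ^a(u, v), and the structure equation turns them into the bracket term of `curvComp`.
set_option maxHeartbeats 2000000 in
theorem KleinConnection.coframe_curvOp (hk : KleinConnection U g z θ w γ)
    {γ' : Fin 4 → Fin 4 → ℝ → ℝ}
    (hγ : ∀ x ∈ U, ∀ a b, HasDerivAt (γ a b) (γ' a b (z x)) (z x)) {x : Coord} (hx : x ∈ U)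
    (d : Fin 4) (u v s : Coord) :
    θ d x (curvOp g x u v s) = ∑ a, ∑ b, curvComp (fun a b => γ a b (z x))
      (fun a b => γ' a b (z x)) (w (z x)) a b (klein a (klein b d))
        * (θ a x u * θ b x v * θ (klein a (klein b d)) x s) := by
  have key : ∀ u v : Coord, θ d x (fderiv ℝ (fun y => christoffel g y v s) x u)
      = fderiv ℝ (fderiv ℝ (θ d)) x u v s
        + ∑ a, (γ a (klein a d) (z x) * (θ a x v * fderiv ℝ (θ (klein a d)) x u s
            + θ (klein a d) x s * fderiv ℝ (θ a) x u v)
          + (θ a x v * θ (klein a d) x s) * ((γ' a (klein a d) (z x) * w (z x)) * θ 0 x u))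
        - fderiv ℝ (θ d) x u (christoffel g x v s) := fun u v => by
    have h1 := ((hk.hasFDerivAt_coframe hx d).clm_apply
      (hk.differentiableAt_christoffel hγ hx v s).hasFDerivAt).unique
      (hk.hasFDerivAt_conn hγ hx d v s)
    have h2 := DFunLike.congr_fun h1 u
    simp only [_root_.add_apply, ContinuousLinearMap.comp_apply,
      ContinuousLinearMap.flip_apply, _root_.sum_apply,
      _root_.smul_apply, smul_eq_mul] at h2
    linarith
  have hsymm : fderiv ℝ (fderiv ℝ (θ d)) x u v = fderiv ℝ (fderiv ℝ (θ d)) x v u :=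
    ((hk.smooth d).contDiffAt (hk.isOpen.mem_nhds hx)).isSymmSndFDerivAt
      (by simpa using two_le_infty) u v
  simp only [curvOp, map_add, map_sub, key, hsymm]
  simp only [hk.conn x hx]
  have ht := fun a => hk.torsion_free hx a u v
  generalize z x = t at *
  have e0 := ht 0
  have e1 := ht 1
  have e2 := ht 2
  have e3 := ht 3
  clear ht key hsymm
  fin_cases d
  · simp [Fin.sum_univ_four, klein, curvComp] at *
    -- The term dθ^a(u, v) carries the coefficient γ_{a,ad} θ^{ad}(s); the same pattern serves each
    -- d.
    linear_combination γ 0 0 t * θ 0 x s * e0 + γ 1 1 t * θ 1 x s * e1 + γ 2 2 t * θ 2 x s * e2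
      + γ 3 3 t * θ 3 x s * e3
  · simp [Fin.sum_univ_four, klein, curvComp] at *
    linear_combination γ 0 1 t * θ 1 x s * e0 + γ 1 0 t * θ 0 x s * e1 + γ 2 3 t * θ 3 x s * e2
      + γ 3 2 t * θ 2 x s * e3
  · simp [Fin.sum_univ_four, klein, curvComp] at *
    linear_combination γ 0 2 t * θ 2 x s * e0 + γ 1 3 t * θ 3 x s * e1 + γ 2 0 t * θ 0 x s * e2
      + γ 3 1 t * θ 1 x s * e3
  · simp [Fin.sum_univ_four, klein, curvComp] at *
    linear_combination γ 0 3 t * θ 3 x s * e0 + γ 1 2 t * θ 2 x s * e1 + γ 2 1 t * θ 1 x s * e2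
      + γ 3 0 t * θ 0 x s * e3

end

/-! ## The coframe `dz / (2F), η¹, η², η³` -/

/-- The imaginary coordinates of a quaternion. -/
noncomputable def imCLM (i : Fin 3) : Quaternion ℝ →L[ℝ] ℝ :=
  LinearMap.toContinuousLinearMap
    { toFun := fun a => ![a.imI, a.imJ, a.imK] i
      map_add' := fun a b => by fin_cases i <;> simp
      map_smul' := fun c a => by fin_cases i <;> simp }

/-- The conjugation of quaternions. -/
noncomputable def starCLM : Quaternion ℝ →L[ℝ] Quaternion ℝ :=
  LinearMap.toContinuousLinearMap
    { toFun := fun a => star a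
      map_add' := fun a b => star_add a b
      map_smul' := fun c a => by ext <;> simp }

@[simp] theorem starCLM_apply (a : Quaternion ℝ) : starCLM a = star a := rfl
@[simp] theorem imCLM_zero (a : Quaternion ℝ) : imCLM 0 a = a.imI := rfl
@[simp] theorem imCLM_one (a : Quaternion ℝ) : imCLM 1 a = a.imJ := rfl
@[simp] theorem imCLM_two (a : Quaternion ℝ) : imCLM 2 a = a.imK := rfl

/-- The Maurer-Cartan form as a continuous linear map. -/
noncomputable def mcForm (q : Coord → Quaternion ℝ) (x : Coord) : Coord →L[ℝ] Quaternion ℝ :=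
  (ContinuousLinearMap.mul ℝ (Quaternion ℝ) (star (q x))).comp (fderiv ℝ q x)

theorem mcForm_apply (q : Coord → Quaternion ℝ) (x v : Coord) :
    mcForm q x v = maurerCartan q x v := rfl

/-- The coframe `dz / (2F), η¹, η², η³`. -/
noncomputable def diagCoframe (F : ℝ → ℝ) (z : Coord → ℝ) (q : Coord → Quaternion ℝ) (a : Fin 4)
    (x : Coord) : Coord →L[ℝ] ℝ :=
  (Fin.cons ((2 * F (z x))⁻¹ • fderiv ℝ z x) (fun i => (imCLM i).comp (mcForm q x))
    : Fin 4 → Coord →L[ℝ] ℝ) a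

/-- The metric `C (F θ⁰θ⁰ + F θ¹θ¹ + θ²θ² + θ³θ³)` is diagonal with these coefficients. -/
def weight (f c : ℝ) : Fin 4 → ℝ := ![c * f, c * f, c, c]

/-- The coefficients of the Levi-Civita connection, for `f = F`, `f₁ = F'`, `p = C' / C`. -/
def conn (f f₁ p : ℝ) : Fin 4 → Fin 4 → ℝ :=
  ![![f₁ + f * p, f₁ + f * p, f * p, f * p], ![f₁ + f * p, -(f₁ + f * p), 2 - f, f - 2],
    ![f * p, -f, -p, 1], ![f * p, f, -1, -p]]

section

variable {I : Set ℝ} {F C : ℝ → ℝ} {U : Set Coord} {z : Coord → ℝ} {q : Coord → Quaternion ℝ}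

theorem diagCoframe_zero (x v : Coord) :
    diagCoframe F z q 0 x v = (2 * F (z x))⁻¹ * coframe z q 0 x v := rfl
theorem diagCoframe_one (x v : Coord) : diagCoframe F z q 1 x v = coframe z q 1 x v := rfl
theorem diagCoframe_two (x v : Coord) : diagCoframe F z q 2 x v = coframe z q 2 x v := rfl
theorem diagCoframe_three (x v : Coord) : diagCoframe F z q 3 x v = coframe z q 3 x v := rfl

theorem IsLocalDiffeo.contDiffAt_z (hU : IsOpen U) (hzq : IsLocalDiffeo I U z q) {x : Coord}
    (hx : x ∈ U) : ContDiffAt ℝ ∞ z x := hzq.smooth_z.contDiffAt (hU.mem_nhds hx)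

theorem IsLocalDiffeo.contDiffAt_q (hU : IsOpen U) (hzq : IsLocalDiffeo I U z q) {x : Coord}
    (hx : x ∈ U) : ContDiffAt ℝ ∞ q x := hzq.smooth_q.contDiffAt (hU.mem_nhds hx)

theorem IsLocalDiffeo.star_mul_self (hzq : IsLocalDiffeo I U z q) {x : Coord} (hx : x ∈ U) :
    star (q x) * q x = 1 := by
  rw [Quaternion.star_mul_self, Quaternion.normSq_eq_norm_mul_self, hzq.unit x hx]
  simp

theorem IsLocalDiffeo.mul_star_self (hzq : IsLocalDiffeo I U z q) {x : Coord} (hx : x ∈ U) :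
    q x * star (q x) = 1 := by
  rw [Quaternion.self_mul_star, Quaternion.normSq_eq_norm_mul_self, hzq.unit x hx]
  simp

theorem IsLocalDiffeo.mul_maurerCartan (hzq : IsLocalDiffeo I U z q) {x : Coord} (hx : x ∈ U)
    (v : Coord) : q x * maurerCartan q x v = fderiv ℝ q x v := by
  rw [maurerCartan, ← mul_assoc, hzq.mul_star_self hx, one_mul]

theorem hasFDerivAt_star_comp {x : Coord} (hq : DifferentiableAt ℝ q x) :
    HasFDerivAt (fun y => star (q y)) (starCLM.comp (fderiv ℝ q x)) x :=
  starCLM.hasFDerivAt.comp x hq.hasFDerivAt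

/-- Differentiate q̄q = 1: the derivative is twice the real part of q̄ dq. -/
theorem IsLocalDiffeo.re_maurerCartan (hU : IsOpen U) (hzq : IsLocalDiffeo I U z q) {x : Coord}
    (hx : x ∈ U) (v : Coord) : (maurerCartan q x v).re = 0 := by
  have hq := (hzq.contDiffAt_q hU hx).differentiableAt (by simp)
  have h1 := (hasFDerivAt_star_comp hq).mul' hq.hasFDerivAt
  have h2 : HasFDerivAt (fun y => star (q y) * q y) (0 : Coord →L[ℝ] Quaternion ℝ) x := by
    refine (hasFDerivAt_const (1 : Quaternion ℝ) x).congr_of_eventuallyEq ?_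
    filter_upwards [hU.mem_nhds hx] with y hy using hzq.star_mul_self hy
  have h3 := congrArg QuaternionAlgebra.re (DFunLike.congr_fun (h1.unique h2) v)
  have h4 : QuaternionAlgebra.re (0 : Quaternion ℝ) = 0 := rfl
  simp [maurerCartan, Quaternion.re_mul] at h3 ⊢
  linarith

theorem IsLocalDiffeo.contDiffOn_mcForm (hU : IsOpen U) (hzq : IsLocalDiffeo I U z q) :
    ContDiffOn ℝ ∞ (mcForm q) U := by
  refine ContDiffOn.clm_comp ?_ (hzq.smooth_q.fderiv_of_isOpen hU (by simp))
  refine (ContinuousLinearMap.mul ℝ (Quaternion ℝ)).contDiff.comp_contDiffOn ?_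
  exact starCLM.contDiff.comp_contDiffOn hzq.smooth_q

theorem IsLocalDiffeo.contDiffOn_diagCoframe (hF : ContDiffOn ℝ ∞ F I) (hFpos : ∀ t ∈ I, 0 < F t)
    (hU : IsOpen U) (hzq : IsLocalDiffeo I U z q) (a : Fin 4) :
    ContDiffOn ℝ ∞ (diagCoframe F z q a) U := by
  refine Fin.cases ?_ (fun i => ?_) a
  · refine ContDiffOn.fun_smul ?_ (hzq.smooth_z.fderiv_of_isOpen hU (by simp))
    refine ContDiffOn.inv (contDiffOn_const.mul (hF.comp hzq.smooth_z hzq.mem)) fun x hx => ?_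
    have := hFpos _ (hzq.mem x hx)
    positivity
  · exact contDiffOn_const.clm_comp (hzq.contDiffOn_mcForm hU)

/-- A vector killed by the coframe has dz = 0 and q̄ dq = 0, since the real part vanishes anyway; so
dq = 0, and the immersion property makes the vector zero. -/
theorem IsLocalDiffeo.isUnit_det (hFpos : ∀ t ∈ I, 0 < F t) (hU : IsOpen U)
    (hzq : IsLocalDiffeo I U z q) {x : Coord} (hx : x ∈ U) :
    IsUnit (coframeMatrix fun a => diagCoframe F z q a x).det := by
  rw [isUnit_iff_ne_zero]
  intro h
  obtain ⟨v, hv, hv0⟩ := Matrix.exists_mulVec_eq_zero_iff.mpr h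
  have hθ : ∀ a, diagCoframe F z q a x v = 0 := fun a => by
    rw [← coframeMatrix_mulVec (fun a => diagCoframe F z q a x), hv0]; rfl
  have hz : fderiv ℝ z x v = 0 := by
    have h0 := hθ 0
    have := hFpos _ (hzq.mem x hx)
    rw [diagCoframe_zero] at h0
    exact (mul_eq_zero.mp h0).resolve_left (by positivity)
  have hm : maurerCartan q x v = 0 :=
    Quaternion.ext _ _ (hzq.re_maurerCartan hU hx v) (hθ 1) (hθ 2) (hθ 3)
  have hq : fderiv ℝ q x v = 0 := by rw [← hzq.mul_maurerCartan hx, hm, mul_zero]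
  have hd : fderiv ℝ (fun y => (z y, q y)) x v = 0 := by
    rw [DifferentiableAt.fderiv_prodMk ((hzq.contDiffAt_z hU hx).differentiableAt (by simp))
      ((hzq.contDiffAt_q hU hx).differentiableAt (by simp))]
    exact Prod.ext hz hq
  exact hv (hzq.immersion x hx (hd.trans (map_zero _).symm))

theorem HasDerivAt.of_contDiffOn (hI : IsOpen I) (hF : ContDiffOn ℝ ∞ F I) {t : ℝ} (ht : t ∈ I) :
    HasDerivAt F (deriv F t) t :=
  ((hF.contDiffAt (hI.mem_nhds ht)).differentiableAt (by simp)).hasDerivAt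

theorem hasFDerivAt_apply_of_contDiffOn {θ : Coord → Coord →L[ℝ] ℝ} (hU : IsOpen U)
    (hθ : ContDiffOn ℝ ∞ θ U) {x : Coord} (hx : x ∈ U) (v : Coord) :
    HasFDerivAt (fun y => θ y v) ((fderiv ℝ θ x).flip v) x := by
  have := (((hθ.contDiffAt (hU.mem_nhds hx)).differentiableAt (by simp)).hasFDerivAt).clm_apply
    (hasFDerivAt_const v x)
  simpa using this

theorem differentiableAt_fderiv_of_contDiffOn {E : Type*} [NormedAddCommGroup E] [NormedSpace ℝ E]
    {f : Coord → E} (hU : IsOpen U) (hf : ContDiffOn ℝ ∞ f U) {x : Coord} (hx : x ∈ U) :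
    DifferentiableAt ℝ (fderiv ℝ f) x :=
  ((hf.fderiv_of_isOpen (m := ∞) hU (by simp)).contDiffAt (hU.mem_nhds hx)).differentiableAt
    (by simp)

theorem fderiv_fderiv_symm {E : Type*} [NormedAddCommGroup E] [NormedSpace ℝ E]
    {f : Coord → E} (hU : IsOpen U) (hf : ContDiffOn ℝ ∞ f U) {x : Coord} (hx : x ∈ U)
    (u v : Coord) : fderiv ℝ (fderiv ℝ f) x u v = fderiv ℝ (fderiv ℝ f) x v u :=
  (hf.contDiffAt (hU.mem_nhds hx)).isSymmSndFDerivAt (by simpa using two_le_infty) u v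

/-- A function of z times dz is closed. -/
theorem IsLocalDiffeo.d_coframe_zero (hI : IsOpen I) (hF : ContDiffOn ℝ ∞ F I)
    (hFpos : ∀ t ∈ I, 0 < F t) (hU : IsOpen U) (hzq : IsLocalDiffeo I U z q) {x : Coord}
    (hx : x ∈ U) (u v : Coord) :
    fderiv ℝ (diagCoframe F z q 0) x u v = fderiv ℝ (diagCoframe F z q 0) x v u := by
  have hne : 2 * F (z x) ≠ 0 := by have := hFpos _ (hzq.mem x hx); positivity
  have hz := ((hzq.contDiffAt_z hU hx).differentiableAt (by simp)).hasFDerivAt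
  have key : HasFDerivAt (diagCoframe F z q 0) _ x :=
    (((HasDerivAt.of_contDiffOn hI hF (hzq.mem x hx)).const_mul 2).fun_inv
      hne).comp_hasFDerivAt x hz |>.smul
      (differentiableAt_fderiv_of_contDiffOn hU hzq.smooth_z hx).hasFDerivAt
  rw [key.fderiv]
  simp [fderiv_fderiv_symm hU hzq.smooth_z hx u v]
  ring

/-- In d(q̄ dq) the second derivative of q drops out by symmetry. What is left is dq̄ ∧ dq, and
substituting dq = q·(q̄ dq) expresses it through the Maurer-Cartan form alone. -/
theorem IsLocalDiffeo.d_coframe_succ (hF : ContDiffOn ℝ ∞ F I)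
    (hFpos : ∀ t ∈ I, 0 < F t) (hU : IsOpen U) (hzq : IsLocalDiffeo I U z q) {x : Coord}
    (hx : x ∈ U) (i : Fin 3) (u v : Coord) :
    fderiv ℝ (diagCoframe F z q i.succ) x u v - fderiv ℝ (diagCoframe F z q i.succ) x v u
      = imCLM i (star (maurerCartan q x u) * maurerCartan q x v
        - star (maurerCartan q x v) * maurerCartan q x u) := by
  have hq := (hzq.contDiffAt_q hU hx).differentiableAt (by simp)
  have key : ∀ u v, fderiv ℝ (diagCoframe F z q i.succ) x u v
      = imCLM i (star (fderiv ℝ q x u) * fderiv ℝ q x v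
        + star (q x) * fderiv ℝ (fderiv ℝ q) x u v) := fun u v => by
    have h1 := hasFDerivAt_apply_of_contDiffOn hU
      (hzq.contDiffOn_diagCoframe hF hFpos hU i.succ) hx v
    have h2 : HasFDerivAt (fun y => diagCoframe F z q i.succ y v) _ x :=
      (imCLM i).hasFDerivAt.comp x ((hasFDerivAt_star_comp hq).mul'
        ((differentiableAt_fderiv_of_contDiffOn hU hzq.smooth_q hx).hasFDerivAt.clm_apply
          (hasFDerivAt_const v x)))
    have h3 := DFunLike.congr_fun (h1.unique h2) u
    rw [ContinuousLinearMap.flip_apply] at h3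
    rw [h3]
    simp [add_comm]
  have hmul : ∀ u v, star (fderiv ℝ q x u) * fderiv ℝ q x v
      = star (maurerCartan q x u) * maurerCartan q x v := fun u v => by
    rw [← hzq.mul_maurerCartan hx u, ← hzq.mul_maurerCartan hx v, star_mul, mul_assoc,
      ← mul_assoc (star (q x)), hzq.star_mul_self hx, one_mul]
  rw [key, key, ← map_sub, hmul, hmul, fderiv_fderiv_symm hU hzq.smooth_q hx u v]
  congr 1
  abel

theorem IsLocalDiffeo.d_coframe (hF : ContDiffOn ℝ ∞ F I)
    (hFpos : ∀ t ∈ I, 0 < F t) (hU : IsOpen U) (hzq : IsLocalDiffeo I U z q) {x : Coord}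
    (hx : x ∈ U) (u v : Coord) :
    fderiv ℝ (diagCoframe F z q 1) x u v - fderiv ℝ (diagCoframe F z q 1) x v u
        = -2 * (diagCoframe F z q 2 x u * diagCoframe F z q 3 x v
          - diagCoframe F z q 3 x u * diagCoframe F z q 2 x v)
    ∧ fderiv ℝ (diagCoframe F z q 2) x u v - fderiv ℝ (diagCoframe F z q 2) x v u
        = -2 * (diagCoframe F z q 3 x u * diagCoframe F z q 1 x v
          - diagCoframe F z q 1 x u * diagCoframe F z q 3 x v)
    ∧ fderiv ℝ (diagCoframe F z q 3) x u v - fderiv ℝ (diagCoframe F z q 3) x v u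
        = -2 * (diagCoframe F z q 1 x u * diagCoframe F z q 2 x v
          - diagCoframe F z q 2 x u * diagCoframe F z q 1 x v) := by
  have h0 := hzq.d_coframe_succ hF hFpos hU hx 0 u v
  have h1 := hzq.d_coframe_succ hF hFpos hU hx 1 u v
  have h2 := hzq.d_coframe_succ hF hFpos hU hx 2 u v
  have hu := hzq.re_maurerCartan hU hx u
  have hv := hzq.re_maurerCartan hU hx v
  have e : ∀ w, diagCoframe F z q 1 x w = (maurerCartan q x w).imI
      ∧ diagCoframe F z q 2 x w = (maurerCartan q x w).imJ
      ∧ diagCoframe F z q 3 x w = (maurerCartan q x w).imK := fun w => ⟨rfl, rfl, rfl⟩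
  rw [(e u).1, (e u).2.1, (e u).2.2, (e v).1, (e v).2.1, (e v).2.2]
  refine ⟨h0.trans ?_, h1.trans ?_, h2.trans ?_⟩
  · simp [Quaternion.imI_mul, hu, hv]; ring
  · simp [Quaternion.imJ_mul, hu, hv]; ring
  · simp [Quaternion.imK_mul, hu, hv]; ring

theorem metric_eq_sum {x : Coord} (hF : F (z x) ≠ 0) (u v : Coord) :
    metric F C z q x ![u, v] = ∑ a, weight (F (z x)) (C (z x)) a
      * (diagCoframe F z q a x u * diagCoframe F z q a x v) := by
  simp only [Fin.sum_univ_four, metric, diagCoframe_zero, diagCoframe_one, diagCoframe_two,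
    diagCoframe_three]
  simp [weight]
  field_simp
  ring

theorem IsLocalDiffeo.isDiag (hFpos : ∀ t ∈ I, 0 < F t) (hCpos : ∀ t ∈ I, 0 < C t) (hU : IsOpen U)
    (hzq : IsLocalDiffeo I U z q) {x : Coord} (hx : x ∈ U) :
    IsDiag (metric F C z q) x (fun a => diagCoframe F z q a x) (weight (F (z x)) (C (z x))) where
  det := hzq.isUnit_det hFpos hU hx
  ne a := by
    have := hFpos _ (hzq.mem x hx)
    have := hCpos _ (hzq.mem x hx)
    fin_cases a <;> simp only [weight] <;> simp <;> (try constructor) <;> positivity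
  eq := metric_eq_sum (hFpos _ (hzq.mem x hx)).ne'

end

/-! ### The Levi-Civita connection of the metric -/

section

variable {I : Set ℝ} {F C : ℝ → ℝ} {U : Set Coord} {z : Coord → ℝ} {q : Coord → Quaternion ℝ}

theorem christoffel_symm {g : CovTensor 2} {x : Coord}
    (hg : ∀ᶠ y in nhds x, ∀ u v, g y ![u, v] = g y ![v, u]) (u v : Coord) :
    christoffel g x u v = christoffel g x v u := by
  have h : fderiv ℝ (fun y => g y ![u, v]) x = fderiv ℝ (fun y => g y ![v, u]) x :=
    Filter.EventuallyEq.fderiv_eq (by filter_upwards [hg] with y hy using hy u v)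
  funext k
  simp only [christoffel, h]
  exact Finset.sum_congr rfl fun l _ => by ring

/-- The hypothesis says that the Christoffel symbol of the first kind is g(∑ X_a E_a, ·); raising
the index recovers the vector. The connection table can thus be verified without inverting the
metric. -/
theorem christoffel_eq_sum {g : CovTensor 2} {x : Coord} {ϑ : Fin 4 → Coord →L[ℝ] ℝ}
    {h : Fin 4 → ℝ} (hd : IsDiag g x ϑ h) (u v : Coord) (X : Fin 4 → ℝ)
    (hX : ∀ s, (1 / 2) * (fderiv ℝ (fun y => g y ![v, s]) x u
      + fderiv ℝ (fun y => g y ![u, s]) x v - fderiv ℝ (fun y => g y ![u, v]) x s)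
        = ∑ a, h a * (X a * ϑ a s)) :
    christoffel g x u v = ∑ a, X a • dualVec ϑ a := by
  funext k
  simp only [christoffel, hX, hd.gram_inv, Finset.sum_apply, Pi.smul_apply, smul_eq_mul]
  have h1 : ∀ l, (∑ a, (h a)⁻¹ * (dualVec ϑ a k * dualVec ϑ a l))
      * ∑ b, h b * (X b * ϑ b (basisVec l))
      = ∑ a, ∑ b, (h a)⁻¹ * h b * X b * dualVec ϑ a k
        * (dualVec ϑ a l * ϑ b (basisVec l)) := fun l => by
    rw [Finset.sum_mul_sum]
    exact Finset.sum_congr rfl fun a _ => Finset.sum_congr rfl fun b _ => by ring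
  simp only [h1]
  rw [Finset.sum_comm]
  refine Finset.sum_congr rfl fun a _ => ?_
  rw [Finset.sum_comm]
  simp only [← Finset.mul_sum, sum_dualVec_mul hd.det]
  simp only [mul_ite, mul_one, mul_zero, Finset.sum_ite_eq', Finset.mem_univ, if_true]
  rw [inv_mul_cancel₀ (hd.ne a), one_mul]

theorem IsLocalDiffeo.hasFDerivAt_z (hU : IsOpen U) (hzq : IsLocalDiffeo I U z q)
    (hFpos : ∀ t ∈ I, 0 < F t) {x : Coord} (hx : x ∈ U) :
    HasFDerivAt z ((2 * F (z x)) • diagCoframe F z q 0 x) x := by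
  have hne : 2 * F (z x) ≠ 0 := by have := hFpos _ (hzq.mem x hx); positivity
  have : (2 * F (z x)) • diagCoframe F z q 0 x = fderiv ℝ z x := by
    change (2 * F (z x)) • ((2 * F (z x))⁻¹ • fderiv ℝ z x) = _
    rw [smul_smul, mul_inv_cancel₀ hne, one_smul]
  rw [this]
  exact ((hzq.contDiffAt_z hU hx).differentiableAt (by simp)).hasFDerivAt

theorem hasDerivAt_weight {t f' c' : ℝ} (hF : HasDerivAt F f' t) (hC : HasDerivAt C c' t)
    (a : Fin 4) : HasDerivAt (fun t => weight (F t) (C t) a)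
      (![c' * F t + C t * f', c' * F t + C t * f', c', c'] a) t := by
  fin_cases a
  · exact hC.mul hF
  · exact hC.mul hF
  · exact hC
  · exact hC

set_option maxHeartbeats 2000000 in
theorem IsLocalDiffeo.kleinConnection (hI : IsOpen I) (hF : ContDiffOn ℝ ∞ F I)
    (hC : ContDiffOn ℝ ∞ C I) (hFpos : ∀ t ∈ I, 0 < F t) (hCpos : ∀ t ∈ I, 0 < C t)
    (hU : IsOpen U) (hzq : IsLocalDiffeo I U z q) :
    KleinConnection U (metric F C z q) z (diagCoframe F z q) (fun t => 2 * F t)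
      (fun a b t => conn (F t) (deriv F t) (deriv C t / C t) a b) where
  isOpen := hU
  smooth := hzq.contDiffOn_diagCoframe hF hFpos hU
  det x hx := hzq.isUnit_det hFpos hU hx
  hasFDerivAt x hx := hzq.hasFDerivAt_z hU hFpos hx
  symm x hx u v := by
    refine christoffel_symm ?_ u v
    filter_upwards [hU.mem_nhds hx] with y hy u v
    rw [metric_eq_sum (hFpos _ (hzq.mem y hy)).ne', metric_eq_sum (hFpos _ (hzq.mem y hy)).ne']
    exact Finset.sum_congr rfl fun a _ => by ring
  conn x hx c u v := by
    have hd := hzq.isDiag hFpos hCpos hU hx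
    have hz := hzq.hasFDerivAt_z hU hFpos hx
    have hw := fun a => (hasDerivAt_weight (HasDerivAt.of_contDiffOn hI hF (hzq.mem x hx))
      (HasDerivAt.of_contDiffOn hI hC (hzq.mem x hx)) a).comp_hasFDerivAt x hz
    have hg : ∀ v s, fderiv ℝ (fun y => metric F C z q y ![v, s]) x = _ := fun v s =>
      ((HasFDerivAt.fun_sum (u := Finset.univ) fun a _ => (hw a).mul
        ((hasFDerivAt_apply_of_contDiffOn hU (hzq.contDiffOn_diagCoframe hF hFpos hU a) hx v).mul
          (hasFDerivAt_apply_of_contDiffOn hU (hzq.contDiffOn_diagCoframe hF hFpos hU a) hx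
            s))).congr_of_eventuallyEq (by
        filter_upwards [hU.mem_nhds hx] with y hy using
          metric_eq_sum (hFpos _ (hzq.mem y hy)).ne' v s)).fderiv
    rw [christoffel_eq_sum hd u v (fun c => fderiv ℝ (diagCoframe F z q c) x u v
      + ∑ a, conn (F (z x)) (deriv F (z x)) (deriv C (z x) / C (z x)) a (klein a c)
        * (diagCoframe F z q a x u * diagCoframe F z q (klein a c) x v))]
    · simp [coframe_dualVec hd.det]
    · intro s
      rw [hg, hg, hg]
      -- Writing C' = pC leaves an identity that is polynomial in f, f', c, p and the coframe
      -- values.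
      have hp : deriv C (z x) = deriv C (z x) / C (z x) * C (z x) :=
        (div_mul_cancel₀ _ (hCpos _ (hzq.mem x hx)).ne').symm
      have t0 := hzq.d_coframe_zero hI hF hFpos hU hx
      have t1 := hzq.d_coframe hF hFpos hU hx
      have t0uv := t0 u v
      have t0us := t0 u s
      have t0vs := t0 v s
      obtain ⟨t1uv, t2uv, t3uv⟩ := t1 u v
      obtain ⟨t1us, t2us, t3us⟩ := t1 u s
      obtain ⟨t1vs, t2vs, t3vs⟩ := t1 v s
      simp only [Fin.sum_univ_four, _root_.add_apply, _root_.smul_apply,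
        ContinuousLinearMap.flip_apply, smul_eq_mul]
      generalize deriv C (z x) / C (z x) = p at *
      rw [hp]
      clear hp hg hw hd hz t0 t1
      simp [weight, conn, klein]
      generalize diagCoframe F z q 0 x u = u0 at *
      generalize diagCoframe F z q 1 x u = u1 at *
      generalize diagCoframe F z q 2 x u = u2 at *
      generalize diagCoframe F z q 3 x u = u3 at *
      generalize diagCoframe F z q 0 x v = v0 at *
      generalize diagCoframe F z q 1 x v = v1 at *
      generalize diagCoframe F z q 2 x v = v2 at *
      generalize diagCoframe F z q 3 x v = v3 at *
      generalize diagCoframe F z q 0 x s = s0 at *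
      generalize diagCoframe F z q 1 x s = s1 at *
      generalize diagCoframe F z q 2 x s = s2 at *
      generalize diagCoframe F z q 3 x s = s3 at *
      generalize F (z x) = f at *
      generalize C (z x) = c at *
      -- Koszul's formula: for each a, half the weight times the skew derivatives of θ^a on the
      -- pairs (u, v), (u, s), (v, s), which the structure equations replace.
      linear_combination (1 / 2) * c * f * (-t0uv * s0 + t0us * v0 + t0vs * u0)
        + (1 / 2) * c * f * (-t1uv * s1 + t1us * v1 + t1vs * u1)
        + (1 / 2) * c * (-t2uv * s2 + t2us * v2 + t2vs * u2)
        + (1 / 2) * c * (-t3uv * s3 + t3us * v3 + t3vs * u3)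

end

/-! ### Components of the Riemann and Ricci tensors -/

section

variable {ϑ : Fin 4 → Coord →L[ℝ] ℝ} {g : CovTensor 2} {x : Coord} {h : Fin 4 → ℝ}

theorem sum_fin_two {α M : Type*} [Fintype α] [AddCommMonoid M] (f : (Fin 2 → α) → M) :
    ∑ b, f b = ∑ a, ∑ b, f ![a, b] := by
  simp only [sum_fin_cons (n := 1), sum_fin_cons (n := 0), Finset.univ_unique,
    Finset.sum_singleton]
  rfl

theorem sum_fin_four {α M : Type*} [Fintype α] [AddCommMonoid M] (f : (Fin 4 → α) → M) :
    ∑ b, f b = ∑ a, ∑ b, ∑ c, ∑ d, f ![a, b, c, d] := by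
  simp only [sum_fin_cons (n := 3), sum_fin_cons (n := 2), sum_fin_cons (n := 1),
    sum_fin_cons (n := 0), Finset.univ_unique, Finset.sum_singleton]
  rfl

/-- Expansion of every argument in the dual frame; the volume form, being a determinant, gets its
components this way. -/
theorem HasComp.of_multilinearMap {n : ℕ} (hd : IsUnit (coframeMatrix ϑ).det)
    (M : MultilinearMap ℝ (fun _ : Fin n => Coord) ℝ) :
    HasComp ϑ M (fun b => M fun p => dualVec ϑ (b p)) := fun v => by
  conv_lhs => rw [← (funext fun p => sum_coframe_smul_dualVec hd (v p) :
    (fun p => ∑ a, ϑ a (v p) • dualVec ϑ a) = v)]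
  rw [MultilinearMap.map_sum]
  refine Finset.sum_congr rfl fun b _ => ?_
  rw [MultilinearMap.map_smul_univ, smul_eq_mul, mul_comm]

theorem HasComp.of_two {T : (Fin 2 → Coord) → ℝ} {τ : (Fin 2 → Fin 4) → ℝ}
    (hT : ∀ u v, T ![u, v] = ∑ a, ∑ b, τ ![a, b] * (ϑ a u * ϑ b v)) : HasComp ϑ T τ := fun v => by
  have hv : v = ![v 0, v 1] := by ext i; fin_cases i <;> rfl
  rw [hv, hT, sum_fin_two]
  simp [Fin.prod_univ_two]

theorem HasComp.sum_two {T : (Fin 2 → Coord) → ℝ} {τ : (Fin 2 → Fin 4) → ℝ} (hT : HasComp ϑ T τ)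
    (u v : Coord) : T ![u, v] = ∑ a, ∑ b, τ ![a, b] * (ϑ a u * ϑ b v) := by
  rw [hT, sum_fin_two]
  simp [Fin.prod_univ_two]

theorem IsDiag.hasComp (hd : IsDiag g x ϑ h) :
    HasComp ϑ (g x) (fun b => if b 0 = b 1 then h (b 0) else 0) := by
  refine HasComp.of_two fun u v => ?_
  rw [hd.eq]
  refine Finset.sum_congr rfl fun a _ => ?_
  simp

theorem IsDiag.metricTrace_of_hasComp (hd : IsDiag g x ϑ h) {T : (Fin 2 → Coord) → ℝ}
    {τ : (Fin 2 → Fin 4) → ℝ} (hT : HasComp ϑ T τ) :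
    metricTrace g x (fun u v => T ![u, v]) = ∑ a, (h a)⁻¹ * τ ![a, a] := by
  have h1 := hT.trace (n := 0) hd ![]
  rw [Finset.univ_unique, Finset.sum_singleton] at h1
  simp only [Finset.univ_eq_empty, Finset.prod_empty, mul_one] at h1
  refine h1.trans (Finset.sum_congr rfl fun a _ => ?_)
  congr 2

/-- The components of the Riemann tensor. -/
def rmComp (γ γ' : Fin 4 → Fin 4 → ℝ) (w : ℝ) (h : Fin 4 → ℝ) (b : Fin 4 → Fin 4) : ℝ :=
  if b 3 = klein (b 0) (klein (b 1) (b 2)) then h (b 2) * curvComp γ γ' w (b 0) (b 1) (b 3) else 0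

theorem KleinConnection.hasComp_riemann {U : Set Coord} {z : Coord → ℝ}
    {θ : Fin 4 → Coord → Coord →L[ℝ] ℝ} {w : ℝ → ℝ} {γ γ' : Fin 4 → Fin 4 → ℝ → ℝ}
    (hk : KleinConnection U g z θ w γ)
    (hγ : ∀ x ∈ U, ∀ a b, HasDerivAt (γ a b) (γ' a b (z x)) (z x)) (hx : x ∈ U)
    (hd : IsDiag g x (fun a => θ a x) h) :
    HasComp (fun a => θ a x) (riemann g x)
      (rmComp (fun a b => γ a b (z x)) (fun a b => γ' a b (z x)) (w (z x)) h) := fun v => by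
  rw [riemann, hd.eq, sum_fin_four]
  simp only [hk.coframe_curvOp hγ hx, rmComp, Fin.prod_univ_four]
  simp only [Finset.mul_sum, Finset.sum_mul]
  rw [Finset.sum_comm]
  refine Finset.sum_congr rfl fun a _ => ?_
  rw [Finset.sum_comm]
  refine Finset.sum_congr rfl fun b _ => Finset.sum_congr rfl fun c _ => ?_
  rw [Finset.sum_eq_single (klein a (klein b c))]
  · simp
    ring
  · intro d _ hne
    simp [hne]
  · simp

theorem HasComp.tensor_two {T S : (Fin 2 → Coord) → ℝ} {τ σ : (Fin 2 → Fin 4) → ℝ}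
    (hT : HasComp ϑ T τ) (hS : HasComp ϑ S σ) (s : Fin 4 → Fin 4) (hs : Function.Bijective s) :
    HasComp ϑ (fun v : Fin 4 → Coord => T ![v (s 0), v (s 1)] * S ![v (s 2), v (s 3)])
      (fun b => τ ![b (s 0), b (s 1)] * σ ![b (s 2), b (s 3)]) := by
  have h1 := (hT.tensor hS).reindex s hs
  have e : ∀ {α : Type} (v : Fin 4 → α),
      (fun i => (v ∘ s) (Fin.castAdd 2 i)) = ![v (s 0), v (s 1)]
      ∧ (fun i => (v ∘ s) (Fin.natAdd 2 i)) = ![v (s 2), v (s 3)] := fun v => by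
    constructor <;> ext i <;> fin_cases i <;> rfl
  have e1 := fun v : Fin 4 → Coord => (e v).1
  have e2 := fun v : Fin 4 → Coord => (e v).2
  have e3 := fun v : Fin 4 → Fin 4 => (e v).1
  have e4 := fun v : Fin 4 → Fin 4 => (e v).2
  simpa only [e1, e2, e3, e4] using h1

theorem HasComp.ricci {τ : (Fin 4 → Fin 4) → ℝ} (hd : IsDiag g x ϑ h)
    (hT : HasComp ϑ (riemann g x) τ) :
    HasComp ϑ (U2Metric.ricci g x) (fun b => ∑ a, (h a)⁻¹ * τ ![a, b 0, a, b 1]) := by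
  have hs : Function.Bijective (![0, 2, 1, 3] : Fin 4 → Fin 4) := by decide
  have h1 := (hT.reindex _ hs).trace (n := 2) hd
  have e : ∀ {α : Type} (a c : α) (v : Fin 2 → α),
      (Fin.cons a (Fin.cons c v) : Fin 4 → α) ∘ (![0, 2, 1, 3] : Fin 4 → Fin 4)
        = ![a, v 0, c, v 1] := fun a c v => by
    ext i; fin_cases i <;> rfl
  have e1 := fun (a c : Coord) v => e a c v
  have e2 := fun (a c : Fin 4) v => e a c v
  simp only [e1, e2] at h1
  exact h1

end

/-- The derivative of `conn`, for `f₂ = F''` and `p₁ = (C' / C)'`. -/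
def connDeriv (f f₁ f₂ p p₁ : ℝ) : Fin 4 → Fin 4 → ℝ :=
  ![![f₂ + (f₁ * p + f * p₁), f₂ + (f₁ * p + f * p₁), f₁ * p + f * p₁, f₁ * p + f * p₁],
    ![f₂ + (f₁ * p + f * p₁), -(f₂ + (f₁ * p + f * p₁)), -f₁, f₁],
    ![f₁ * p + f * p₁, -f₁, -p₁, 0], ![f₁ * p + f * p₁, f₁, 0, -p₁]]

theorem hasDerivAt_conn {F F₁ P : ℝ → ℝ} {f₁ f₂ p₁ t : ℝ} (hF : HasDerivAt F f₁ t)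
    (hF₁ : HasDerivAt F₁ f₂ t) (hP : HasDerivAt P p₁ t) (a b : Fin 4) :
    HasDerivAt (fun t => conn (F t) (F₁ t) (P t) a b)
      (connDeriv (F t) f₁ f₂ (P t) p₁ a b) t := by
  have h0 := hF.mul hP
  have h1 := hF₁.add h0
  fin_cases a <;> fin_cases b
  · exact h1
  · exact h1
  · exact h0
  · exact h0
  · exact h1
  · exact h1.neg
  · exact hF.const_sub 2
  · exact hF.sub_const 2
  · exact h0
  · exact hF.neg
  · exact hP.neg
  · exact hasDerivAt_const t _
  · exact h0
  · exact hF
  · exact hasDerivAt_const t _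
  · exact hP.neg

/-- The eigenvalues of the Ricci tensor in the frame dual to `diagCoframe`. -/
def ricDiag (f f₁ f₂ p p₁ : ℝ) : Fin 4 → ℝ :=
  ![-2 * f * f₂ - 4 * f * f₁ * p - 6 * f ^ 2 * p₁,
    -2 * f * f₂ - 4 * f * f₁ * p - 2 * f ^ 2 * p₁ - 2 * f ^ 2 * p ^ 2 + 2 * f ^ 2,
    -2 * f * p₁ - 2 * p * f₁ - 2 * f * p ^ 2 + 4 - 2 * f,
    -2 * f * p₁ - 2 * p * f₁ - 2 * f * p ^ 2 + 4 - 2 * f]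

/-- The scalar curvature, multiplied by `C`. -/
def scalComp (f f₁ f₂ p p₁ : ℝ) : ℝ :=
  -4 * f₂ - 12 * f₁ * p - 12 * f * p₁ - 6 * f * p ^ 2 - 2 * f + 8

/-- The component with indices a, b, a, d is nonzero only if d = a·b·a = b, so the Ricci tensor is
diagonal in this frame. -/
theorem trace_rmComp {f c : ℝ} (hf : f ≠ 0) (hc : c ≠ 0) (f₁ f₂ p p₁ : ℝ) (b d : Fin 4) :
    ∑ a, (weight f c a)⁻¹ * rmComp (conn f f₁ p) (connDeriv f f₁ f₂ p p₁) (2 * f) (weight f c)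
      ![a, b, a, d] = if b = d then ricDiag f f₁ f₂ p p₁ b else 0 := by
  fin_cases b <;> fin_cases d <;>
    simp [Fin.sum_univ_four, rmComp, weight, klein, curvComp, conn, connDeriv, ricDiag] <;>
    field_simp <;> ring

/-! ### The algebra of the Weyl tensor and the Hodge star in components -/

/-- The components of the metric. -/
def diagComp (h : Fin 4 → ℝ) (a b : Fin 4) : ℝ := if a = b then h a else 0

/-- The components of `ω^±`. -/
def omegaComp (ε f c : ℝ) : Fin 4 → Fin 4 → ℝ :=
  ![![0, ε * (c * f), 0, 0], ![-(ε * (c * f)), 0, 0, 0], ![0, 0, 0, c], ![0, 0, -c, 0]]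

/-- The sign of a map of `Fin 4` to itself (`0` if it is not bijective). -/
noncomputable def volSign (b : Fin 4 → Fin 4) : ℝ :=
  (((b 1 : ℕ) : ℝ) - (b 0 : ℕ)) * (((b 2 : ℕ) : ℝ) - (b 0 : ℕ)) * (((b 3 : ℕ) : ℝ) - (b 0 : ℕ))
    * (((b 2 : ℕ) : ℝ) - (b 1 : ℕ)) * (((b 3 : ℕ) : ℝ) - (b 1 : ℕ))
    * (((b 3 : ℕ) : ℝ) - (b 2 : ℕ)) / 12

/-- The components of the volume form. -/
noncomputable def volComp (f c : ℝ) (b : Fin 4 → Fin 4) : ℝ := c ^ 2 * f * volSign b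

/-- The components of the metric on 2-forms. -/
def pairComp (h : Fin 4 → ℝ) (b : Fin 4 → Fin 4) : ℝ :=
  diagComp h (b 0) (b 2) * diagComp h (b 1) (b 3) - diagComp h (b 0) (b 3) * diagComp h (b 1) (b 2)

/-- The components of `weylModel`. -/
noncomputable def modelComp (ε f c : ℝ) (b : Fin 4 → Fin 4) : ℝ :=
  omegaComp ε f c (b 0) (b 1) * omegaComp ε f c (b 2) (b 3)
    - 2 / 3 * (1 / 2 * (pairComp (weight f c) b + ε * volComp f c b))

/-- The value of `𝓛^± F - 1`. -/
noncomputable def opLValue (ε f f₁ f₂ : ℝ) : ℝ := 1 / 2 * f₂ - 3 / 2 * ε * f₁ + f - 1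

/-- The components of the Weyl tensor in terms of the curvature. -/
noncomputable def weylComp (h : Fin 4 → ℝ) (rm : (Fin 4 → Fin 4) → ℝ) (ric : Fin 4 → Fin 4 → ℝ)
    (s : ℝ) (b : Fin 4 → Fin 4) : ℝ :=
  rm b - 1 / 2 * (ric (b 0) (b 2) * diagComp h (b 1) (b 3)
      - ric (b 0) (b 3) * diagComp h (b 1) (b 2)
      + ric (b 1) (b 3) * diagComp h (b 0) (b 2)
      - ric (b 1) (b 2) * diagComp h (b 0) (b 3))
    + s / 6 * pairComp h b

/-- Reduces the verification over a skew pair of indices from 16 cases to 6. -/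
theorem eq_of_skew {G H : Fin 4 → Fin 4 → ℝ} (hG : ∀ a b, G a b = -G b a)
    (hH : ∀ a b, H a b = -H b a) (h : ∀ a b, a < b → G a b = H a b) (a b : Fin 4) :
    G a b = H a b := by
  rcases lt_trichotomy a b with hab | rfl | hab
  · exact h a b hab
  · linarith [hG a a, hH a a]
  · rw [hG, hH, h b a hab]

theorem klein_comm (a b : Fin 4) : klein a b = klein b a := by
  revert a b; decide

theorem volSign_swap_left (a b d e : Fin 4) : volSign ![a, b, d, e] = -volSign ![b, a, d, e] := by
  simp [volSign]; ring

theorem volSign_swap_right (a b d e : Fin 4) : volSign ![a, b, d, e] = -volSign ![a, b, e, d] := by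
  simp [volSign]; ring

theorem curvComp_swap (γ γ' : Fin 4 → Fin 4 → ℝ) (w : ℝ) (a b d : Fin 4) :
    curvComp γ γ' w a b d = -curvComp γ γ' w b a d := by
  rw [curvComp, curvComp, klein_comm b a]
  ring

theorem rmComp_swap (γ γ' : Fin 4 → Fin 4 → ℝ) (w : ℝ) (h : Fin 4 → ℝ) (a b d e : Fin 4) :
    rmComp γ γ' w h ![a, b, d, e] = -rmComp γ γ' w h ![b, a, d, e] := by
  have hk : klein a (klein b d) = klein b (klein a d) := by revert a b d; decide
  simp only [rmComp, Matrix.cons_val, hk, curvComp_swap γ γ' w a b]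
  by_cases he : e = klein b (klein a d) <;> simp [he]

theorem omegaComp_swap (ε f c : ℝ) (a b : Fin 4) : omegaComp ε f c a b = -omegaComp ε f c b a := by
  fin_cases a <;> fin_cases b <;> simp [omegaComp]

theorem modelComp_swap (ε f c : ℝ) (a b d e : Fin 4) :
    modelComp ε f c ![a, b, d, e] = -modelComp ε f c ![b, a, d, e] := by
  simp only [modelComp, pairComp, volComp, Matrix.cons_val, volSign_swap_left a b,
    omegaComp_swap ε f c a b]
  ring

theorem weylComp_swap {h : Fin 4 → ℝ} {rm : (Fin 4 → Fin 4) → ℝ} (ric : Fin 4 → Fin 4 → ℝ)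
    (s : ℝ) (hrm : ∀ a b d e, rm ![a, b, d, e] = -rm ![b, a, d, e]) (a b d e : Fin 4) :
    weylComp h rm ric s ![a, b, d, e] = -weylComp h rm ric s ![b, a, d, e] := by
  rw [weylComp, weylComp, hrm]
  simp only [pairComp, Matrix.cons_val]
  ring

-- This is W = W⁺ + W⁻ in components. The logarithmic derivative p of C and its derivative cancel on
-- the left, in agreement with the conformal covariance of W; only the scale C survives.
set_option maxHeartbeats 4000000 in
theorem weylComp_eq {f c : ℝ} (hc : c ≠ 0) (f₁ f₂ p p₁ : ℝ) (a b d e : Fin 4) :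
    weylComp (weight f c) (rmComp (conn f f₁ p) (connDeriv f f₁ f₂ p p₁) (2 * f) (weight f c))
        (diagComp (ricDiag f f₁ f₂ p p₁)) (scalComp f f₁ f₂ p p₁ / c) ![a, b, d, e]
      = -c⁻¹ * opLValue 1 f f₁ f₂ * modelComp 1 f c ![a, b, d, e]
        + -c⁻¹ * opLValue (-1) f f₁ f₂ * modelComp (-1) f c ![a, b, d, e] := by
  refine eq_of_skew (G := fun a b => weylComp _ _ _ _ ![a, b, d, e])
    (H := fun a b => -c⁻¹ * opLValue 1 f f₁ f₂ * modelComp 1 f c ![a, b, d, e]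
        + -c⁻¹ * opLValue (-1) f f₁ f₂ * modelComp (-1) f c ![a, b, d, e])
    (fun a b => weylComp_swap _ _ (rmComp_swap _ _ _ _) a b d e) (fun a b => ?_)
    (fun a b hab => ?_) a b
  · rw [modelComp_swap 1, modelComp_swap (-1)]
    ring
  · fin_cases a <;> fin_cases b <;> first | exact absurd hab (by decide) | skip
    all_goals
      fin_cases d <;> fin_cases e <;>
      simp [weylComp, modelComp, pairComp, diagComp, omegaComp, volComp, volSign, opLValue,
        scalComp, rmComp, weight, klein, curvComp, conn, connDeriv, ricDiag] <;>
      first | done | (field_simp; ring)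

section

variable {ϑ : Fin 4 → Coord →L[ℝ] ℝ} {g : CovTensor 2} {x : Coord} {h : Fin 4 → ℝ}

theorem HasComp.trace_trace {n : ℕ} (hd : IsDiag g x ϑ h) {S : (Fin (n + 4) → Coord) → ℝ}
    {σ : (Fin (n + 4) → Fin 4) → ℝ} (hS : HasComp ϑ S σ) :
    HasComp ϑ (fun v => metricTrace g x fun k k' => metricTrace g x fun l l' =>
        S (Fin.cons l (Fin.cons l' (Fin.cons k (Fin.cons k' v)))))
      (fun b => ∑ k, (h k)⁻¹ * ∑ l, (h l)⁻¹
        * σ (Fin.cons l (Fin.cons l (Fin.cons k (Fin.cons k b))))) :=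
  HasComp.trace (n := n) hd (HasComp.trace (n := n + 2) hd hS)

/-- The components of `∗T`. -/
noncomputable def hodgeComp (h : Fin 4 → ℝ) (V τ : (Fin 4 → Fin 4) → ℝ) (b : Fin 4 → Fin 4) : ℝ :=
  1 / 2 * ∑ k, (h k)⁻¹ * ∑ l, (h l)⁻¹ * (V ![b 0, b 1, k, l] * τ ![k, l, b 2, b 3])

theorem HasComp.hodgeLeft (hd : IsDiag g x ϑ h) {vol T : CovTensor 4}
    {V τ : (Fin 4 → Fin 4) → ℝ} (hV : HasComp ϑ (vol x) V) (hT : HasComp ϑ (T x) τ) :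
    HasComp ϑ (hodgeLeft g vol T x) (hodgeComp h V τ) := by
  have hs : Function.Bijective (![4, 5, 2, 0, 3, 1, 6, 7] : Fin 8 → Fin 8) := by decide
  have h1 := (((hV.tensor hT).reindex _ hs).trace_trace (n := 4) hd).const_mul (1 / 2)
  have e : ∀ {α : Type} (l l' k k' : α) (v : Fin 4 → α),
      (fun i => ((Fin.cons l (Fin.cons l' (Fin.cons k (Fin.cons k' v))) : Fin 8 → α)
        ∘ (![4, 5, 2, 0, 3, 1, 6, 7] : Fin 8 → Fin 8)) (Fin.castAdd 4 i)) = ![v 0, v 1, k, l]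
      ∧ (fun i => ((Fin.cons l (Fin.cons l' (Fin.cons k (Fin.cons k' v))) : Fin 8 → α)
        ∘ (![4, 5, 2, 0, 3, 1, 6, 7] : Fin 8 → Fin 8)) (Fin.natAdd 4 i)) = ![k', l', v 2, v 3] :=
    fun l l' k k' v => by constructor <;> ext i <;> fin_cases i <;> rfl
  have e1 := fun (l l' k k' : Coord) v => (e l l' k k' v).1
  have e2 := fun (l l' k k' : Coord) v => (e l l' k k' v).2
  have e3 := fun (l l' k k' : Fin 4) v => (e l l' k k' v).1
  have e4 := fun (l l' k k' : Fin 4) v => (e l l' k k' v).2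
  simp only [e1, e2, e3, e4] at h1
  exact h1

theorem HasComp.weyl {rm : (Fin 4 → Fin 4) → ℝ} {ric : Fin 4 → Fin 4 → ℝ} (hd : IsDiag g x ϑ h)
    (hR : HasComp ϑ (riemann g x) rm) (hric : HasComp ϑ (U2Metric.ricci g x) (fun b => ric (b 0) (b 1))) :
    HasComp ϑ (weyl g x) (weylComp h rm ric (scalarCurv g x)) := by
  have hs1 : Function.Bijective (![0, 2, 1, 3] : Fin 4 → Fin 4) := by decide
  have hs2 : Function.Bijective (![0, 3, 1, 2] : Fin 4 → Fin 4) := by decide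
  have hs3 : Function.Bijective (![1, 3, 0, 2] : Fin 4 → Fin 4) := by decide
  have hs4 : Function.Bijective (![1, 2, 0, 3] : Fin 4 → Fin 4) := by decide
  have hg := hd.hasComp
  exact (hR.sub ((((hric.tensor_two hg _ hs1).sub (hric.tensor_two hg _ hs2)).add
    (hric.tensor_two hg _ hs3)).sub (hric.tensor_two hg _ hs4)|>.const_mul (1 / 2))).add
    (((hg.tensor_two hg _ hs1).sub (hg.tensor_two hg _ hs2)).const_mul (scalarCurv g x / 6))

theorem HasComp.idForms {V : (Fin 4 → Fin 4) → ℝ} {vol : CovTensor 4} (ε : ℝ)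
    (hd : IsDiag g x ϑ h) (hV : HasComp ϑ (vol x) V) :
    HasComp ϑ (idForms ε g vol x) (fun b => 1 / 2 * (pairComp h b + ε * V b)) := by
  have hs1 : Function.Bijective (![0, 2, 1, 3] : Fin 4 → Fin 4) := by decide
  have hs2 : Function.Bijective (![0, 3, 1, 2] : Fin 4 → Fin 4) := by decide
  have hg := hd.hasComp
  exact (((hg.tensor_two hg _ hs1).sub (hg.tensor_two hg _ hs2)).add (hV.const_mul ε)).const_mul
    (1 / 2)

end

theorem hodge_omegaComp {f c ε : ℝ} (hf : f ≠ 0) (hc : c ≠ 0) (hε : ε * ε = 1) (a b : Fin 4) :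
    1 / 2 * ∑ k, (weight f c k)⁻¹ * ∑ l, (weight f c l)⁻¹
      * (volComp f c ![a, b, k, l] * omegaComp ε f c k l) = ε * omegaComp ε f c a b := by
  rcases mul_self_eq_one_iff.mp hε with rfl | rfl <;> fin_cases a <;> fin_cases b <;>
    simp [Fin.sum_univ_four, volComp, omegaComp, volSign, weight] <;>
    first | done | (field_simp; norm_num)

/-- The tensor `pairComp` acts as the identity on 2-forms, and the star composed with the identity
has the volume form as its tensor. -/
theorem hodge_pairComp {f c : ℝ} (hf : f ≠ 0) (hc : c ≠ 0) (a b d e : Fin 4) :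
    hodgeComp (weight f c) (volComp f c) (pairComp (weight f c)) ![a, b, d, e]
      = volComp f c ![a, b, d, e] := by
  have hw : ∀ a, weight f c a ≠ 0 := fun a => by fin_cases a <;> simp [weight, hf, hc]
  have h1 : ∀ k l, pairComp (weight f c) ![k, l, d, e]
      = (if k = d then (if l = e then weight f c d * weight f c e else 0) else 0)
        - (if k = e then (if l = d then weight f c d * weight f c e else 0) else 0) := fun k l => by
    simp only [pairComp, diagComp, Matrix.cons_val]
    by_cases h1 : k = d <;> by_cases h2 : l = e <;> by_cases h3 : k = e <;> by_cases h4 : l = d <;>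
      simp_all [mul_comm]
  simp only [hodgeComp, Matrix.cons_val, h1, mul_sub, Finset.sum_sub_distrib, mul_ite, mul_zero,
    Finset.sum_ite_eq', Finset.mem_univ, if_true, Finset.sum_ite_irrel, Finset.sum_const_zero]
  have hd := hw d
  have he := hw e
  field_simp
  simp [volComp, volSign]
  ring

-- This is ∗∗ = 1 on 2-forms in dimension 4.
set_option maxHeartbeats 4000000 in
theorem hodge_volComp {f c : ℝ} (hf : f ≠ 0) (hc : c ≠ 0) (a b d e : Fin 4) :
    hodgeComp (weight f c) (volComp f c) (volComp f c) ![a, b, d, e]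
      = pairComp (weight f c) ![a, b, d, e] := by
  refine eq_of_skew (G := fun a b => hodgeComp _ _ _ ![a, b, d, e])
    (H := fun a b => pairComp _ ![a, b, d, e]) (fun a b => ?_) (fun a b => ?_)
    (fun a b hab => ?_) a b
  · simp only [hodgeComp, volComp, Matrix.cons_val, fun k l => volSign_swap_left a b k l, mul_neg, neg_mul,
      Finset.sum_neg_distrib]
  · simp only [pairComp, Matrix.cons_val]
    ring
  · refine eq_of_skew (G := fun d e => hodgeComp _ _ _ ![a, b, d, e])
      (H := fun d e => pairComp _ ![a, b, d, e]) (fun d e => ?_) (fun d e => ?_)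
      (fun d e hde => ?_) d e
    · simp only [hodgeComp, volComp, Matrix.cons_val, fun k l => volSign_swap_right k l d e,
        mul_neg, Finset.sum_neg_distrib]
    · simp only [pairComp, Matrix.cons_val]
      ring
    · fin_cases a <;> fin_cases b <;> first | exact absurd hab (by decide) | skip
      all_goals
        fin_cases d <;> fin_cases e <;> first | exact absurd hde (by decide) | skip
      all_goals
        simp [hodgeComp, Fin.sum_univ_four, volComp, pairComp, diagComp, volSign, weight] <;>
        first | done | (field_simp; norm_num)

/-- The form ω^ε is an eigenvector of the star with eigenvalue ε, and the star interchanges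
`pairComp` and `volComp`, so it multiplies `pairComp + ε volComp` by ε as well. -/
theorem hodge_modelComp {f c ε : ℝ} (hf : f ≠ 0) (hc : c ≠ 0) (hε : ε * ε = 1) (a b d e : Fin 4) :
    hodgeComp (weight f c) (volComp f c) (modelComp ε f c) ![a, b, d, e]
      = ε * modelComp ε f c ![a, b, d, e] := by
  have h1 := hodge_omegaComp hf hc hε a b
  have h2 := hodge_pairComp hf hc a b d e
  have h3 := hodge_volComp hf hc a b d e
  simp only [hodgeComp, modelComp, Fin.sum_univ_four, Matrix.cons_val] at *
  linear_combination (omegaComp ε f c d e) * h1 - 1 / 3 * h2 - 1 / 3 * ε * h3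
    - 1 / 3 * volComp f c ![a, b, d, e] * (-1) * hε

/-- Multiplying by the Vandermonde matrix of 0, 1, 2, 3 gives the Vandermonde matrix of the b p. Its
determinant is the product in `volSign`, and the 12 there is the Vandermonde determinant of 0, 1, 2,
3. -/
theorem det_selection (b : Fin 4 → Fin 4) :
    (Matrix.of fun p a => if a = b p then (1 : ℝ) else 0).det = volSign b := by
  have hI0 : Finset.Ioi (0 : Fin 4) = {1, 2, 3} := by decide
  have hI1 : Finset.Ioi (1 : Fin 4) = {2, 3} := by decide
  have hI2 : Finset.Ioi (2 : Fin 4) = {3} := by decide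
  have hI3 : Finset.Ioi (3 : Fin 4) = ∅ := by decide
  have hV : ∀ v : Fin 4 → ℝ, (Matrix.vandermonde v).det = (v 1 - v 0) * (v 2 - v 0) * (v 3 - v 0)
      * (v 2 - v 1) * (v 3 - v 1) * (v 3 - v 2) := fun v => by
    rw [Matrix.det_vandermonde, Fin.prod_univ_four, hI0, hI1, hI2, hI3,
      Finset.prod_insert (by decide), Finset.prod_insert (by decide),
      Finset.prod_insert (by decide), Finset.prod_singleton, Finset.prod_singleton,
      Finset.prod_singleton, Finset.prod_empty]
    ring
  have h1 : (Matrix.of fun p a => if a = b p then (1 : ℝ) else 0)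
      * Matrix.vandermonde (fun a : Fin 4 => ((a : ℕ) : ℝ))
      = Matrix.vandermonde (fun p => (((b p : Fin 4) : ℕ) : ℝ)) := by
    ext p j
    simp [Matrix.mul_apply, Matrix.vandermonde_apply]
  have h2 := congrArg Matrix.det h1
  rw [Matrix.det_mul, hV, hV] at h2
  norm_num at h2
  rw [volSign]
  linarith

theorem hodgeComp_add_mul (h : Fin 4 → ℝ) (V σ τ : (Fin 4 → Fin 4) → ℝ) (A B : ℝ)
    (b : Fin 4 → Fin 4) : hodgeComp h V (fun b => A * σ b + B * τ b) b
      = A * hodgeComp h V σ b + B * hodgeComp h V τ b := by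
  simp only [hodgeComp, Fin.sum_univ_four]
  ring

/-! ### Curvature, complex structures and Weyl parts of g in components -/

/-- The hypotheses on the metric. -/
structure Setting (I : Set ℝ) (F C : ℝ → ℝ) (U : Set Coord) (z : Coord → ℝ)
    (q : Coord → Quaternion ℝ) : Prop where
  hI : IsOpen I
  hF : ContDiffOn ℝ ∞ F I
  hC : ContDiffOn ℝ ∞ C I
  hFpos : ∀ t ∈ I, 0 < F t
  hCpos : ∀ t ∈ I, 0 < C t
  hU : IsOpen U
  hzq : IsLocalDiffeo I U z q

/-- The derivative of `C' / C`. -/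
noncomputable def logDeriv₂ (C : ℝ → ℝ) (t : ℝ) : ℝ :=
  deriv (deriv C) t / C t - (deriv C t / C t) ^ 2

namespace Setting

variable {I : Set ℝ} {F C : ℝ → ℝ} {U : Set Coord} {z : Coord → ℝ} {q : Coord → Quaternion ℝ}

theorem mem (S : Setting I F C U z q) {x : Coord} (hx : x ∈ U) : z x ∈ I := S.hzq.mem x hx

theorem isDiag (S : Setting I F C U z q) {x : Coord} (hx : x ∈ U) :
    IsDiag (metric F C z q) x (fun a => diagCoframe F z q a x) (weight (F (z x)) (C (z x))) :=
  S.hzq.isDiag S.hFpos S.hCpos S.hU hx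

theorem kleinConnection (S : Setting I F C U z q) :
    KleinConnection U (metric F C z q) z (diagCoframe F z q) (fun t => 2 * F t)
      (fun a b t => conn (F t) (deriv F t) (deriv C t / C t) a b) :=
  S.hzq.kleinConnection S.hI S.hF S.hC S.hFpos S.hCpos S.hU

theorem _root_.U2Metric.contDiffOn_deriv {f : ℝ → ℝ} (hI : IsOpen I) (hf : ContDiffOn ℝ ∞ f I) :
    ContDiffOn ℝ ∞ (deriv f) I :=
  ((contDiffOn_infty_iff_deriv_of_isOpen hI).mp hf).2

theorem _root_.U2Metric.hasDerivAt_logDeriv (hI : IsOpen I) (hC : ContDiffOn ℝ ∞ C I) {t : ℝ}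
    (ht : t ∈ I) (h0 : C t ≠ 0) :
    HasDerivAt (fun t => deriv C t / C t) (logDeriv₂ C t) t := by
  refine ((HasDerivAt.of_contDiffOn hI (contDiffOn_deriv hI hC) ht).fun_div
    (HasDerivAt.of_contDiffOn hI hC ht) h0).congr_deriv ?_
  rw [logDeriv₂]
  field_simp

theorem hasDerivAt_conn (S : Setting I F C U z q) {t : ℝ} (ht : t ∈ I) (a b : Fin 4) :
    HasDerivAt (fun t => conn (F t) (deriv F t) (deriv C t / C t) a b)
      (connDeriv (F t) (deriv F t) (deriv (deriv F) t) (deriv C t / C t) (logDeriv₂ C t) a b) t :=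
  U2Metric.hasDerivAt_conn (HasDerivAt.of_contDiffOn S.hI S.hF ht)
    (HasDerivAt.of_contDiffOn S.hI (contDiffOn_deriv S.hI S.hF) ht)
    (hasDerivAt_logDeriv S.hI S.hC ht (S.hCpos t ht).ne') a b

theorem hasComp_riemann (S : Setting I F C U z q) {x : Coord} (hx : x ∈ U) :
    HasComp (fun a => diagCoframe F z q a x) (riemann (metric F C z q) x)
      (rmComp (conn (F (z x)) (deriv F (z x)) (deriv C (z x) / C (z x)))
        (connDeriv (F (z x)) (deriv F (z x)) (deriv (deriv F) (z x)) (deriv C (z x) / C (z x))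
          (logDeriv₂ C (z x))) (2 * F (z x)) (weight (F (z x)) (C (z x)))) :=
  S.kleinConnection.hasComp_riemann
    (γ' := fun a b t => connDeriv (F t) (deriv F t) (deriv (deriv F) t) (deriv C t / C t)
      (logDeriv₂ C t) a b) (fun _ hy a b => S.hasDerivAt_conn (S.mem hy) a b) hx (S.isDiag hx)

theorem hasComp_ricci (S : Setting I F C U z q) {x : Coord} (hx : x ∈ U) :
    HasComp (fun a => diagCoframe F z q a x) (ricci (metric F C z q) x)
      (fun b => diagComp (ricDiag (F (z x)) (deriv F (z x)) (deriv (deriv F) (z x))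
        (deriv C (z x) / C (z x)) (logDeriv₂ C (z x))) (b 0) (b 1)) :=
  ((S.hasComp_riemann hx).ricci (S.isDiag hx)).congr fun b =>
    trace_rmComp (S.hFpos _ (S.mem hx)).ne' (S.hCpos _ (S.mem hx)).ne' _ _ _ _ (b 0) (b 1)

theorem scalarCurv_eq (S : Setting I F C U z q) {x : Coord} (hx : x ∈ U) :
    scalarCurv (metric F C z q) x = scalComp (F (z x)) (deriv F (z x)) (deriv (deriv F) (z x))
        (deriv C (z x) / C (z x)) (logDeriv₂ C (z x)) / C (z x) := by
  have hf := (S.hFpos _ (S.mem hx)).ne'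
  rw [scalarCurv, (S.isDiag hx).metricTrace_of_hasComp (S.hasComp_ricci hx)]
  simp [Fin.sum_univ_four, diagComp, ricDiag, weight, scalComp]
  field_simp
  ring

theorem hasComp_weyl (S : Setting I F C U z q) {x : Coord} (hx : x ∈ U) :
    HasComp (fun a => diagCoframe F z q a x) (weyl (metric F C z q) x) (fun b =>
      -(C (z x))⁻¹ * opLValue 1 (F (z x)) (deriv F (z x)) (deriv (deriv F) (z x))
          * modelComp 1 (F (z x)) (C (z x)) b
        + -(C (z x))⁻¹ * opLValue (-1) (F (z x)) (deriv F (z x)) (deriv (deriv F) (z x))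
          * modelComp (-1) (F (z x)) (C (z x)) b) := by
  refine (HasComp.weyl (S.isDiag hx) (S.hasComp_riemann hx) (S.hasComp_ricci hx)).congr fun b => ?_
  have hb : b = ![b 0, b 1, b 2, b 3] := by ext i; fin_cases i <;> rfl
  rw [hb, S.scalarCurv_eq hx]
  exact weylComp_eq (S.hCpos _ (S.mem hx)).ne' _ _ _ _ _ _ _ _

theorem unitCoframe_eq (S : Setting I F C U z q) {x : Coord} (hx : x ∈ U) (a : Fin 4) (v : Coord) :
    unitCoframe F C z q a x v = √(weight (F (z x)) (C (z x)) a) * diagCoframe F z q a x v := by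
  have hf := S.hFpos _ (S.mem hx)
  have hc := S.hCpos _ (S.mem hx)
  have h0 : √(C (z x) / (4 * F (z x))) = √(C (z x) * F (z x)) * (2 * F (z x))⁻¹ := by
    have : C (z x) / (4 * F (z x)) = C (z x) * F (z x) * ((2 * F (z x))⁻¹) ^ 2 := by
      field_simp; ring
    rw [this, Real.sqrt_mul (by positivity), Real.sqrt_sq (by positivity)]
  fin_cases a
  · have := diagCoframe_zero (F := F) (z := z) (q := q) x v
    simp [unitCoframe, weight, this, h0]
    ring
  · rfl
  · rfl
  · rfl

theorem sigmaSq_eq (S : Setting I F C U z q) {x : Coord} (hx : x ∈ U) (a : Fin 4)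
    (v : Fin 2 → Coord) : sigmaSq F C z q a x v = weight (F (z x)) (C (z x)) a
      * (diagCoframe F z q a x (v 0) * diagCoframe F z q a x (v 1)) := by
  have hf := S.hFpos _ (S.mem hx)
  have hc := S.hCpos _ (S.mem hx)
  have hw : 0 ≤ weight (F (z x)) (C (z x)) a := by
    fin_cases a <;> simp only [weight] <;> simp <;> positivity
  rw [sigmaSq, S.unitCoframe_eq hx, S.unitCoframe_eq hx]
  linear_combination (diagCoframe F z q a x (v 0) * diagCoframe F z q a x (v 1))
    * Real.mul_self_sqrt hw

/-- On dual vectors the defining determinant is a selection determinant with its columns scaled by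
the square roots of the weights; the product of these is C²F. -/
theorem hasComp_volForm (S : Setting I F C U z q) {x : Coord} (hx : x ∈ U) :
    HasComp (fun a => diagCoframe F z q a x) (volForm F C z q x)
      (volComp (F (z x)) (C (z x))) := by
  have hf := S.hFpos _ (S.mem hx)
  have hc := S.hCpos _ (S.mem hx)
  have hdet := (S.isDiag hx).det
  set s : Fin 4 → ℝ := fun a => √(weight (F (z x)) (C (z x)) a) with hs
  let L : Coord →ₗ[ℝ] (Fin 4 → ℝ) :=
    LinearMap.pi fun a => s a • (diagCoframe F z q a x : Coord →ₗ[ℝ] ℝ)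
  let M := ((Matrix.detRowAlternating (R := ℝ) (n := Fin 4)).toMultilinearMap).compLinearMap
    (fun _ => L)
  have hM' : ∀ v, M v = (Matrix.of fun b a => s a * diagCoframe F z q a x (v b)).det :=
    fun v => rfl
  have hM : ∀ v, M v = volForm F C z q x v := fun v => by
    rw [volForm, ← Matrix.det_transpose, hM']
    congr 1
    ext b a
    simp [S.unitCoframe_eq hx, hs]
  have h1 := HasComp.of_multilinearMap hdet M
  have h2 : volForm F C z q x = M := funext fun v => (hM v).symm
  rw [h2]
  refine h1.congr fun b => ?_
  have h3 : M (fun p => dualVec (fun a => diagCoframe F z q a x) (b p))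
      = (Matrix.of fun p a => s a * (Matrix.of fun p a => if a = b p then (1 : ℝ) else 0) p a).det := by
    rw [hM']
    congr 1
    ext p a
    simp only [Matrix.of_apply]
    rw [coframe_dualVec hdet]
  rw [h3, Matrix.det_mul_row, det_selection, volComp]
  congr 1
  have e1 : √(C (z x) * F (z x)) * √(C (z x) * F (z x)) = C (z x) * F (z x) :=
    Real.mul_self_sqrt (by positivity)
  have e2 : √(C (z x)) * √(C (z x)) = C (z x) := Real.mul_self_sqrt hc.le
  simp [Fin.prod_univ_four, hs, weight]
  linear_combination √(C (z x)) * √(C (z x)) * e1 + C (z x) * F (z x) * e2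

/-- For F = 1/2 the factor 1/(2F) is 1, so `coframe` is an instance of `diagCoframe` and the general
duality applies. -/
theorem coframe_frame (S : Setting I F C U z q) {x : Coord} (hx : x ∈ U) (a b : Fin 4) :
    coframe z q a x (frame z q b x) = if a = b then 1 else 0 := by
  have e : ∀ a v, diagCoframe (fun _ => 1 / 2) z q a x v = coframe z q a x v := fun a v => by
    refine Fin.cases ?_ (fun i => ?_) a
    · rw [diagCoframe_zero]; norm_num
    · fin_cases i <;> rfl
  have hd : IsUnit (coframeMatrix fun a => diagCoframe (fun _ => 1 / 2) z q a x).det :=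
    S.hzq.isUnit_det (fun _ _ => by norm_num) S.hU hx
  have hf : frame z q b x = dualVec (fun a => diagCoframe (fun _ => 1 / 2) z q a x) b := by
    have hm : (Matrix.of fun (b j : Fin 4) => coframe z q b x (basisVec j))
        = coframeMatrix fun a => diagCoframe (fun _ => 1 / 2) z q a x := by
      ext b j
      exact (e b _).symm
    funext i
    rw [frame, hm, dualVec]
  rw [hf, ← e]
  exact coframe_dualVec hd a b

/-- In the frame E_a the structure has constant coefficients: J^ε E_0 = ε E_1 and J^ε E_2 = E_3. -/
theorem diagCoframe_complexStr (S : Setting I F C U z q) {x : Coord} (hx : x ∈ U) (ε : ℝ)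
    (u : Coord) :
    diagCoframe F z q 0 x (complexStr ε F z q x u) = -ε * diagCoframe F z q 1 x u
    ∧ diagCoframe F z q 1 x (complexStr ε F z q x u) = ε * diagCoframe F z q 0 x u
    ∧ diagCoframe F z q 2 x (complexStr ε F z q x u) = -diagCoframe F z q 3 x u
    ∧ diagCoframe F z q 3 x (complexStr ε F z q x u) = diagCoframe F z q 2 x u := by
  have hf := (S.hFpos _ (S.mem hx)).ne'
  have h0 : ∀ b, diagCoframe F z q 0 x (frame z q b x)
      = (2 * F (z x))⁻¹ * if (0 : Fin 4) = b then 1 else 0 := fun b => by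
    rw [diagCoframe_zero, S.coframe_frame hx]
  have h1 : ∀ b, diagCoframe F z q 1 x (frame z q b x) = if (1 : Fin 4) = b then 1 else 0 :=
    fun b => by rw [diagCoframe_one, S.coframe_frame hx]
  have h2 : ∀ b, diagCoframe F z q 2 x (frame z q b x) = if (2 : Fin 4) = b then 1 else 0 :=
    fun b => by rw [diagCoframe_two, S.coframe_frame hx]
  have h3 : ∀ b, diagCoframe F z q 3 x (frame z q b x) = if (3 : Fin 4) = b then 1 else 0 :=
    fun b => by rw [diagCoframe_three, S.coframe_frame hx]
  simp only [complexStr, map_add, map_sub, map_smul, h0, h1, h2, h3, smul_eq_mul]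
  simp only [diagCoframe_zero, diagCoframe_one, diagCoframe_two, diagCoframe_three]
  refine ⟨?_, ?_, ?_, ?_⟩ <;> simp <;> field_simp

theorem hasComp_omega (S : Setting I F C U z q) {x : Coord} (hx : x ∈ U) (ε : ℝ) :
    HasComp (fun a => diagCoframe F z q a x) (omega ε F C z q x)
      (fun b => omegaComp ε (F (z x)) (C (z x)) (b 0) (b 1)) := by
  refine HasComp.of_two fun u v => ?_
  obtain ⟨h0, h1, h2, h3⟩ := S.diagCoframe_complexStr hx ε u
  change metric F C z q x ![complexStr ε F z q x u, v] = _
  rw [(S.isDiag hx).eq]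
  simp only [Fin.sum_univ_four, h0, h1, h2, h3]
  simp [weight, omegaComp]
  ring

theorem hasComp_weylModel (S : Setting I F C U z q) {x : Coord} (hx : x ∈ U) (ε : ℝ) :
    HasComp (fun a => diagCoframe F z q a x) (weylModel ε F C z q x)
      (modelComp ε (F (z x)) (C (z x))) := by
  have hs : Function.Bijective (![0, 1, 2, 3] : Fin 4 → Fin 4) := by decide
  have hw := S.hasComp_omega hx ε
  exact (hw.tensor_two hw _ hs).sub
    ((HasComp.idForms ε (S.isDiag hx) (S.hasComp_volForm hx)).const_mul (2 / 3))

/-- The operator (1 + ε∗)/2 fixes the model of sign ε and annihilates the other one. -/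
theorem hasComp_weylPart (S : Setting I F C U z q) {x : Coord} (hx : x ∈ U) {ε : ℝ}
    (hε : ε = 1 ∨ ε = -1) :
    HasComp (fun a => diagCoframe F z q a x) (weylPart ε (metric F C z q) (volForm F C z q) x)
      (fun b => -(C (z x))⁻¹ * opLValue ε (F (z x)) (deriv F (z x)) (deriv (deriv F) (z x))
        * modelComp ε (F (z x)) (C (z x)) b) := by
  have hf := (S.hFpos _ (S.mem hx)).ne'
  have hc := (S.hCpos _ (S.mem hx)).ne'
  have hW := S.hasComp_weyl hx
  refine ((hW.add ((HasComp.hodgeLeft (S.isDiag hx) (S.hasComp_volForm hx) hW).const_mul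
    ε)).const_mul (1 / 2)).congr fun b => ?_
  obtain ⟨b0, b1, b2, b3, rfl⟩ : ∃ b0 b1 b2 b3, b = ![b0, b1, b2, b3] :=
    ⟨b 0, b 1, b 2, b 3, by ext i; fin_cases i <;> rfl⟩
  have h1 := hodge_modelComp hf hc (ε := 1) (by norm_num) b0 b1 b2 b3
  have h2 := hodge_modelComp hf hc (ε := -1) (by norm_num) b0 b1 b2 b3
  rw [hodgeComp_add_mul, h1, h2]
  rcases hε with rfl | rfl <;> ring

end Setting

/-! ### The operators 𝓛^± and derivatives of powers of C -/

section

variable {I : Set ℝ} {F C : ℝ → ℝ}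

theorem hasDerivAt_firstOrder (hI : IsOpen I) {f : ℝ → ℝ} (hf : ContDiffOn ℝ ∞ f I) (c : ℝ) {t : ℝ}
    (ht : t ∈ I) : HasDerivAt (firstOrder c f) (c * deriv (deriv f) t + deriv f t) t :=
  ((HasDerivAt.of_contDiffOn hI (contDiffOn_deriv hI hf) ht).const_mul c).add
    (HasDerivAt.of_contDiffOn hI hf ht)

theorem opL_eq (hI : IsOpen I) {f : ℝ → ℝ} (hf : ContDiffOn ℝ ∞ f I) {ε : ℝ} (hε : ε * ε = 1)
    {t : ℝ} (ht : t ∈ I) :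
    opL ε f t - 1 = opLValue ε (f t) (deriv f t) (deriv (deriv f) t) := by
  rw [opL, firstOrder, (hasDerivAt_firstOrder hI hf (-ε) ht).deriv, firstOrder, opLValue]
  linear_combination 1 / 2 * deriv (deriv f) t * hε

/-- With derivatives written as C^r times a polynomial in p = C'/C and p', the fractional powers in
the curvature formulas factor out. -/
theorem hasDerivAt_rpow_comp (hI : IsOpen I) (hC : ContDiffOn ℝ ∞ C I)
    (hCpos : ∀ t ∈ I, 0 < C t) (r : ℝ) {t : ℝ} (ht : t ∈ I) :
    HasDerivAt (fun s => C s ^ r) (r * C t ^ r * (deriv C t / C t)) t := by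
  have h := (HasDerivAt.of_contDiffOn hI hC ht).rpow_const (p := r) (Or.inl (hCpos t ht).ne')
  refine h.congr_deriv ?_
  rw [Real.rpow_sub_one (hCpos t ht).ne']
  ring

theorem hasDerivAt_deriv_rpow_comp (hI : IsOpen I) (hC : ContDiffOn ℝ ∞ C I)
    (hCpos : ∀ t ∈ I, 0 < C t) (r : ℝ) {t : ℝ} (ht : t ∈ I) :
    HasDerivAt (deriv fun s => C s ^ r)
      (r * C t ^ r * (r * (deriv C t / C t) ^ 2 + logDeriv₂ C t)) t := by
  have h1 : HasDerivAt (fun s => r * C s ^ r * (deriv C s / C s))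
      (r * C t ^ r * (r * (deriv C t / C t) ^ 2 + logDeriv₂ C t)) t :=
    (((hasDerivAt_rpow_comp hI hC hCpos r ht).const_mul r).mul
      (hasDerivAt_logDeriv hI hC ht (hCpos t ht).ne')).congr_deriv (by ring)
  refine h1.congr_of_eventuallyEq ?_
  filter_upwards [hI.mem_nhds ht] with s hs
  exact (hasDerivAt_rpow_comp hI hC hCpos r hs).deriv

theorem deriv_mul_deriv_rpow_comp (hI : IsOpen I) (hF : ContDiffOn ℝ ∞ F I)
    (hC : ContDiffOn ℝ ∞ C I) (hCpos : ∀ t ∈ I, 0 < C t) (r : ℝ) {t : ℝ} (ht : t ∈ I) :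
    deriv (fun t => F t * deriv (fun s => C s ^ r) t) t
      = r * C t ^ r * (deriv F t * (deriv C t / C t)
        + F t * (r * (deriv C t / C t) ^ 2 + logDeriv₂ C t)) := by
  refine ((HasDerivAt.of_contDiffOn hI hF ht).mul
    (hasDerivAt_deriv_rpow_comp hI hC hCpos r ht)).deriv.trans ?_
  rw [(hasDerivAt_rpow_comp hI hC hCpos r ht).deriv]
  ring

end

/-! ### The divergence of the Weyl parts in components -/

section

variable {ϑ : Fin 4 → Coord →L[ℝ] ℝ} {g : CovTensor 2} {x : Coord} {h : Fin 4 → ℝ}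

theorem HasComp.cons {n : ℕ} {T : (Fin (n + 1) → Coord) → ℝ} {τ : (Fin (n + 1) → Fin 4) → ℝ}
    (hT : HasComp ϑ T τ) (X : Coord) :
    HasComp ϑ (fun v => T (Fin.cons X v)) (fun b => ∑ a, ϑ a X * τ (Fin.cons a b)) := fun v => by
  beta_reduce
  rw [hT, sum_fin_cons, Finset.sum_comm]
  refine Finset.sum_congr rfl fun b _ => ?_
  rw [Finset.sum_mul]
  refine Finset.sum_congr rfl fun a _ => ?_
  rw [Fin.prod_univ_succ]
  simp only [Fin.cons_zero, Fin.cons_succ]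
  ring

/-- A function of z has its gradient along E_0, so contraction with it keeps only components with a
leading index 0. -/
theorem IsDiag.coframe_grad (hd : IsDiag g x ϑ h) {φ : Coord → ℝ} {k : ℝ}
    (hφ : HasFDerivAt φ (k • ϑ 0) x) (a : Fin 4) :
    ϑ a (grad g φ x) = if a = 0 then (h 0)⁻¹ * k else 0 := by
  have h1 : grad g φ x = ((h 0)⁻¹ * k) • dualVec ϑ 0 := by
    funext i
    simp only [grad, hφ.fderiv, hd.gram_inv, Finset.sum_mul, Pi.smul_apply, smul_eq_mul,
      _root_.smul_apply]
    rw [Finset.sum_comm]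
    have h2 : ∀ b, ∑ j, (h b)⁻¹ * (dualVec ϑ b i * dualVec ϑ b j) * (k * ϑ 0 (basisVec j))
        = (h b)⁻¹ * dualVec ϑ b i * k * ∑ j, dualVec ϑ b j * ϑ 0 (basisVec j) := fun b => by
      rw [Finset.mul_sum]
      exact Finset.sum_congr rfl fun j _ => by ring
    simp only [h2, sum_dualVec_mul hd.det, mul_ite, mul_one, mul_zero, Finset.sum_ite_eq,
      Finset.mem_univ, if_true]
    ring
  rw [h1, map_smul, coframe_dualVec hd.det, smul_eq_mul, mul_ite, mul_one, mul_zero]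

end

theorem covComp_four (γ : Fin 4 → Fin 4 → ℝ) (w : ℝ) (τ τ' : (Fin 4 → Fin 4) → ℝ)
    (a b c d e : Fin 4) : covComp γ w τ τ' ![a, b, c, d, e]
      = (if a = 0 then w * τ' ![b, c, d, e] else 0) - (γ a b * τ ![klein a b, c, d, e]
        + γ a c * τ ![b, klein a c, d, e] + γ a d * τ ![b, c, klein a d, e]
        + γ a e * τ ![b, c, d, klein a e]) := by
  have e0 : Fin.tail ![a, b, c, d, e] = ![b, c, d, e] := rfl
  have u0 : ∀ s, Function.update ![b, c, d, e] 0 s = ![s, c, d, e] := fun s => by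
    ext i; fin_cases i <;> rfl
  have u1 : ∀ s, Function.update ![b, c, d, e] 1 s = ![b, s, d, e] := fun s => by
    ext i; fin_cases i <;> rfl
  have u2 : ∀ s, Function.update ![b, c, d, e] 2 s = ![b, c, s, e] := fun s => by
    ext i; fin_cases i <;> rfl
  have u3 : ∀ s, Function.update ![b, c, d, e] 3 s = ![b, c, d, s] := fun s => by
    ext i; fin_cases i <;> rfl
  rw [covComp, e0, Fin.sum_univ_four, u0, u1, u2, u3]
  rfl

/-- The derivative of `omegaComp`. -/
def omegaDeriv (ε f f₁ c c₁ : ℝ) : Fin 4 → Fin 4 → ℝ :=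
  ![![0, ε * (c₁ * f + c * f₁), 0, 0], ![-(ε * (c₁ * f + c * f₁)), 0, 0, 0], ![0, 0, 0, c₁],
    ![0, 0, -c₁, 0]]

/-- The derivative of `weight`. -/
def weightDeriv (f f₁ c c₁ : ℝ) : Fin 4 → ℝ := ![c₁ * f + c * f₁, c₁ * f + c * f₁, c₁, c₁]

/-- The derivative of `modelComp`. -/
noncomputable def modelDeriv (ε f f₁ c c₁ : ℝ) (b : Fin 4 → Fin 4) : ℝ :=
  omegaDeriv ε f f₁ c c₁ (b 0) (b 1) * omegaComp ε f c (b 2) (b 3)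
    + omegaComp ε f c (b 0) (b 1) * omegaDeriv ε f f₁ c c₁ (b 2) (b 3)
    - 2 / 3 * (1 / 2 * (diagComp (weightDeriv f f₁ c c₁) (b 0) (b 2)
        * diagComp (weight f c) (b 1) (b 3)
      + diagComp (weight f c) (b 0) (b 2) * diagComp (weightDeriv f f₁ c c₁) (b 1) (b 3)
      - (diagComp (weightDeriv f f₁ c c₁) (b 0) (b 3) * diagComp (weight f c) (b 1) (b 2)
        + diagComp (weight f c) (b 0) (b 3) * diagComp (weightDeriv f f₁ c c₁) (b 1) (b 2))
      + ε * ((2 * c * c₁ * f + c ^ 2 * f₁) * volSign b)))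

theorem hasDerivAt_omegaComp {F C : ℝ → ℝ} {f₁ c₁ t : ℝ} (hF : HasDerivAt F f₁ t)
    (hC : HasDerivAt C c₁ t) (ε : ℝ) (a b : Fin 4) :
    HasDerivAt (fun t => omegaComp ε (F t) (C t) a b) (omegaDeriv ε (F t) f₁ (C t) c₁ a b) t := by
  have h1 := (hC.mul hF).const_mul ε
  have h0 := hasDerivAt_const t (0 : ℝ)
  fin_cases a <;> fin_cases b
  exacts [h0, h1, h0, h0, h1.neg, h0, h0, h0, h0, h0, h0, hC, h0, h0, hC.neg, h0]

theorem hasDerivAt_diagComp_weight {F C : ℝ → ℝ} {f₁ c₁ t : ℝ} (hF : HasDerivAt F f₁ t)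
    (hC : HasDerivAt C c₁ t) (a b : Fin 4) :
    HasDerivAt (fun t => diagComp (weight (F t) (C t)) a b)
      (diagComp (weightDeriv (F t) f₁ (C t) c₁) a b) t := by
  by_cases hab : a = b
  · simp only [diagComp, if_pos hab]
    exact hasDerivAt_weight hF hC a
  · simp only [diagComp, if_neg hab]
    exact hasDerivAt_const t _

theorem hasDerivAt_modelComp {F C : ℝ → ℝ} {f₁ c₁ t : ℝ} (hF : HasDerivAt F f₁ t)
    (hC : HasDerivAt C c₁ t) (ε : ℝ) (b : Fin 4 → Fin 4) :
    HasDerivAt (fun t => modelComp ε (F t) (C t) b) (modelDeriv ε (F t) f₁ (C t) c₁ b) t := by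
  have hω := hasDerivAt_omegaComp hF hC ε
  have hg := hasDerivAt_diagComp_weight hF hC
  have hv : HasDerivAt (fun t => volComp (F t) (C t) b)
      ((2 * C t * c₁ * F t + C t ^ 2 * f₁) * volSign b) t :=
    (((hC.pow 2).mul hF).mul_const (volSign b)).congr_deriv (by simp)
  exact ((hω (b 0) (b 1)).mul (hω (b 2) (b 3))).sub
    (((((hg (b 0) (b 2)).mul (hg (b 1) (b 3))).sub ((hg (b 0) (b 3)).mul (hg (b 1) (b 2)))).add
      (hv.const_mul ε)).const_mul (1 / 2) |>.const_mul (2 / 3))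

theorem omegaDeriv_swap (ε f f₁ c c₁ : ℝ) (a b : Fin 4) :
    omegaDeriv ε f f₁ c c₁ a b = -omegaDeriv ε f f₁ c c₁ b a := by
  fin_cases a <;> fin_cases b <;> simp [omegaDeriv]

theorem modelComp_swap_right (ε f c : ℝ) (a b d e : Fin 4) :
    modelComp ε f c ![a, b, d, e] = -modelComp ε f c ![a, b, e, d] := by
  simp only [modelComp, pairComp, volComp, Matrix.cons_val, volSign_swap_right a b d e,
    omegaComp_swap ε f c d e]
  ring

theorem modelDeriv_swap (ε f f₁ c c₁ : ℝ) (a b d e : Fin 4) :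
    modelDeriv ε f f₁ c c₁ ![a, b, d, e] = -modelDeriv ε f f₁ c c₁ ![b, a, d, e] := by
  simp only [modelDeriv, Matrix.cons_val, volSign_swap_left a b,
    omegaComp_swap ε f c a b, omegaDeriv_swap ε f f₁ c c₁ a b]
  ring

theorem modelDeriv_swap_right (ε f f₁ c c₁ : ℝ) (a b d e : Fin 4) :
    modelDeriv ε f f₁ c c₁ ![a, b, d, e] = -modelDeriv ε f f₁ c c₁ ![a, b, e, d] := by
  simp only [modelDeriv, Matrix.cons_val, volSign_swap_right a b d e,
    omegaComp_swap ε f c d e, omegaDeriv_swap ε f f₁ c c₁ d e]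
  ring

theorem covComp_swap_left (γ : Fin 4 → Fin 4 → ℝ) (w : ℝ) {τ τ' : (Fin 4 → Fin 4) → ℝ}
    (hτ : ∀ a b d e, τ ![a, b, d, e] = -τ ![b, a, d, e])
    (hτ' : ∀ a b d e, τ' ![a, b, d, e] = -τ' ![b, a, d, e]) (a b c d e : Fin 4) :
    covComp γ w τ τ' ![a, b, c, d, e] = -covComp γ w τ τ' ![a, c, b, d, e] := by
  rw [covComp_four, covComp_four, hτ (klein a b) c, hτ b (klein a c), hτ b c, hτ b c, hτ' b c]
  split_ifs <;> ring

theorem covComp_swap_right (γ : Fin 4 → Fin 4 → ℝ) (w : ℝ) {τ τ' : (Fin 4 → Fin 4) → ℝ}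
    (hτ : ∀ a b d e, τ ![a, b, d, e] = -τ ![a, b, e, d])
    (hτ' : ∀ a b d e, τ' ![a, b, d, e] = -τ' ![a, b, e, d]) (a b c d e : Fin 4) :
    covComp γ w τ τ' ![a, b, c, d, e] = -covComp γ w τ τ' ![a, b, c, e, d] := by
  rw [covComp_four, covComp_four, hτ _ _ (klein a d) e, hτ _ _ d (klein a e), hτ _ _ d e,
    hτ _ _ d e, hτ' _ _ d e]
  split_ifs <;> ring

-- Here `l` and `l₁` stand for 𝓛^εF - 1 and its derivative. The divergence is again the model
-- contracted with E_0, and the coefficient is l times the logarithmic derivative of e^{3εz/2} l √C,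
-- written so that it makes sense at zeros of l.
set_option maxHeartbeats 4000000 in
theorem trace_covComp_model {f c ε : ℝ} (hf : f ≠ 0) (hc : c ≠ 0) (hε : ε = 1 ∨ ε = -1)
    (f₁ p l l₁ : ℝ) (b d e : Fin 4) :
    ∑ k, (weight f c k)⁻¹ * covComp (conn f f₁ p) (2 * f)
        (fun b => -c⁻¹ * l * modelComp ε f c b)
        (fun b => (c⁻¹ * p * l - c⁻¹ * l₁) * modelComp ε f c b
          + -c⁻¹ * l * modelDeriv ε f f₁ c (p * c) b) ![k, k, b, d, e]
      = -c⁻¹ * (2 / c * (3 / 2 * ε * l + l₁ + l * p / 2)) * modelComp ε f c ![0, b, d, e] := by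
  refine eq_of_skew
    (G := fun d e => ∑ k, (weight f c k)⁻¹ * covComp _ _ _ _ ![k, k, b, d, e])
    (H := fun d e => -c⁻¹ * (2 / c * (3 / 2 * ε * l + l₁ + l * p / 2))
      * modelComp ε f c ![0, b, d, e]) (fun d e => ?_) (fun d e => ?_) (fun d e hde => ?_) d e
  · rw [← Finset.sum_neg_distrib]
    refine Finset.sum_congr rfl fun k _ => ?_
    rw [covComp_swap_right, mul_neg]
    · intro a b d e
      rw [modelComp_swap_right]; ring
    · intro a b d e
      rw [modelComp_swap_right, modelDeriv_swap_right]; ring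
  · rw [modelComp_swap_right]; ring
  · simp only [covComp_four, Fin.sum_univ_four]
    rcases hε with rfl | rfl <;> fin_cases d <;> fin_cases e
    all_goals first | exact absurd hde (by decide) | skip
    all_goals
      fin_cases b <;>
      simp [modelComp, modelDeriv, pairComp, diagComp, omegaComp, omegaDeriv, volComp, volSign,
        weight, weightDeriv, klein, conn] <;>
      first | done | (field_simp; ring)

/-- With y = √c all half-integral powers become integral powers of y, and the curvature formulas
turn into rational identities. -/
theorem rpow_half_powers {c : ℝ} (hc : 0 < c) : ∃ y : ℝ, 0 < y ∧ c = y ^ 2 ∧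
    c ^ (1 / 2 : ℝ) = y ∧ c ^ (-(1 / 2) : ℝ) = y⁻¹ ∧ c ^ (-(3 / 2) : ℝ) = (y ^ 3)⁻¹ ∧ √c = y := by
  refine ⟨√c, Real.sqrt_pos.mpr hc, (Real.sq_sqrt hc.le).symm, (Real.sqrt_eq_rpow c).symm, ?_, ?_,
    rfl⟩
  · rw [Real.rpow_neg hc.le, Real.sqrt_eq_rpow]
  · rw [Real.rpow_neg hc.le, Real.sqrt_eq_rpow, ← Real.rpow_natCast, ← Real.rpow_mul hc.le]
    norm_num

/-! ### The formulas for the scalar, trace-free Ricci and Weyl curvatures and for the divergence -/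

namespace Setting

variable {I : Set ℝ} {F C : ℝ → ℝ} {U : Set Coord} {z : Coord → ℝ} {q : Coord → Quaternion ℝ}

theorem scalarCurv_formula (S : Setting I F C U z q) {x : Coord} (hx : x ∈ U) :
    scalarCurv (metric F C z q) x
      = -4 * (C (z x))⁻¹ * (deriv (deriv F) (z x) + (1 / 2) * F (z x) - 2)
        - 24 * C (z x) ^ (-(3 / 2) : ℝ)
          * deriv (fun t => F t * deriv (fun s => C s ^ (1 / 2 : ℝ)) t) (z x) := by
  rw [S.scalarCurv_eq hx, deriv_mul_deriv_rpow_comp S.hI S.hF S.hC S.hCpos _ (S.mem hx)]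
  obtain ⟨y, hy, h1, h2, h3, h4, -⟩ := rpow_half_powers (S.hCpos _ (S.mem hx))
  rw [h2, h4, scalComp]
  generalize deriv C (z x) / C (z x) = p
  rw [h1]
  field_simp
  ring

theorem ricci_eq_sum (S : Setting I F C U z q) {x : Coord} (hx : x ∈ U) (v : Fin 2 → Coord) :
    ricci (metric F C z q) x v = ∑ a, ricDiag (F (z x)) (deriv F (z x)) (deriv (deriv F) (z x))
        (deriv C (z x) / C (z x)) (logDeriv₂ C (z x)) a
      * (diagCoframe F z q a x (v 0) * diagCoframe F z q a x (v 1)) := by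
  have hv : v = ![v 0, v 1] := by ext i; fin_cases i <;> rfl
  conv_lhs => rw [hv]
  rw [(S.hasComp_ricci hx).sum_two]
  refine Finset.sum_congr rfl fun a _ => ?_
  simp [diagComp]

theorem tracefreeRicci_formula (S : Setting I F C U z q) {x : Coord} (hx : x ∈ U)
    (v : Fin 2 → Coord) : tracefreeRicci (metric F C z q) x v
      = 4 * F (z x) * C (z x) ^ (-(1 / 2) : ℝ)
          * (deriv (deriv fun s => C s ^ (-(1 / 2) : ℝ)) (z x)
            - (1 / 4) * C (z x) ^ (-(1 / 2) : ℝ))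
          * (sigmaSq F C z q 0 x v - sigmaSq F C z q 1 x v)
        + 2 * (C (z x) ^ (-(1 / 2) : ℝ)
              * deriv (fun t => F t * deriv (fun s => C s ^ (-(1 / 2) : ℝ)) t) (z x)
            - (C (z x))⁻¹ * ((1 / 2) * deriv (deriv F) (z x) - (3 / 4) * F (z x) + 1))
          * (sigmaSq F C z q 0 x v + sigmaSq F C z q 1 x v
            - sigmaSq F C z q 2 x v - sigmaSq F C z q 3 x v) := by
  have hv : v = ![v 0, v 1] := by ext i; fin_cases i <;> rfl
  have hg : metric F C z q x v = ∑ a, weight (F (z x)) (C (z x)) a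
      * (diagCoframe F z q a x (v 0) * diagCoframe F z q a x (v 1)) := by
    conv_lhs => rw [hv]
    exact (S.isDiag hx).eq (v 0) (v 1)
  rw [tracefreeRicci, S.ricci_eq_sum hx, hg, S.scalarCurv_eq hx,
    deriv_mul_deriv_rpow_comp S.hI S.hF S.hC S.hCpos _ (S.mem hx),
    (hasDerivAt_deriv_rpow_comp S.hI S.hC S.hCpos _ (S.mem hx)).deriv]
  simp only [S.sigmaSq_eq hx, Fin.sum_univ_four]
  obtain ⟨y, hy, h1, h2, h3, h4, -⟩ := rpow_half_powers (S.hCpos _ (S.mem hx))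
  rw [h3]
  simp only [scalComp, ricDiag, weight, Matrix.cons_val]
  generalize deriv C (z x) / C (z x) = p
  rw [h1]
  field_simp
  ring

theorem weylPart_formula (S : Setting I F C U z q) {ε : ℝ} (hε : ε = 1 ∨ ε = -1) {x : Coord}
    (hx : x ∈ U) (v : Fin 4 → Coord) : weylPart ε (metric F C z q) (volForm F C z q) x v
      = -(C (z x))⁻¹ * (opL ε F (z x) - 1) * weylModel ε F C z q x v := by
  have hε' : ε * ε = 1 := by rcases hε with rfl | rfl <;> norm_num
  rw [opL_eq S.hI S.hF hε' (S.mem hx)]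
  exact (S.hasComp_weylPart hx hε).eq ((S.hasComp_weylModel hx ε).const_mul _) v

theorem contDiffOn_opL (S : Setting I F C U z q) (ε : ℝ) : ContDiffOn ℝ ∞ (opL ε F) I := by
  have h : ∀ (c : ℝ) {f : ℝ → ℝ}, ContDiffOn ℝ ∞ f I → ContDiffOn ℝ ∞ (firstOrder c f) I :=
    fun c f hf => (contDiffOn_const.mul (contDiffOn_deriv S.hI hf)).add hf
  exact h _ (h _ S.hF)

theorem hasDerivAt_weylCoeff (S : Setting I F C U z q) (ε : ℝ) {t : ℝ} (ht : t ∈ I)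
    (b : Fin 4 → Fin 4) :
    HasDerivAt (fun t => -(C t)⁻¹ * (opL ε F t - 1) * modelComp ε (F t) (C t) b)
      (((C t)⁻¹ * (deriv C t / C t) * (opL ε F t - 1) - (C t)⁻¹ * deriv (opL ε F) t)
          * modelComp ε (F t) (C t) b
        + -(C t)⁻¹ * (opL ε F t - 1)
          * modelDeriv ε (F t) (deriv F t) (C t) (deriv C t / C t * C t) b) t := by
  have hc := (S.hCpos t ht).ne'
  have hF := HasDerivAt.of_contDiffOn S.hI S.hF ht
  have hC := HasDerivAt.of_contDiffOn S.hI S.hC ht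
  have hL := HasDerivAt.of_contDiffOn S.hI (S.contDiffOn_opL ε) ht
  rw [div_mul_cancel₀ _ hc]
  refine (((hC.fun_inv hc).fun_neg.fun_mul (hL.sub_const 1)).mul
    (hasDerivAt_modelComp hF hC ε b)).congr_deriv ?_
  field_simp
  ring

/-- The function `q` of `z` with `δ W^± = -C⁻¹ (2 q / C) (ω^± ⊗ ω^± - (2/3) Id)(E₀, ·, ·, ·)`. -/
noncomputable def _root_.U2Metric.divCoeff (ε : ℝ) (F C : ℝ → ℝ) (t : ℝ) : ℝ :=
  3 / 2 * ε * (opL ε F t - 1) + deriv (opL ε F) t + (opL ε F t - 1) * (deriv C t / C t) / 2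

theorem hasComp_covDeriv_weylPart (S : Setting I F C U z q) {ε : ℝ} (hε : ε = 1 ∨ ε = -1)
    {x : Coord} (hx : x ∈ U) :
    HasComp (fun a => diagCoframe F z q a x)
      (covDeriv (metric F C z q) (weylPart ε (metric F C z q) (volForm F C z q)) x)
      (covComp (conn (F (z x)) (deriv F (z x)) (deriv C (z x) / C (z x))) (2 * F (z x))
        (fun b => -(C (z x))⁻¹ * (opL ε F (z x) - 1) * modelComp ε (F (z x)) (C (z x)) b)
        (fun b => ((C (z x))⁻¹ * (deriv C (z x) / C (z x)) * (opL ε F (z x) - 1)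
              - (C (z x))⁻¹ * deriv (opL ε F) (z x)) * modelComp ε (F (z x)) (C (z x)) b
          + -(C (z x))⁻¹ * (opL ε F (z x) - 1)
            * modelDeriv ε (F (z x)) (deriv F (z x)) (C (z x))
              (deriv C (z x) / C (z x) * C (z x)) b)) := by
  have hε' : ε * ε = 1 := by rcases hε with rfl | rfl <;> norm_num
  refine S.kleinConnection.hasComp_covDeriv
    (τ := fun b t => -(C t)⁻¹ * (opL ε F t - 1) * modelComp ε (F t) (C t) b)
    (τ' := fun b t => ((C t)⁻¹ * (deriv C t / C t) * (opL ε F t - 1)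
              - (C t)⁻¹ * deriv (opL ε F) t) * modelComp ε (F t) (C t) b
          + -(C t)⁻¹ * (opL ε F t - 1)
            * modelDeriv ε (F t) (deriv F t) (C t) (deriv C t / C t * C t) b)
    (fun y hy => (S.hasComp_weylPart hy hε).congr fun b => ?_)
    (fun y hy b => S.hasDerivAt_weylCoeff ε (S.mem hy) b) hx
  rw [opL_eq S.hI S.hF hε' (S.mem hy)]

theorem hasComp_divergence (S : Setting I F C U z q) {ε : ℝ} (hε : ε = 1 ∨ ε = -1) {x : Coord}
    (hx : x ∈ U) :
    HasComp (fun a => diagCoframe F z q a x)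
      (divergence (metric F C z q) (weylPart ε (metric F C z q) (volForm F C z q)) x)
      (fun b => -(C (z x))⁻¹ * (2 / C (z x) * divCoeff ε F C (z x))
        * modelComp ε (F (z x)) (C (z x)) (Fin.cons 0 b)) := by
  refine ((S.hasComp_covDeriv_weylPart hε hx).trace (n := 3) (S.isDiag hx)).congr fun b => ?_
  have h := trace_covComp_model (S.hFpos _ (S.mem hx)).ne' (S.hCpos _ (S.mem hx)).ne' hε
    (deriv F (z x)) (deriv C (z x) / C (z x)) (opL ε F (z x) - 1) (deriv (opL ε F) (z x))
    (b 0) (b 1) (b 2)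
  have e1 : ∀ a : Fin 4, (Fin.cons a b : Fin 4 → Fin 4) = ![a, b 0, b 1, b 2] := fun a => by
    ext i; fin_cases i <;> rfl
  simp only [e1]
  exact h

/-- The exponential contributes the term 3ε/2 of `divCoeff`, and √C contributes p/2. -/
theorem hasDerivAt_divPotential (S : Setting I F C U z q) (ε : ℝ) {t : ℝ} (ht : t ∈ I) :
    HasDerivAt (divPotential ε F C) (Real.exp (ε * (3 / 2) * t) * √(C t) * divCoeff ε F C t) t := by
  have hc := S.hCpos t ht
  have hC := HasDerivAt.of_contDiffOn S.hI S.hC ht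
  have hL := HasDerivAt.of_contDiffOn S.hI (S.contDiffOn_opL ε) ht
  have hs := Real.mul_self_sqrt hc.le
  refine (((((hasDerivAt_id t).const_mul (ε * (3 / 2))).exp).fun_mul (hL.sub_const 1)).fun_mul
    (hC.sqrt hc.ne')).congr_deriv ?_
  have h1 : deriv C t / C t = deriv C t / (√(C t) * √(C t)) := by rw [hs]
  rw [divCoeff, h1]
  simp only [id]
  field_simp

/-- The gradient of φ(z) is (CF)⁻¹ · 2Fφ' E_0, whence the constant 2/C. -/
theorem model_cons_grad (S : Setting I F C U z q) (ε : ℝ) {x : Coord} (hx : x ∈ U)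
    {φ : ℝ → ℝ} {φ' : ℝ} (hφ : HasDerivAt φ φ' (z x)) :
    HasComp (fun a => diagCoframe F z q a x)
      (fun v : Fin 3 → Coord => weylModel ε F C z q x
        ![grad (metric F C z q) (fun y => φ (z y)) x, v 0, v 1, v 2])
      (fun b => 2 / C (z x) * φ' * modelComp ε (F (z x)) (C (z x)) (Fin.cons 0 b)) := by
  have hf := (S.hFpos _ (S.mem hx)).ne'
  have h1 := (S.hasComp_weylModel hx ε).cons (grad (metric F C z q) (fun y => φ (z y)) x)
  have e : ∀ (X : Coord) (v : Fin 3 → Coord),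
      (Fin.cons X v : Fin 4 → Coord) = ![X, v 0, v 1, v 2] := fun X v => by
    ext i; fin_cases i <;> rfl
  simp only [e, (S.isDiag hx).coframe_grad (S.kleinConnection.hasFDerivAt_comp hx hφ), ite_mul,
    zero_mul, Finset.sum_ite_eq', Finset.mem_univ, if_true] at h1
  refine h1.congr fun b => ?_
  simp only [weight, Matrix.cons_val]
  field_simp

theorem divergence_formula (S : Setting I F C U z q) {ε : ℝ} (hε : ε = 1 ∨ ε = -1) {x : Coord}
    (hx : x ∈ U) (v : Fin 3 → Coord) :
    divergence (metric F C z q) (weylPart ε (metric F C z q) (volForm F C z q)) x v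
      = -C (z x) ^ (-(3 / 2) : ℝ) * Real.exp (-ε * (3 / 2) * z x)
        * weylModel ε F C z q x
          ![grad (metric F C z q) (fun y => divPotential ε F C (z y)) x, v 0, v 1, v 2] := by
  refine ((S.hasComp_divergence hε hx).congr fun b => ?_).eq
    ((S.model_cons_grad ε hx (S.hasDerivAt_divPotential ε (S.mem hx))).const_mul _) v
  obtain ⟨y, hy, h1, -, -, h4, h5⟩ := rpow_half_powers (S.hCpos _ (S.mem hx))
  have he : Real.exp (-ε * (3 / 2) * z x) * Real.exp (ε * (3 / 2) * z x) = 1 := by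
    rw [← Real.exp_add]; ring_nf; exact Real.exp_zero
  rw [h4, h5]
  generalize modelComp ε (F (z x)) (C (z x)) (Fin.cons 0 b) = m
  rw [h1]
  -- Only the side of the potential carries exponentials, so their product 1 is inserted on the
  -- other side for the two to match.
  have : -(y ^ 2)⁻¹ * (2 / y ^ 2 * divCoeff ε F C (z x)) * m
      = -(y ^ 2)⁻¹ * (2 / y ^ 2 * divCoeff ε F C (z x)) * m
        * (Real.exp (-ε * (3 / 2) * z x) * Real.exp (ε * (3 / 2) * z x)) := by rw [he, mul_one]
  rw [this]
  field_simp

theorem divergence_formula_log (S : Setting I F C U z q) {ε : ℝ} (hε : ε = 1 ∨ ε = -1) {x : Coord}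
    (hx : x ∈ U) (hL : opL ε F (z x) ≠ 1) (v : Fin 3 → Coord) :
    divergence (metric F C z q) (weylPart ε (metric F C z q) (volForm F C z q)) x v
      = weylPart ε (metric F C z q) (volForm F C z q) x
          ![grad (metric F C z q) (fun y => Real.log |divPotential ε F C (z y)|) x,
            v 0, v 1, v 2] := by
  have hc := S.hCpos _ (S.mem hx)
  have h0 : divPotential ε F C (z x) ≠ 0 := by
    rw [divPotential]
    positivity
  have hlog := (S.hasDerivAt_divPotential ε (S.mem hx)).log h0
  simp only [Real.log_abs, S.weylPart_formula hε hx]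
  refine ((S.hasComp_divergence hε hx).congr fun b => ?_).eq
    ((S.model_cons_grad ε hx hlog).const_mul _) v
  rw [divPotential]
  field_simp

end Setting

/-! ### Closedness of ω^± and the Kähler case -/

theorem covComp_two (γ : Fin 4 → Fin 4 → ℝ) (w : ℝ) (τ τ' : (Fin 2 → Fin 4) → ℝ)
    (a b c : Fin 4) : covComp γ w τ τ' ![a, b, c]
      = (if a = 0 then w * τ' ![b, c] else 0)
        - (γ a b * τ ![klein a b, c] + γ a c * τ ![b, klein a c]) := by
  have e0 : Fin.tail ![a, b, c] = ![b, c] := rfl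
  have u0 : ∀ s, Function.update ![b, c] 0 s = ![s, c] := fun s => by
    ext i; fin_cases i <;> rfl
  have u1 : ∀ s, Function.update ![b, c] 1 s = ![b, s] := fun s => by
    ext i; fin_cases i <;> rfl
  rw [covComp, e0, Fin.sum_univ_two, u0, u1]
  rfl

/-- In the cyclic sum the Christoffel corrections cancel in pairs, by symmetry of the connection and
skew-symmetry of the form. -/
theorem extD_eq_sum_covDeriv {g β : CovTensor 2} {x : Coord}
    (hg : ∀ u v, christoffel g x u v = christoffel g x v u)
    (hβ : ∀ u v, β x ![u, v] = -β x ![v, u]) (u v w : Coord) :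
    extD β x ![u, v, w] = covDeriv g β x ![u, v, w] + covDeriv g β x ![v, w, u]
      + covDeriv g β x ![w, u, v] := by
  have key : ∀ u v w, covDeriv g β x ![u, v, w] = fderiv ℝ (fun y => β y ![v, w]) x u
      - (β x ![christoffel g x u v, w] + β x ![v, christoffel g x u w]) := fun u v w => by
    have e0 : Fin.tail ![u, v, w] = ![v, w] := rfl
    have u0 : ∀ s, Function.update ![v, w] 0 s = ![s, w] := fun s => by
      ext i; fin_cases i <;> rfl
    have u1 : ∀ s, Function.update ![v, w] 1 s = ![v, s] := fun s => by
      ext i; fin_cases i <;> rfl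
    rw [covDeriv, e0, Fin.sum_univ_two, u0, u1]
    rfl
  have e : extD β x ![u, v, w] = fderiv ℝ (fun y => β y ![v, w]) x u
    + fderiv ℝ (fun y => β y ![w, u]) x v + fderiv ℝ (fun y => β y ![u, v]) x w := rfl
  rw [e, key, key, key, hg w u, hg v u, hg w v, hβ v (christoffel g x u w),
    hβ w (christoffel g x u v), hβ u (christoffel g x v w)]
  ring

namespace Setting

variable {I : Set ℝ} {F C : ℝ → ℝ} {U : Set Coord} {z : Coord → ℝ} {q : Coord → Quaternion ℝ}

/-- Since ω^ε = ε(C/2) dz ∧ η¹ + C η² ∧ η³, its differential is (C' + εC) dz ∧ η² ∧ η³; the factor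
2F is dz(E_0). -/
theorem extD_omega (S : Setting I F C U z q) {x : Coord} (hx : x ∈ U) (ε : ℝ) :
    extD (omega ε F C z q) x ![dualVec (fun a => diagCoframe F z q a x) 0,
        dualVec (fun a => diagCoframe F z q a x) 2, dualVec (fun a => diagCoframe F z q a x) 3]
      = 2 * F (z x) * (deriv C (z x) + ε * C (z x)) := by
  have hc := (S.hCpos _ (S.mem hx)).ne'
  have hskew : ∀ u v, omega ε F C z q x ![u, v] = -omega ε F C z q x ![v, u] := fun u v => by
    rw [(S.hasComp_omega hx ε).sum_two, (S.hasComp_omega hx ε).sum_two]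
    simp [Fin.sum_univ_four, omegaComp]
    ring
  have h1 := S.kleinConnection.hasComp_covDeriv (τ := fun b t => omegaComp ε (F t) (C t) (b 0) (b 1))
    (τ' := fun b t => omegaDeriv ε (F t) (deriv F t) (C t) (deriv C t) (b 0) (b 1))
    (fun y hy => S.hasComp_omega hy ε)
    (fun y hy b => hasDerivAt_omegaComp (HasDerivAt.of_contDiffOn S.hI S.hF (S.mem hy))
      (HasDerivAt.of_contDiffOn S.hI S.hC (S.mem hy)) ε (b 0) (b 1)) hx
  have e : ∀ a b c, (fun p => dualVec (fun a => diagCoframe F z q a x) (![a, b, c] p))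
      = ![dualVec (fun a => diagCoframe F z q a x) a, dualVec (fun a => diagCoframe F z q a x) b,
        dualVec (fun a => diagCoframe F z q a x) c] := fun a b c => by
    ext i; fin_cases i <;> rfl
  have h2 := fun a b c => (congrArg (covDeriv (metric F C z q) (omega ε F C z q) x)
    (e a b c)).symm.trans (h1.apply_dualVec (S.isDiag hx).det ![a, b, c])
  rw [extD_eq_sum_covDeriv (S.kleinConnection.symm x hx) hskew, h2, h2, h2, covComp_two,
    covComp_two, covComp_two]
  simp [klein, conn, omegaComp, omegaDeriv]
  field_simp
  ring

theorem deriv_eq_of_closed (S : Setting I F C U z q) {x : Coord} (hx : x ∈ U)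
    (h : ∀ v, extD (formOf (metric F C z q) (complexStr 1 F z q)) x v = 0) :
    deriv C (z x) = -C (z x) := by
  have h1 := (S.extD_omega hx 1).symm.trans (h _)
  have hf := S.hFpos _ (S.mem hx)
  have h2 := (mul_eq_zero.mp h1).resolve_left (by positivity)
  linarith

theorem exists_eq_mul_exp (S : Setting I F C U z q) (hconn : IsPreconnected U)
    (h : ∀ x ∈ U, deriv C (z x) = -C (z x)) :
    ∃ C₀ : ℝ, 0 < C₀ ∧ ∀ x ∈ U, C (z x) = C₀ * Real.exp (-z x) := by
  rcases U.eq_empty_or_nonempty with rfl | ⟨x₀, hx₀⟩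
  · exact ⟨1, one_pos, fun x hx => hx.elim⟩
  -- Constancy of C e^z is proved on U and not on I, because the equation C' = -C is known only at
  -- values of z on U.
  have hd : ∀ x ∈ U, HasFDerivAt (fun y => C (z y) * Real.exp (z y)) (0 : Coord →L[ℝ] ℝ) x := by
    intro x hx
    have h1 := S.kleinConnection.hasFDerivAt_comp hx
      ((HasDerivAt.of_contDiffOn S.hI S.hC (S.mem hx)).fun_mul (Real.hasDerivAt_exp (z x)))
    refine h1.congr_fderiv ?_
    rw [h x hx]
    ring_nf
    simp
  obtain ⟨a, ha⟩ := S.hU.exists_is_const_of_fderiv_eq_zero hconn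
    (fun x hx => (hd x hx).differentiableAt.differentiableWithinAt)
    (fun x hx => (hd x hx).fderiv)
  refine ⟨a, ?_, fun x hx => ?_⟩
  · rw [← ha x₀ hx₀]
    exact mul_pos (S.hCpos _ (S.mem hx₀)) (Real.exp_pos _)
  · rw [← ha x hx, mul_assoc, ← Real.exp_add]
    simp

/-- Because dz(E_0) = 2F ≠ 0, an identity in z that holds on U may be differentiated with respect to
z. -/
theorem deriv_eq_zero_of_comp (S : Setting I F C U z q) {φ : ℝ → ℝ} {φ' : ℝ} {x : Coord}
    (hx : x ∈ U) (hφ : HasDerivAt φ φ' (z x)) (h : ∀ y ∈ U, φ (z y) = 0) : φ' = 0 := by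
  have h1 := S.kleinConnection.hasFDerivAt_comp hx hφ
  have h2 : HasFDerivAt (fun y => φ (z y)) (0 : Coord →L[ℝ] ℝ) x :=
    (hasFDerivAt_const (0 : ℝ) x).congr_of_eventuallyEq (by
      filter_upwards [S.hU.mem_nhds hx] with y hy using h y hy)
  have h3 := DFunLike.congr_fun (h1.unique h2) (dualVec (fun a => diagCoframe F z q a x) 0)
  have hf := S.hFpos _ (S.mem hx)
  rw [_root_.smul_apply, coframe_dualVec (S.isDiag hx).det] at h3
  simpa [hf.ne'] using h3

theorem deriv_eq_of_exp (S : Setting I F C U z q) {C₀ : ℝ}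
    (h : ∀ x ∈ U, C (z x) = C₀ * Real.exp (-z x)) {x : Coord} (hx : x ∈ U) :
    deriv C (z x) = -C (z x) := by
  have h1 := S.deriv_eq_zero_of_comp hx
    ((HasDerivAt.of_contDiffOn S.hI S.hC (S.mem hx)).fun_sub
      (((hasDerivAt_id (z x)).fun_neg.exp).const_mul C₀)) (fun y hy => by rw [h y hy]; simp)
  have h2 := h x hx
  simp only [id] at h1
  linarith

/-- Differentiating C' = -C once more gives C'' = C, hence p = -1 and p' = 0. -/
theorem logDeriv_eq (S : Setting I F C U z q) (h : ∀ x ∈ U, deriv C (z x) = -C (z x)) {x : Coord}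
    (hx : x ∈ U) : deriv C (z x) / C (z x) = -1 ∧ logDeriv₂ C (z x) = 0 := by
  have hc := (S.hCpos _ (S.mem hx)).ne'
  have h1 := S.deriv_eq_zero_of_comp hx
    ((HasDerivAt.of_contDiffOn S.hI (contDiffOn_deriv S.hI S.hC) (S.mem hx)).fun_add
      (HasDerivAt.of_contDiffOn S.hI S.hC (S.mem hx))) (fun y hy => by rw [h y hy]; ring)
  have h2 := h x hx
  have h3 : deriv (deriv C) (z x) = C (z x) := by linarith
  rw [logDeriv₂, h3, h2]
  constructor <;> field_simp
  ring

theorem scalarCurv_of_deriv_eq (S : Setting I F C U z q)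
    (h : ∀ x ∈ U, deriv C (z x) = -C (z x)) {x : Coord} (hx : x ∈ U) :
    scalarCurv (metric F C z q) x = -(8 / C (z x)) * (opL 1 F (z x) - 1) := by
  obtain ⟨h1, h2⟩ := S.logDeriv_eq h hx
  rw [S.scalarCurv_eq hx, h1, h2, opL_eq S.hI S.hF (by norm_num) (S.mem hx), scalComp, opLValue]
  ring

theorem omega_eq_sum (S : Setting I F C U z q) {x : Coord} (hx : x ∈ U) (ε : ℝ)
    (v : Fin 2 → Coord) : omega ε F C z q x v = ∑ a, weight (F (z x)) (C (z x)) a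
      * (diagCoframe F z q a x (complexStr ε F z q x (v 0)) * diagCoframe F z q a x (v 1)) :=
  (S.isDiag hx).eq _ _

/-- For p = -1 and p' = 0 the Ricci eigenvalues agree on E_0, E_1, as they always do on E_2, E_3. So
ρ is a combination of θ⁰ ∧ θ¹ and θ² ∧ θ³, which ω^+ and ω^- span. -/
theorem ricciForm_of_deriv_eq (S : Setting I F C U z q)
    (h : ∀ x ∈ U, deriv C (z x) = -C (z x)) {x : Coord} (hx : x ∈ U) (v : Fin 2 → Coord) :
    ricciForm F C z q x v = -(2 / C (z x)) * (opL 1 F (z x) - 1) * omega 1 F C z q x v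
      - 2 / C (z x) * (firstOrder (-(1 / 2)) (firstOrder 1 F) (z x) - 1)
        * omega (-1) F C z q x v := by
  have hc := (S.hCpos _ (S.mem hx)).ne'
  obtain ⟨h1, h2⟩ := S.logDeriv_eq h hx
  obtain ⟨a0, a1, a2, a3⟩ := S.diagCoframe_complexStr hx 1 (v 0)
  obtain ⟨b0, b1, b2, b3⟩ := S.diagCoframe_complexStr hx (-1) (v 0)
  have h3 : firstOrder (-(1 / 2)) (firstOrder 1 F) (z x)
      = -(1 / 2) * (deriv (deriv F) (z x) + deriv F (z x)) + (deriv F (z x) + F (z x)) := by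
    rw [firstOrder, (hasDerivAt_firstOrder S.hI S.hF 1 (S.mem hx)).deriv, firstOrder]
    ring
  rw [ricciForm, S.ricci_eq_sum hx, h1, h2, opL_eq S.hI S.hF (by norm_num) (S.mem hx), h3,
    S.omega_eq_sum hx, S.omega_eq_sum hx]
  simp only [Fin.sum_univ_four, Matrix.cons_val, a0, a1, a2, a3, b0, b1, b2, b3, weight, ricDiag,
    opLValue]
  field_simp
  ring

end Setting

/-! ### The Bach tensor -/

theorem covComp_three (γ : Fin 4 → Fin 4 → ℝ) (w : ℝ) (τ τ' : (Fin 3 → Fin 4) → ℝ)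
    (a b c d : Fin 4) : covComp γ w τ τ' ![a, b, c, d]
      = (if a = 0 then w * τ' ![b, c, d] else 0) - (γ a b * τ ![klein a b, c, d]
        + γ a c * τ ![b, klein a c, d] + γ a d * τ ![b, c, klein a d]) := by
  have e0 : Fin.tail ![a, b, c, d] = ![b, c, d] := rfl
  have u0 : ∀ s, Function.update ![b, c, d] 0 s = ![s, c, d] := fun s => by
    ext i; fin_cases i <;> rfl
  have u1 : ∀ s, Function.update ![b, c, d] 1 s = ![b, s, d] := fun s => by
    ext i; fin_cases i <;> rfl
  have u2 : ∀ s, Function.update ![b, c, d] 2 s = ![b, c, s] := fun s => by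
    ext i; fin_cases i <;> rfl
  rw [covComp, e0, Fin.sum_univ_three, u0, u1, u2]
  rfl

theorem covComp_five (γ : Fin 4 → Fin 4 → ℝ) (w : ℝ) (τ τ' : (Fin 5 → Fin 4) → ℝ)
    (a b c d e m : Fin 4) : covComp γ w τ τ' ![a, b, c, d, e, m]
      = (if a = 0 then w * τ' ![b, c, d, e, m] else 0) - (γ a b * τ ![klein a b, c, d, e, m]
        + γ a c * τ ![b, klein a c, d, e, m] + γ a d * τ ![b, c, klein a d, e, m]
        + γ a e * τ ![b, c, d, klein a e, m] + γ a m * τ ![b, c, d, e, klein a m]) := by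
  have e0 : Fin.tail ![a, b, c, d, e, m] = ![b, c, d, e, m] := rfl
  have u0 : ∀ s, Function.update ![b, c, d, e, m] 0 s = ![s, c, d, e, m] := fun s => by
    ext i; fin_cases i <;> rfl
  have u1 : ∀ s, Function.update ![b, c, d, e, m] 1 s = ![b, s, d, e, m] := fun s => by
    ext i; fin_cases i <;> rfl
  have u2 : ∀ s, Function.update ![b, c, d, e, m] 2 s = ![b, c, s, e, m] := fun s => by
    ext i; fin_cases i <;> rfl
  have u3 : ∀ s, Function.update ![b, c, d, e, m] 3 s = ![b, c, d, s, m] := fun s => by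
    ext i; fin_cases i <;> rfl
  have u4 : ∀ s, Function.update ![b, c, d, e, m] 4 s = ![b, c, d, e, s] := fun s => by
    ext i; fin_cases i <;> rfl
  rw [covComp, e0, Fin.sum_univ_five, u0, u1, u2, u3, u4]
  rfl

theorem covComp_add {n : ℕ} (γ : Fin 4 → Fin 4 → ℝ) (w : ℝ) (σ σ' τ τ' : (Fin n → Fin 4) → ℝ)
    (b : Fin (n + 1) → Fin 4) : covComp γ w (fun b => σ b + τ b) (fun b => σ' b + τ' b) b
      = covComp γ w σ σ' b + covComp γ w τ τ' b := by
  simp only [covComp, mul_add, Finset.sum_add_distrib]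
  split_ifs <;> ring

/-- The metric trace over the first and third slots commutes with the covariant derivative, for
the inverse `H` of a parallel diagonal metric. -/
theorem trace_covComp {γ : Fin 4 → Fin 4 → ℝ} {w : ℝ} {H H' : Fin 4 → ℝ}
    (hH : ∀ a k, H k * γ a k + H (klein a k) * γ a (klein a k)
      = -(if a = 0 then w * H' k else 0))
    (S S' : (Fin 5 → Fin 4) → ℝ) (a i j l : Fin 4) :
    ∑ k, H k * covComp γ w S S' ![a, k, i, k, j, l]
      = covComp γ w (fun b => ∑ k, H k * S ![k, b 0, k, b 1, b 2])
          (fun b => ∑ k, (H' k * S ![k, b 0, k, b 1, b 2] + H k * S' ![k, b 0, k, b 1, b 2]))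
          ![a, i, j, l] := by
  have hinv : Function.Involutive (klein a) := klein_klein a
  -- Reindexing by k ↦ a·k pairs the corrections of the two traced slots, so that their coefficients
  -- add up to the combination in `hH`.
  have r : ∑ k, H k * (γ a k * S ![klein a k, i, k, j, l])
      = ∑ k, H (klein a k) * (γ a (klein a k) * S ![k, i, klein a k, j, l]) := by
    rw [← Equiv.sum_comp hinv.toPerm]
    simp only [Function.Involutive.coe_toPerm, klein_klein]
  have h := hH a
  simp only [covComp_five, covComp_three, Matrix.cons_val]
  have h2 : ∑ k, S ![k, i, klein a k, j, l] * (H k * γ a k + H (klein a k) * γ a (klein a k))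
      = -(if a = 0 then ∑ k, w * H' k * S ![k, i, k, j, l] else 0) := by
    by_cases ha : a = 0
    · subst ha
      have h0 : ∀ k, klein 0 k = k := by decide
      simp only [h0, if_true, ← Finset.sum_neg_distrib] at h ⊢
      exact Finset.sum_congr rfl fun k _ => by rw [h]; ring
    · simp [h, ha]
  have h3 : ∑ k, S ![k, i, klein a k, j, l] * (H k * γ a k + H (klein a k) * γ a (klein a k))
      = ∑ k, H k * (γ a k * S ![k, i, klein a k, j, l])
        + ∑ k, H k * (γ a k * S ![klein a k, i, k, j, l]) := by
    rw [r, ← Finset.sum_add_distrib]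
    exact Finset.sum_congr rfl fun k _ => by ring
  rw [h3] at h2
  by_cases ha : a = 0
  · simp only [ha, if_true, Fin.sum_univ_four] at h2 ⊢
    linear_combination -h2
  · simp only [ha, if_false, Fin.sum_univ_four] at h2 ⊢
    linear_combination -h2

/-- The derivative of the inverse of `weight`. -/
noncomputable def weightInvDeriv (f f₁ c c₁ : ℝ) (a : Fin 4) : ℝ :=
  -weightDeriv f f₁ c c₁ a / weight f c a ^ 2

/-- This is ∇g⁻¹ = 0 in components, the hypothesis of `trace_covComp`. -/
theorem weight_compat {f c : ℝ} (hf : f ≠ 0) (hc : c ≠ 0) (f₁ p : ℝ) (a k : Fin 4) :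
    (weight f c k)⁻¹ * conn f f₁ p a k
        + (weight f c (klein a k))⁻¹ * conn f f₁ p a (klein a k)
      = -(if a = 0 then 2 * f * weightInvDeriv f f₁ c (p * c) k else 0) := by
  fin_cases a <;> fin_cases k <;>
    simp [weight, weightDeriv, weightInvDeriv, klein, conn] <;>
    first | done | (field_simp; ring)

/-- The components of `∇^k W_{ikjl}`. -/
noncomputable def divComp (f c : ℝ) (Q₁ Q₂ : ℝ) (b : Fin 3 → Fin 4) : ℝ :=
  2 * c⁻¹ ^ 2 * Q₁ * modelComp 1 f c ![0, b 0, b 1, b 2]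
    + 2 * c⁻¹ ^ 2 * Q₂ * modelComp (-1) f c ![0, b 0, b 1, b 2]

/-- The derivative of `divComp`. -/
noncomputable def divCompDeriv (f f₁ c p Q₁ Q₁' Q₂ Q₂' : ℝ) (b : Fin 3 → Fin 4) : ℝ :=
  2 * c⁻¹ ^ 2 * ((Q₁' - 2 * p * Q₁) * modelComp 1 f c ![0, b 0, b 1, b 2]
      + Q₁ * modelDeriv 1 f f₁ c (p * c) ![0, b 0, b 1, b 2])
    + 2 * c⁻¹ ^ 2 * ((Q₂' - 2 * p * Q₂) * modelComp (-1) f c ![0, b 0, b 1, b 2]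
      + Q₂ * modelDeriv (-1) f f₁ c (p * c) ![0, b 0, b 1, b 2])

-- The letters l, m with their subscripts stand for 𝓛^±F - 1 and its derivatives. The identity holds
-- only after they are expressed by the derivatives of F up to order four; p and p' then cancel. The
-- components of (σ^a)² are the weights, which accounts for the factor `weight f c a`.
set_option maxHeartbeats 4000000 in
theorem bach_comp {f c : ℝ} (hf : f ≠ 0) (hc : c ≠ 0) (f₁ f₂ f₃ f₄ p p₁ l m l₁ m₁ l₂ m₂ : ℝ)
    (hl : l = opLValue 1 f f₁ f₂) (hm : m = opLValue (-1) f f₁ f₂)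
    (hl₁ : l₁ = 1 / 2 * f₃ - 3 / 2 * f₂ + f₁) (hm₁ : m₁ = 1 / 2 * f₃ + 3 / 2 * f₂ + f₁)
    (hl₂ : l₂ = 1 / 2 * f₄ - 3 / 2 * f₃ + f₂) (hm₂ : m₂ = 1 / 2 * f₄ + 3 / 2 * f₃ + f₂)
    (i j : Fin 4) :
    ∑ k, (weight f c k)⁻¹ * covComp (conn f f₁ p) (2 * f)
        (divComp f c (3 / 2 * l + l₁ + l * p / 2) (-(3 / 2) * m + m₁ + m * p / 2))
        (divCompDeriv f f₁ c p (3 / 2 * l + l₁ + l * p / 2)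
          (3 / 2 * l₁ + l₂ + l₁ * p / 2 + l * p₁ / 2) (-(3 / 2) * m + m₁ + m * p / 2)
          (-(3 / 2) * m₁ + m₂ + m₁ * p / 2 + m * p₁ / 2)) ![k, i, j, k]
      + 1 / 2 * ∑ k, (weight f c k)⁻¹ * ((weight f c k)⁻¹ * (ricDiag f f₁ f₂ p p₁ k
        * (-c⁻¹ * l * modelComp 1 f c ![i, k, j, k] + -c⁻¹ * m * modelComp (-1) f c ![i, k, j, k])))
      = diagComp (fun a => weight f c a * ![
          -(8 / (3 * c ^ 2)) * ((-(1 / 2) * f₂ + 3 / 2 * f₁ + f - 1) * l + f₁ * l₁),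
          -2 * (16 / (3 * c ^ 2) * f * (1 / 2 * l₂ + 3 / 2 * l₁ + l))
            - 8 / (3 * c ^ 2) * ((-(1 / 2) * f₂ + 3 / 2 * f₁ + f - 1) * l + f₁ * l₁),
          16 / (3 * c ^ 2) * f * (1 / 2 * l₂ + 3 / 2 * l₁ + l)
            + 8 / (3 * c ^ 2) * ((-(1 / 2) * f₂ + 3 / 2 * f₁ + f - 1) * l + f₁ * l₁),
          16 / (3 * c ^ 2) * f * (1 / 2 * l₂ + 3 / 2 * l₁ + l)
            + 8 / (3 * c ^ 2) * ((-(1 / 2) * f₂ + 3 / 2 * f₁ + f - 1) * l + f₁ * l₁)] a) i j := by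
  simp only [covComp_three, Fin.sum_univ_four]
  rw [opLValue] at hl hm
  fin_cases i <;> fin_cases j <;>
    simp [divComp, divCompDeriv, modelComp, modelDeriv, pairComp, diagComp, omegaComp, omegaDeriv,
      volComp, volSign, weight, weightDeriv, klein, conn, ricDiag] <;>
    first | done | (field_simp; subst hl hm hl₁ hm₁ hl₂ hm₂; ring)

theorem HasComp.bach {ϑ : Fin 4 → Coord →L[ℝ] ℝ} {g : CovTensor 2} {x : Coord} {h : Fin 4 → ℝ}
    (hd : IsDiag g x ϑ h) {σ : (Fin 6 → Fin 4) → ℝ} {ric : (Fin 2 → Fin 4) → ℝ}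
    {τ : (Fin 4 → Fin 4) → ℝ} (hS : HasComp ϑ (covDeriv g (covDeriv g (U2Metric.weyl g)) x) σ)
    (hric : HasComp ϑ (U2Metric.ricci g x) ric) (hW : HasComp ϑ (U2Metric.weyl g x) τ) :
    HasComp ϑ (U2Metric.bach g x) (fun b =>
      (∑ k, (h k)⁻¹ * ∑ l, (h l)⁻¹ * σ ![l, k, b 0, k, b 1, l])
        + 1 / 2 * ∑ k, (h k)⁻¹ * ∑ l, (h l)⁻¹ * (ric ![k, l] * τ ![b 0, k, b 1, l])) := by
  -- The permutations move both traced pairs to the front, in the order l, l', k, k' expected by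
  -- `HasComp.trace_trace`.
  have hs1 : Function.Bijective (![1, 3, 4, 2, 5, 0] : Fin 6 → Fin 6) := by decide
  have hs2 : Function.Bijective (![3, 1, 4, 2, 5, 0] : Fin 6 → Fin 6) := by decide
  have h1 := (hS.reindex _ hs1).trace_trace (n := 2) hd
  have h2 := (((hric.tensor hW).reindex _ hs2).trace_trace (n := 2) hd).const_mul (1 / 2)
  have e1 : ∀ {α : Type} (l l' k k' : α) (v : Fin 2 → α),
      (Fin.cons l (Fin.cons l' (Fin.cons k (Fin.cons k' v))) : Fin 6 → α)
        ∘ (![1, 3, 4, 2, 5, 0] : Fin 6 → Fin 6) = ![l', k', v 0, k, v 1, l] :=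
    fun l l' k k' v => by ext i; fin_cases i <;> rfl
  have e2 : ∀ {α : Type} (l l' k k' : α) (v : Fin 2 → α),
      (fun i => ((Fin.cons l (Fin.cons l' (Fin.cons k (Fin.cons k' v))) : Fin 6 → α)
        ∘ (![3, 1, 4, 2, 5, 0] : Fin 6 → Fin 6)) (Fin.castAdd 4 i)) = ![k', l']
      ∧ (fun i => ((Fin.cons l (Fin.cons l' (Fin.cons k (Fin.cons k' v))) : Fin 6 → α)
        ∘ (![3, 1, 4, 2, 5, 0] : Fin 6 → Fin 6)) (Fin.natAdd 2 i)) = ![v 0, k, v 1, l] :=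
    fun l l' k k' v => by constructor <;> ext i <;> fin_cases i <;> rfl
  have a1 := fun (l l' k k' : Coord) v => e1 l l' k k' v
  have a2 := fun (l l' k k' : Fin 4) v => e1 l l' k k' v
  have b1 := fun (l l' k k' : Coord) v => (e2 l l' k k' v).1
  have b2 := fun (l l' k k' : Coord) v => (e2 l l' k k' v).2
  have b3 := fun (l l' k k' : Fin 4) v => (e2 l l' k k' v).1
  have b4 := fun (l l' k k' : Fin 4) v => (e2 l l' k k' v).2
  simp only [a1, a2] at h1
  simp only [b1, b2, b3, b4] at h2
  exact h1.add h2

/-- The components of the Weyl tensor, as functions of `z`. -/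
noncomputable def weylFun (F C : ℝ → ℝ) (b : Fin 4 → Fin 4) (t : ℝ) : ℝ :=
  -(C t)⁻¹ * (opL 1 F t - 1) * modelComp 1 (F t) (C t) b
    + -(C t)⁻¹ * (opL (-1) F t - 1) * modelComp (-1) (F t) (C t) b

/-- The components of the covariant derivative of the Weyl tensor, as functions of `z`. -/
noncomputable def covWeylFun (F C : ℝ → ℝ) (b : Fin 5 → Fin 4) (t : ℝ) : ℝ :=
  covComp (conn (F t) (deriv F t) (deriv C t / C t)) (2 * F t) (fun b => weylFun F C b t)
    (fun b => deriv (weylFun F C b) t) b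

namespace Setting

variable {I : Set ℝ} {F C : ℝ → ℝ} {U : Set Coord} {z : Coord → ℝ} {q : Coord → Quaternion ℝ}

theorem contDiffOn_modelComp (S : Setting I F C U z q) (ε : ℝ) (b : Fin 4 → Fin 4) :
    ContDiffOn ℝ ∞ (fun t => modelComp ε (F t) (C t) b) I := by
  have h0 : ContDiffOn ℝ ∞ (fun _ : ℝ => (0 : ℝ)) I := contDiffOn_const
  have h1 := contDiffOn_const (c := ε).mul (S.hC.mul S.hF)
  have hω : ∀ a b, ContDiffOn ℝ ∞ (fun t => omegaComp ε (F t) (C t) a b) I := fun a b => by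
    fin_cases a <;> fin_cases b
    exacts [h0, h1, h0, h0, h1.neg, h0, h0, h0, h0, h0, h0, S.hC, h0, h0, S.hC.neg, h0]
  have hw : ∀ a, ContDiffOn ℝ ∞ (fun t => weight (F t) (C t) a) I := fun a => by
    fin_cases a
    exacts [S.hC.mul S.hF, S.hC.mul S.hF, S.hC, S.hC]
  have hg : ∀ a b, ContDiffOn ℝ ∞ (fun t => diagComp (weight (F t) (C t)) a b) I := fun a b => by
    by_cases hab : a = b
    · simp only [diagComp, if_pos hab]; exact hw a
    · simp only [diagComp, if_neg hab]; exact h0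
  exact ((hω _ _).mul (hω _ _)).sub (contDiffOn_const.mul (contDiffOn_const.mul
    ((((hg _ _).mul (hg _ _)).sub ((hg _ _).mul (hg _ _))).add
      (contDiffOn_const.mul (((S.hC.pow 2).mul S.hF).mul contDiffOn_const)))))

theorem contDiffOn_weylFun (S : Setting I F C U z q) (b : Fin 4 → Fin 4) :
    ContDiffOn ℝ ∞ (weylFun F C b) I := by
  have hC := (S.hC.inv fun t ht => (S.hCpos t ht).ne').neg
  exact ((hC.mul ((S.contDiffOn_opL 1).sub contDiffOn_const)).mul
    (S.contDiffOn_modelComp 1 b)).add ((hC.mul ((S.contDiffOn_opL (-1)).sub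
      contDiffOn_const)).mul (S.contDiffOn_modelComp (-1) b))

theorem differentiableAt_covWeylFun (S : Setting I F C U z q) {t : ℝ} (ht : t ∈ I)
    (b : Fin 5 → Fin 4) : DifferentiableAt ℝ (covWeylFun F C b) t := by
  have hF := HasDerivAt.of_contDiffOn S.hI S.hF ht
  have h1 : ∀ b, DifferentiableAt ℝ (weylFun F C b) t := fun b =>
    (HasDerivAt.of_contDiffOn S.hI (S.contDiffOn_weylFun b) ht).differentiableAt
  have h2 : ∀ b, DifferentiableAt ℝ (deriv (weylFun F C b)) t := fun b =>
    (HasDerivAt.of_contDiffOn S.hI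
      (contDiffOn_deriv S.hI (S.contDiffOn_weylFun b)) ht).differentiableAt
  unfold covWeylFun covComp
  refine DifferentiableAt.fun_sub ?_ (DifferentiableAt.fun_sum fun p _ =>
    (S.hasDerivAt_conn ht _ _).differentiableAt.fun_mul (h1 _))
  split_ifs
  · exact (hF.differentiableAt.const_mul 2).fun_mul (h2 _)
  · exact differentiableAt_const _

theorem hasComp_weyl' (S : Setting I F C U z q) {x : Coord} (hx : x ∈ U) :
    HasComp (fun a => diagCoframe F z q a x) (weyl (metric F C z q) x)
      (fun b => weylFun F C b (z x)) := by
  refine (S.hasComp_weyl hx).congr fun b => ?_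
  rw [weylFun, opL_eq S.hI S.hF (by norm_num) (S.mem hx),
    opL_eq S.hI S.hF (by norm_num) (S.mem hx)]

theorem hasComp_covDeriv_weyl (S : Setting I F C U z q) {x : Coord} (hx : x ∈ U) :
    HasComp (fun a => diagCoframe F z q a x)
      (covDeriv (metric F C z q) (weyl (metric F C z q)) x)
      (fun b => covWeylFun F C b (z x)) :=
  S.kleinConnection.hasComp_covDeriv (fun _ hy => S.hasComp_weyl' hy)
    (τ' := fun b => deriv (weylFun F C b))
    (fun _ hy b => HasDerivAt.of_contDiffOn S.hI (S.contDiffOn_weylFun b) (S.mem hy)) hx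

/-- Skew-symmetry of W in its first two indices turns this trace into minus the divergence, and the
divergences of the two parts are known from `trace_covComp_model`. -/
theorem trace_covWeylFun (S : Setting I F C U z q) {t : ℝ} (ht : t ∈ I) (b : Fin 3 → Fin 4) :
    ∑ k, (weight (F t) (C t) k)⁻¹ * covWeylFun F C ![k, b 0, k, b 1, b 2] t
      = divComp (F t) (C t) (divCoeff 1 F C t) (divCoeff (-1) F C t) b := by
  have hf := (S.hFpos t ht).ne'
  have hc := (S.hCpos t ht).ne'
  have hd : ∀ b, deriv (weylFun F C b) t = _ := fun b =>
    ((S.hasDerivAt_weylCoeff 1 ht b).fun_add (S.hasDerivAt_weylCoeff (-1) ht b)).deriv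
  have h1 := trace_covComp_model hf hc (Or.inl rfl) (deriv F t) (deriv C t / C t) (opL 1 F t - 1)
    (deriv (opL 1 F) t) (b 0) (b 1) (b 2)
  have h2 := trace_covComp_model hf hc (Or.inr rfl) (deriv F t) (deriv C t / C t)
    (opL (-1) F t - 1) (deriv (opL (-1) F) t) (b 0) (b 1) (b 2)
  have hswap : ∀ ε k b0 b1 b2, covComp (conn (F t) (deriv F t) (deriv C t / C t)) (2 * F t)
      (fun b => -(C t)⁻¹ * (opL ε F t - 1) * modelComp ε (F t) (C t) b)
      (fun b => ((C t)⁻¹ * (deriv C t / C t) * (opL ε F t - 1) - (C t)⁻¹ * deriv (opL ε F) t)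
          * modelComp ε (F t) (C t) b
        + -(C t)⁻¹ * (opL ε F t - 1)
          * modelDeriv ε (F t) (deriv F t) (C t) (deriv C t / C t * C t) b) ![k, b0, k, b1, b2]
      = -covComp (conn (F t) (deriv F t) (deriv C t / C t)) (2 * F t)
      (fun b => -(C t)⁻¹ * (opL ε F t - 1) * modelComp ε (F t) (C t) b)
      (fun b => ((C t)⁻¹ * (deriv C t / C t) * (opL ε F t - 1) - (C t)⁻¹ * deriv (opL ε F) t)
          * modelComp ε (F t) (C t) b
        + -(C t)⁻¹ * (opL ε F t - 1)
          * modelDeriv ε (F t) (deriv F t) (C t) (deriv C t / C t * C t) b)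
        ![k, k, b0, b1, b2] := fun ε k b0 b1 b2 => by
    refine covComp_swap_left _ _ (fun a b d e => ?_) (fun a b d e => ?_) _ _ _ _ _
    · rw [modelComp_swap]; ring
    · rw [modelComp_swap, modelDeriv_swap]; ring
  simp only [covWeylFun, hd]
  simp only [weylFun, covComp_add, hswap, mul_add, mul_neg, Finset.sum_add_distrib,
    Finset.sum_neg_distrib, h1, h2]
  rw [divComp, divCoeff, divCoeff]
  field_simp
  ring

theorem hasDerivAt_divCoeff (S : Setting I F C U z q) (ε : ℝ) {t : ℝ} (ht : t ∈ I) :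
    HasDerivAt (divCoeff ε F C) (3 / 2 * ε * deriv (opL ε F) t + deriv (deriv (opL ε F)) t
      + deriv (opL ε F) t * (deriv C t / C t) / 2 + (opL ε F t - 1) * logDeriv₂ C t / 2) t := by
  have hL := HasDerivAt.of_contDiffOn S.hI (S.contDiffOn_opL ε) ht
  have hL' := HasDerivAt.of_contDiffOn S.hI (contDiffOn_deriv S.hI (S.contDiffOn_opL ε)) ht
  have hp := hasDerivAt_logDeriv S.hI S.hC ht (S.hCpos t ht).ne'
  exact ((((hL.sub_const 1).const_mul (3 / 2 * ε)).fun_add hL').fun_add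
    (((hL.sub_const 1).fun_mul hp).div_const 2)).congr_deriv (by ring)

theorem hasDerivAt_divComp (S : Setting I F C U z q) {Q₁ Q₂ : ℝ → ℝ} {Q₁' Q₂' t : ℝ} (ht : t ∈ I)
    (h1 : HasDerivAt Q₁ Q₁' t) (h2 : HasDerivAt Q₂ Q₂' t) (b : Fin 3 → Fin 4) :
    HasDerivAt (fun t => divComp (F t) (C t) (Q₁ t) (Q₂ t) b)
      (divCompDeriv (F t) (deriv F t) (C t) (deriv C t / C t) (Q₁ t) Q₁' (Q₂ t) Q₂' b) t := by
  have hc := (S.hCpos t ht).ne'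
  have hF := HasDerivAt.of_contDiffOn S.hI S.hF ht
  have hC := HasDerivAt.of_contDiffOn S.hI S.hC ht
  have hi : HasDerivAt (fun t => 2 * (C t)⁻¹ ^ 2) (-4 * deriv C t / C t ^ 3) t :=
    (((hC.fun_inv hc).fun_pow 2).const_mul 2).congr_deriv (by simp; field_simp; ring)
  rw [divCompDeriv, div_mul_cancel₀ _ hc]
  refine (((hi.fun_mul h1).fun_mul (hasDerivAt_modelComp hF hC 1 _)).fun_add
    ((hi.fun_mul h2).fun_mul (hasDerivAt_modelComp hF hC (-1) _))).congr_deriv ?_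
  field_simp
  ring

theorem hasDerivAt_weightInv (S : Setting I F C U z q) {t : ℝ} (ht : t ∈ I) (k : Fin 4) :
    HasDerivAt (fun t => (weight (F t) (C t) k)⁻¹)
      (weightInvDeriv (F t) (deriv F t) (C t) (deriv C t / C t * C t) k) t := by
  have hc := (S.hCpos t ht).ne'
  have hf := (S.hFpos t ht).ne'
  rw [div_mul_cancel₀ _ hc]
  refine (hasDerivAt_weight (HasDerivAt.of_contDiffOn S.hI S.hF ht)
    (HasDerivAt.of_contDiffOn S.hI S.hC ht) k).fun_inv ?_
  fin_cases k <;> simp [weight, hf, hc]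

theorem bach_formula (S : Setting I F C U z q) {x : Coord} (hx : x ∈ U) (v : Fin 2 → Coord) :
    bach (metric F C z q) x v
      = 16 / (3 * C (z x) ^ 2) * F (z x) * (opL (-1) (opL 1 F) (z x) - 1)
          * (-2 * sigmaSq F C z q 1 x v + sigmaSq F C z q 2 x v + sigmaSq F C z q 3 x v)
        + 8 / (3 * C (z x) ^ 2) * opB F (z x)
          * (-sigmaSq F C z q 0 x v - sigmaSq F C z q 1 x v
            + sigmaSq F C z q 2 x v + sigmaSq F C z q 3 x v) := by
  have ht := S.mem hx
  have hf := (S.hFpos _ ht).ne'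
  have hc := (S.hCpos _ ht).ne'
  have h2 := S.kleinConnection.hasComp_covDeriv (τ := covWeylFun F C)
    (τ' := fun b => deriv (covWeylFun F C b)) (fun _ hy => S.hasComp_covDeriv_weyl hy)
    (fun _ hy b => (S.differentiableAt_covWeylFun (S.mem hy) b).hasDerivAt) hx
  have hB := HasComp.bach (S.isDiag hx) h2 (S.hasComp_ricci hx) (S.hasComp_weyl' hx)
  have hL : ∀ ε, ε * ε = 1 → opL ε F (z x) - 1 = _ := fun ε hε => opL_eq S.hI S.hF hε ht
  have hF0 := fun s (hs : s ∈ I) => HasDerivAt.of_contDiffOn S.hI S.hF hs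
  have hF1 := fun s (hs : s ∈ I) => HasDerivAt.of_contDiffOn S.hI (contDiffOn_deriv S.hI S.hF) hs
  have hF2 := fun s (hs : s ∈ I) => HasDerivAt.of_contDiffOn S.hI
    (contDiffOn_deriv S.hI (contDiffOn_deriv S.hI S.hF)) hs
  have hF3 := fun s (hs : s ∈ I) => HasDerivAt.of_contDiffOn S.hI
    (contDiffOn_deriv S.hI (contDiffOn_deriv S.hI (contDiffOn_deriv S.hI S.hF))) hs
  -- The formula is established on all of I, so that it can be differentiated again for the second
  -- derivative.
  have hL1 : ∀ ε, ε * ε = 1 → ∀ s ∈ I, deriv (opL ε F) s = 1 / 2 * deriv (deriv (deriv F)) s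
      - 3 / 2 * ε * deriv (deriv F) s + deriv F s := fun ε hε s hs => by
    have h : HasDerivAt (fun t => 1 / 2 * deriv (deriv F) t - 3 / 2 * ε * deriv F t + F t - 1 + 1)
        (1 / 2 * deriv (deriv (deriv F)) s - 3 / 2 * ε * deriv (deriv F) s + deriv F s) s :=
      (((((hF2 s hs).const_mul (1 / 2)).fun_sub ((hF1 s hs).const_mul (3 / 2 * ε))).fun_add
        (hF0 s hs)).sub_const 1).add_const 1
    refine (h.congr_of_eventuallyEq ?_).deriv
    filter_upwards [S.hI.mem_nhds hs] with r hr
    have := opL_eq S.hI S.hF hε hr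
    rw [opLValue] at this
    linarith
  have hL2 : ∀ ε, ε * ε = 1 → deriv (deriv (opL ε F)) (z x)
      = 1 / 2 * deriv (deriv (deriv (deriv F))) (z x)
        - 3 / 2 * ε * deriv (deriv (deriv F)) (z x) + deriv (deriv F) (z x) := fun ε hε => by
    refine (((((hF3 _ ht).const_mul (1 / 2)).fun_sub ((hF2 _ ht).const_mul (3 / 2 * ε))).fun_add
        (hF1 _ ht)).congr_of_eventuallyEq ?_).deriv
    filter_upwards [S.hI.mem_nhds ht] with r hr using hL1 ε hε r hr
  have hY := S.trace_covWeylFun ht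
  -- The derivatives of the individual components of ∇W are never computed: only their trace
  -- matters, and it follows by differentiating the identity for ∇^k W_{ikjl} along z.
  have hY' : ∀ b : Fin 3 → Fin 4, ∑ k, (weightInvDeriv (F (z x)) (deriv F (z x)) (C (z x))
        (deriv C (z x) / C (z x) * C (z x)) k * covWeylFun F C ![k, b 0, k, b 1, b 2] (z x)
      + (weight (F (z x)) (C (z x)) k)⁻¹ * deriv (covWeylFun F C ![k, b 0, k, b 1, b 2]) (z x))
      = _ := fun b => by
    have e1 : HasDerivAt (fun t => ∑ k, (weight (F t) (C t) k)⁻¹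
        * covWeylFun F C ![k, b 0, k, b 1, b 2] t) _ (z x) :=
      HasDerivAt.fun_sum fun k _ => (S.hasDerivAt_weightInv ht k).fun_mul
        (S.differentiableAt_covWeylFun ht ![k, b 0, k, b 1, b 2]).hasDerivAt
    refine e1.unique ((S.hasDerivAt_divComp ht (S.hasDerivAt_divCoeff 1 ht)
      (S.hasDerivAt_divCoeff (-1) ht) b).congr_of_eventuallyEq ?_)
    filter_upwards [S.hI.mem_nhds ht] with s hs using S.trace_covWeylFun hs b
  -- The inner trace is carried through the outer covariant derivative, which reduces the
  -- second-order term to a divergence of `divComp`.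
  have hsum : ∀ i j, ∑ k, (weight (F (z x)) (C (z x)) k)⁻¹
      * ∑ l, (weight (F (z x)) (C (z x)) l)⁻¹
        * covComp (fun a b => conn (F (z x)) (deriv F (z x)) (deriv C (z x) / C (z x)) a b)
          (2 * F (z x)) (fun b => covWeylFun F C b (z x))
          (fun b => deriv (covWeylFun F C b) (z x)) ![l, k, i, k, j, l]
      = ∑ l, (weight (F (z x)) (C (z x)) l)⁻¹
        * covComp (conn (F (z x)) (deriv F (z x)) (deriv C (z x) / C (z x))) (2 * F (z x))
          (divComp (F (z x)) (C (z x)) (divCoeff 1 F C (z x)) (divCoeff (-1) F C (z x)))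
          (divCompDeriv (F (z x)) (deriv F (z x)) (C (z x)) (deriv C (z x) / C (z x))
            (divCoeff 1 F C (z x)) (3 / 2 * 1 * deriv (opL 1 F) (z x)
              + deriv (deriv (opL 1 F)) (z x) + deriv (opL 1 F) (z x) * (deriv C (z x) / C (z x)) / 2
              + (opL 1 F (z x) - 1) * logDeriv₂ C (z x) / 2)
            (divCoeff (-1) F C (z x)) (3 / 2 * -1 * deriv (opL (-1) F) (z x)
              + deriv (deriv (opL (-1) F)) (z x)
              + deriv (opL (-1) F) (z x) * (deriv C (z x) / C (z x)) / 2
              + (opL (-1) F (z x) - 1) * logDeriv₂ C (z x) / 2)) ![l, i, j, l] := fun i j => by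
    have e := fun l => trace_covComp (weight_compat hf hc (deriv F (z x)) (deriv C (z x) / C (z x)))
      (fun b => covWeylFun F C b (z x)) (fun b => deriv (covWeylFun F C b) (z x)) l i j l
    simp only [hY, hY'] at e
    simp only [Finset.mul_sum]
    rw [Finset.sum_comm]
    refine Finset.sum_congr rfl fun l _ => ?_
    rw [← e, Finset.mul_sum]
    exact Finset.sum_congr rfl fun k _ => by ring
  have hLL : opL (-1) (opL 1 F) (z x) - 1 = 1 / 2 * deriv (deriv (opL 1 F)) (z x)
      + 3 / 2 * deriv (opL 1 F) (z x) + (opL 1 F (z x) - 1) := by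
    rw [opL_eq S.hI (S.contDiffOn_opL 1) (by norm_num) ht, opLValue]
    ring
  have key := fun i j => bach_comp hf hc (deriv F (z x)) (deriv (deriv F) (z x))
    (deriv (deriv (deriv F)) (z x)) (deriv (deriv (deriv (deriv F))) (z x))
    (deriv C (z x) / C (z x)) (logDeriv₂ C (z x)) (opL 1 F (z x) - 1) (opL (-1) F (z x) - 1)
    (deriv (opL 1 F) (z x)) (deriv (opL (-1) F) (z x)) (deriv (deriv (opL 1 F)) (z x))
    (deriv (deriv (opL (-1) F)) (z x)) (hL 1 (by norm_num)) (hL (-1) (by norm_num))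
    ((hL1 1 (by norm_num) _ ht).trans (by ring)) ((hL1 (-1) (by norm_num) _ ht).trans (by ring))
    ((hL2 1 (by norm_num)).trans (by ring)) ((hL2 (-1) (by norm_num)).trans (by ring)) i j
  have q1 : divCoeff 1 F C (z x) = 3 / 2 * (opL 1 F (z x) - 1) + deriv (opL 1 F) (z x)
      + (opL 1 F (z x) - 1) * (deriv C (z x) / C (z x)) / 2 := by rw [divCoeff]; ring
  have q2 : divCoeff (-1) F C (z x) = -(3 / 2) * (opL (-1) F (z x) - 1)
      + deriv (opL (-1) F) (z x) + (opL (-1) F (z x) - 1) * (deriv C (z x) / C (z x)) / 2 := by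
    rw [divCoeff]; ring
  have q3 : (3 / 2 * -1 : ℝ) = -(3 / 2) := by norm_num
  simp only [q1, q2, q3, mul_one] at hsum
  have hric : ∀ i j : Fin 4, ∑ k, (weight (F (z x)) (C (z x)) k)⁻¹
      * ∑ l, (weight (F (z x)) (C (z x)) l)⁻¹
        * (diagComp (ricDiag (F (z x)) (deriv F (z x)) (deriv (deriv F) (z x))
          (deriv C (z x) / C (z x)) (logDeriv₂ C (z x))) k l * weylFun F C ![i, k, j, l] (z x))
      = ∑ k, (weight (F (z x)) (C (z x)) k)⁻¹ * ((weight (F (z x)) (C (z x)) k)⁻¹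
        * (ricDiag (F (z x)) (deriv F (z x)) (deriv (deriv F) (z x))
          (deriv C (z x) / C (z x)) (logDeriv₂ C (z x)) k * weylFun F C ![i, k, j, k] (z x))) :=
    fun i j => by simp [diagComp]
  have hv : v = ![v 0, v 1] := by ext i; fin_cases i <;> rfl
  conv_lhs => rw [hv]
  rw [hB.sum_two]
  have hcomp : ∀ i j, _ = _ := fun i j =>
    (congrArg₂ (fun a b => a + 1 / 2 * b) (hsum i j) (hric i j)).trans (key i j)
  simp only [Matrix.cons_val, hcomp]
  simp only [S.sigmaSq_eq hx, hLL, opB, Fin.sum_univ_four]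
  simp [diagComp, weight]
  ring

end Setting

end U2Metric

theorem mainTheorem6
    (I : Set ℝ) (hI : IsOpen I) (F C : ℝ → ℝ)
    (hF : ContDiffOn ℝ ∞ F I) (hC : ContDiffOn ℝ ∞ C I)
    (hFpos : ∀ t ∈ I, 0 < F t) (hCpos : ∀ t ∈ I, 0 < C t)
    (U : Set Coord) (hU : IsOpen U) (z : Coord → ℝ) (q : Coord → Quaternion ℝ)
    (hzq : IsLocalDiffeo I U z q) :
    -- the scalar curvature
    (∀ x ∈ U, scalarCurv (metric F C z q) x
      = -4 * (C (z x))⁻¹ * (deriv (deriv F) (z x) + (1 / 2) * F (z x) - 2)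
        - 24 * C (z x) ^ (-(3 / 2) : ℝ)
          * deriv (fun t => F t * deriv (fun s => C s ^ (1 / 2 : ℝ)) t) (z x))
    -- the trace-free Ricci tensor
    ∧ (∀ x ∈ U, ∀ v : Fin 2 → Coord, tracefreeRicci (metric F C z q) x v
      = 4 * F (z x) * C (z x) ^ (-(1 / 2) : ℝ)
          * (deriv (deriv fun s => C s ^ (-(1 / 2) : ℝ)) (z x)
            - (1 / 4) * C (z x) ^ (-(1 / 2) : ℝ))
          * (sigmaSq F C z q 0 x v - sigmaSq F C z q 1 x v)
        + 2 * (C (z x) ^ (-(1 / 2) : ℝ)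
              * deriv (fun t => F t * deriv (fun s => C s ^ (-(1 / 2) : ℝ)) t) (z x)
            - (C (z x))⁻¹ * ((1 / 2) * deriv (deriv F) (z x) - (3 / 4) * F (z x) + 1))
          * (sigmaSq F C z q 0 x v + sigmaSq F C z q 1 x v
            - sigmaSq F C z q 2 x v - sigmaSq F C z q 3 x v))
    -- the Weyl curvatures and their divergences
    ∧ (∀ ε : ℝ, ε = 1 ∨ ε = -1 →
        (∀ x ∈ U, ∀ v : Fin 4 → Coord, weylPart ε (metric F C z q) (volForm F C z q) x v
          = -(C (z x))⁻¹ * (opL ε F (z x) - 1) * weylModel ε F C z q x v)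
        ∧ (∀ x ∈ U, opL ε F (z x) ≠ 1 → ∀ v : Fin 3 → Coord,
          divergence (metric F C z q) (weylPart ε (metric F C z q) (volForm F C z q)) x v
            = weylPart ε (metric F C z q) (volForm F C z q) x
                ![grad (metric F C z q)
                    (fun y => Real.log |divPotential ε F C (z y)|) x, v 0, v 1, v 2])
        ∧ (∀ x ∈ U, ∀ v : Fin 3 → Coord,
          divergence (metric F C z q) (weylPart ε (metric F C z q) (volForm F C z q)) x v
            = -C (z x) ^ (-(3 / 2) : ℝ) * Real.exp (-ε * (3 / 2) * z x)
              * weylModel ε F C z q x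
                ![grad (metric F C z q) (fun y => divPotential ε F C (z y)) x, v 0, v 1, v 2]))
    -- the Bach tensor
    ∧ (∀ x ∈ U, ∀ v : Fin 2 → Coord, bach (metric F C z q) x v
      = 16 / (3 * C (z x) ^ 2) * F (z x) * (opL (-1) (opL 1 F) (z x) - 1)
          * (-2 * sigmaSq F C z q 1 x v + sigmaSq F C z q 2 x v + sigmaSq F C z q 3 x v)
        + 8 / (3 * C (z x) ^ 2) * opB F (z x)
          * (-sigmaSq F C z q 0 x v - sigmaSq F C z q 1 x v
            + sigmaSq F C z q 2 x v + sigmaSq F C z q 3 x v))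
    -- the case of a Kähler metric with respect to `J⁺`
    ∧ (IsPreconnected U → IsKahlerOn U (metric F C z q) (complexStr 1 F z q) →
        ∃ C₀ : ℝ, 0 < C₀ ∧ ∀ x ∈ U, C (z x) = C₀ * Real.exp (-z x))
    ∧ (IsKahlerOn U (metric F C z q) (complexStr 1 F z q)
          ∨ (∃ C₀ : ℝ, 0 < C₀ ∧ ∀ x ∈ U, C (z x) = C₀ * Real.exp (-z x)) →
        (∀ x ∈ U, scalarCurv (metric F C z q) x = -(8 / C (z x)) * (opL 1 F (z x) - 1))
        ∧ (∀ x ∈ U, ∀ v : Fin 2 → Coord, ricciForm F C z q x v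
          = -(2 / C (z x)) * (opL 1 F (z x) - 1) * omega 1 F C z q x v
            - 2 / C (z x) * (firstOrder (-(1 / 2)) (firstOrder 1 F) (z x) - 1)
              * omega (-1) F C z q x v)) := by
  have S : Setting I F C U z q := ⟨hI, hF, hC, hFpos, hCpos, hU, hzq⟩
  refine ⟨fun x hx => S.scalarCurv_formula hx, fun x hx v => S.tracefreeRicci_formula hx v,
    fun ε hε => ⟨fun x hx v => S.weylPart_formula hε hx v,
      fun x hx hL v => S.divergence_formula_log hε hx hL v,
      fun x hx v => S.divergence_formula hε hx v⟩,
    fun x hx v => S.bach_formula hx v,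
    fun hconn hK => S.exists_eq_mul_exp hconn fun x hx => S.deriv_eq_of_closed hx (hK.closed x hx),
    fun h => ?_⟩
  -- Either alternative yields C' = -C along U, from which both formulas are derived without
  -- connectedness.
  have hd : ∀ x ∈ U, deriv C (z x) = -C (z x) := by
    rcases h with hK | ⟨C₀, -, hC₀⟩
    · exact fun x hx => S.deriv_eq_of_closed hx (hK.closed x hx)
    · exact fun x hx => S.deriv_eq_of_exp hC₀ hx
  exact ⟨fun x hx => S.scalarCurv_of_deriv_eq hd hx, fun x hx v => S.ricciForm_of_deriv_eq hd hx v⟩
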